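/- **Setting.** Let $k\in\mathbb N$, let $\Gamma\in\mathbb R^{k\times k}$ be symmetric positive definite with smallest eigenvalue at least $\mu_{\min}\in(0,1]$, and let $C\ge 1$, $\beta\ge 1$, $0<p\le\min\{\frac23,\frac1\beta\}$ with $p\ne\frac1\beta$. Let $\boldsymbol b=(b_j)_{j\ge1}\in\ell^p(\mathbb N)$ be nonnegative. Let $\Xi$ be a set, $\Theta_s:=[-\frac12,\frac12]^s$, and let $G_s:\Theta_s\times\Xi\to\mathbb R^k$, $s\in\mathbb N$, be maps that are smooth in $\boldsymbol\theta$ and satisfy $$\|\partial_{\boldsymbol\theta}^{\boldsymbol\nu}G_s(\boldsymbol\theta,\boldsymbol\xi)\|\le C(|\boldsymbol\nu|!)^\beta\,\boldsymbol b^{\boldsymbol\nu}\quad\text{for all }s\in\mathbb N,\ \boldsymbol\nu\in\mathbb N_0^s,\ \boldsymbol\theta\in\Theta_s,\ \boldsymbol\xi\in\Xi .$$ Put $f(\boldsymbol\theta,\boldsymbol y):=\det(2\pi\Gamma)^{-1/2}\exp\big(-\tfrac12(\boldsymbol y-G_s(\boldsymbol\theta,\boldsymbol\xi))^{\rm T}\Gamma^{-1}(\boldsymbol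 y-G_s(\boldsymbol\theta,\boldsymbol\xi))\big)$, $g(x):=x\log x$ and, for $K>0$, $$\mathcal I_K:=\int_{[-K,K]^k}g\Big(\int_{\Theta_s}f(\boldsymbol\theta,\boldsymbol y)\,{\rm d}\boldsymbol\theta\Big)\,{\rm d}\boldsymbol y .$$ **Cubature.** For $n=2^\ell$, $\ell\ge0$, generating vectors $\boldsymbol z_1\in\mathbb N_0^k$, $\boldsymbol z_2\in\mathbb N_0^s$ and independent shifts $\boldsymbol\Delta_1\sim\mathcal U([0,1]^k)$, $\boldsymbol\Delta_2\sim\mathcal U([0,1]^s)$, the full tensor product approximation of $\mathcal I_K$ is $$\mathcal Q_\ell:=\frac{(2K)^k}{n}\sum_{i=1}^{n}g\Big(\frac1n\sum_{m=1}^{n}f\big(\{\tfrac{m\boldsymbol z_2}{n}+\boldsymbol\Delta_2\}-\tfrac{\mathbf 1}{\mathbf 2},\ 2K\{\tfrac{i\boldsymbol z_1}{n}+\boldsymbol\Delta_1\}-K\mathbf 1\big)\Big),$$ where $\{\cdot\}$ is the componentwise fractional part. **CBC algorithm.** Given weights $(\gamma_{\mathfrak u})_{\mathfrak u\subseteq\{1:d\}}$,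 a vector $\boldsymbol z\in\{0,\dots,n-1\}^d$ is obtained with the component-by-component (CBC) algorithm if, successively for $j=1,\dots,d$, with $z_1,\dots,z_{j-1}$ fixed, $z_j$ minimises among all elements of $\{0,\dots,n-1\}$ coprime to $n$ the squared shift-averaged worst-case error in the unanchored weighted Sobolev space, $$\sum_{\varnothing\ne\mathfrak u\subseteq\{1:j\}}\gamma_{\mathfrak u}\,\frac1n\sum_{i=1}^n\prod_{r\in\mathfrak u}B_2\big(\{\tfrac{iz_r}{n}\}\big),\qquad B_2(x)=x^2-x+\tfrac16 ,$$ with ties broken arbitrarily. **Statement.** Let $K>0$, let $(\gamma_{1,\mathfrak u})_{\mathfrak u\subseteq\{1:k\}}$ be any positive weights, and let $\delta'\in(0,\frac12)$ and $\delta>0$ be arbitrary. Let $$\gamma_{2,\mathfrak u}:=\bigg((|\mathfrak u|!)^\beta\prod_{j\in\mathfrak u}\frac{c_j}{\sqrt{2\zeta(2\lambda)/(2\pi^2)^\lambda}}\bigg)^{\frac{2}{1+\lambda}},\qquad c_j:=\frac{2^\beta C}{\sqrt{\mu_{\min}}}\,b_j,\qquad\lambda:=\frac1{2-2\delta'},\qquad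 \mathfrak u\subseteq\{1:s\}.$$ Then there is a constant $C'>0$, independent of the parameter dimension $s$, of $\ell$ and of $\boldsymbol\xi$, such that for all $s\ge1$, $\boldsymbol\xi\in\Xi$ and $\ell\ge0$, whenever $\boldsymbol z_1$ is obtained with the CBC algorithm with weights $(\gamma_{1,\mathfrak u})$ and $\boldsymbol z_2$ is obtained with the CBC algorithm with the product-and-order dependent weights $(\gamma_{2,\mathfrak u})$, both with $n=2^\ell$, $$\sqrt{\mathbb E_{\boldsymbol\Delta_1,\boldsymbol\Delta_2}\big[|\mathcal I_K-\mathcal Q_\ell|^2\big]}\le C'\,(2^\ell)^{-\frac12+\delta}.$$ -/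

import Mathlib

open MeasureTheory
open scoped Nat ContDiff

noncomputable section

namespace BayesQMC

/-! ### The model problem -/

/-- The parameter domain `Θ_s = [-1/2, 1/2]^s`. -/
def paramBox (s : ℕ) : Set (Fin s → ℝ) :=
  Set.Icc (fun _ => -(1 / 2)) (fun _ => 1 / 2)

/-- The list of coordinate directions in which a multi-index `ν` differentiates: each `j` occurs
`ν j` times, so the length of the list is `|ν|`. -/
def multiIndexDirs {s : ℕ} (ν : Fin s → ℕ) : List (Fin s) :=
  (List.finRange s).flatMap fun j => List.replicate (ν j) j

/-- The mixed partial derivative `∂^ν F (θ)`, with one-sided derivatives at the boundary of the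
domain `S`: the iterated derivative of `F` on `S`, evaluated on the coordinate directions of `ν`. -/
def mixedPartial {s : ℕ} {E : Type*} [NormedAddCommGroup E] [NormedSpace ℝ E]
    (ν : Fin s → ℕ) (F : (Fin s → ℝ) → E) (S : Set (Fin s → ℝ)) (θ : Fin s → ℝ) : E :=
  iteratedFDerivWithin ℝ (multiIndexDirs ν).length F S θ
    fun i => Pi.single ((multiIndexDirs ν).get i) (1 : ℝ)

/-- `f(θ, y) = C_{k,Γ} exp(-‖y - G(θ)‖²_{Γ⁻¹} / 2)` with `C_{k,Γ} = det(2πΓ)^{-1/2}` and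
`‖v‖²_{Γ⁻¹} = vᵀ Γ⁻¹ v`. -/
def likelihood {k s : ℕ} (Γ : Matrix (Fin k) (Fin k) ℝ)
    (G : (Fin s → ℝ) → EuclideanSpace ℝ (Fin k)) (θ : Fin s → ℝ) (y : Fin k → ℝ) : ℝ :=
  1 / Real.sqrt ((2 * Real.pi) • Γ).det *
    Real.exp (-(1 / 2) * ((fun i => y i - G θ i) ⬝ᵥ Γ⁻¹.mulVec (fun i => y i - G θ i)))

/-- `g(x) = x log x`. -/
def xlogx (x : ℝ) : ℝ := x * Real.log x

/-- The truncated double integral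
`𝓘_K = ∫_{[-K,K]^k} log(∫_{Θ_s} f(θ,y) dθ) ∫_{Θ_s} f(θ,y) dθ dy`. -/
def doubleIntegral {k s : ℕ} (Γ : Matrix (Fin k) (Fin k) ℝ)
    (G : (Fin s → ℝ) → EuclideanSpace ℝ (Fin k)) (K : ℝ) : ℝ :=
  ∫ y in Set.Icc (fun _ : Fin k => -K) (fun _ => K),
    xlogx (∫ θ in paramBox s, likelihood Γ G θ y)

/-! ### Randomly shifted rank-1 lattice rules -/

/-- The shifted lattice point `{i z / n + Δ}` in `[0,1)^d` (componentwise fractional part). -/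
def shiftedLatticePoint {d : ℕ} (n : ℕ) (z : Fin d → ℕ) (Δ : Fin d → ℝ) (i : ℕ) : Fin d → ℝ :=
  fun j => Int.fract ((i : ℝ) * (z j : ℝ) / (n : ℝ) + Δ j)

/-- The randomly shifted lattice rule `n⁻¹ ∑_{i=1}^n F({i z / n + Δ})` on `[0,1]^d`. -/
def latticeRule {d : ℕ} (n : ℕ) (z : Fin d → ℕ) (Δ : Fin d → ℝ) (F : (Fin d → ℝ) → ℝ) : ℝ :=
  (1 / (n : ℝ)) * ∑ i ∈ Finset.Icc 1 n, F (shiftedLatticePoint n z Δ i)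

/-- The uniform distribution on `[0,1]^d`. -/
def uniformCube (d : ℕ) : Measure (Fin d → ℝ) :=
  volume.restrict (Set.Icc (fun _ => 0) (fun _ => 1))

/-- The Bernoulli polynomial `B₂(x) = x² - x + 1/6`. -/
def bernoulliTwo (x : ℝ) : ℝ := x ^ 2 - x + 1 / 6

/-- The squared shift-averaged worst-case error, in the unanchored Sobolev space with weights `γ`,
of the `n`-point lattice rule in the coordinates `D` with generating vector `z`:
`∑_{∅ ≠ u ⊆ D} γ_u n⁻¹ ∑_{i=1}^n ∏_{j ∈ u} B₂({i z_j / n})`. -/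
def shiftAveragedErrorSq {d : ℕ} (n : ℕ) (γ : Finset (Fin d) → ℝ) (D : Finset (Fin d))
    (z : Fin d → ℕ) : ℝ :=
  ∑ u ∈ D.powerset with u.Nonempty,
    γ u * ((1 / (n : ℝ)) * ∑ i ∈ Finset.Icc 1 n,
      ∏ j ∈ u, bernoulliTwo (Int.fract ((i : ℝ) * (z j : ℝ) / (n : ℝ))))

/-- `z` is an output of the component-by-component algorithm with `n` points and input weights
`γ`: for `j = 1, 2, …`, with `z_1, …, z_{j-1}` already chosen, `z_j` is one of the
`0 ≤ w < n` coprime to `n` which minimise the shift-averaged worst-case error of the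
`j`-dimensional rule with generating vector `(z_1, …, z_{j-1}, w)`. Ties are broken arbitrarily. -/
def IsCBCVector {d : ℕ} (n : ℕ) (γ : Finset (Fin d) → ℝ) (z : Fin d → ℕ) : Prop :=
  ∀ j : Fin d, z j < n ∧ (z j).Coprime n ∧
    ∀ w : ℕ, w < n → w.Coprime n →
      shiftAveragedErrorSq n γ (Finset.Iic j) z ≤
        shiftAveragedErrorSq n γ (Finset.Iic j) (Function.update z j w)

/-- `ϱ(λ) = 2 ζ(2λ) / (2π²)^λ`, with `ζ(x) = ∑_{m ≥ 1} m^{-x}`. -/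
def varrho (lam : ℝ) : ℝ :=
  2 * (∑' m : ℕ, ((m : ℝ) + 1) ^ (-(2 * lam))) / (2 * Real.pi ^ 2) ^ lam

/-- The product-and-order dependent (POD) weights
`γ_u = ((|u|!)^β ∏_{j ∈ u} c_j / √ϱ(λ))^{2/(1+λ)}`, where `c_j = 2^β C μ^{-1/2} b_j` and
`λ = 1/(2-2δ)`. -/
def podWeight (s : ℕ) (C β μ δ : ℝ) (b : ℕ → ℝ) (u : Finset (Fin s)) : ℝ :=
  (((u.card)! : ℝ) ^ β *
      ∏ j ∈ u, ((2 : ℝ) ^ β * C / Real.sqrt μ * b j) / Real.sqrt (varrho (1 / (2 - 2 * δ)))) ^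
    (2 / (1 + 1 / (2 - 2 * δ)))

/-! ### The full tensor product cubature -/

/-- The full tensor product cubature `(2K)^k Q^{(1)} g(Q^{(2)} f)` for `𝓘_K`. The outer rule
(generating vector `z₁`, shift `Δ₁`) is scaled from `[0,1]^k` to `[-K,K]^k`, the inner rule
(generating vector `z₂`, shift `Δ₂`) is translated from `[0,1]^s` to `Θ_s`. -/
def fullTensorCubature {k s : ℕ} (Γ : Matrix (Fin k) (Fin k) ℝ)
    (G : (Fin s → ℝ) → EuclideanSpace ℝ (Fin k)) (K : ℝ) (n : ℕ)
    (z₁ : Fin k → ℕ) (z₂ : Fin s → ℕ) (Δ₁ : Fin k → ℝ) (Δ₂ : Fin s → ℝ) : ℝ :=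
  (2 * K) ^ k * latticeRule n z₁ Δ₁ fun y =>
    xlogx (latticeRule n z₂ Δ₂ fun θ =>
      likelihood Γ G (fun j => θ j - 1 / 2) (fun i => 2 * K * y i - K))

/-- The root-mean-square error of the full tensor product cubature with respect to independent
uniform shifts `Δ₁` and `Δ₂`, i.e. the `L²` norm of the error. -/
def fullTensorRMSError {k s : ℕ} (Γ : Matrix (Fin k) (Fin k) ℝ)
    (G : (Fin s → ℝ) → EuclideanSpace ℝ (Fin k)) (K : ℝ) (n : ℕ)
    (z₁ : Fin k → ℕ) (z₂ : Fin s → ℕ) : ENNReal :=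
  eLpNorm
    (fun Δ : (Fin k → ℝ) × (Fin s → ℝ) =>
      doubleIntegral Γ G K - fullTensorCubature Γ G K n z₁ z₂ Δ.1 Δ.2)
    2 ((uniformCube k).prod (uniformCube s))

end BayesQMC

end

namespace BayesQMC

/-! ### Averages of `B₂` over the reduced residues modulo a power of two -/

/-! Let `H` be the exact inner integral as a function of the outer variable, `Q` its approximation
by the shifted inner rule, and g(x) = x log x. The error is the sum of ∫ g(H) - ∫ g(Q), caused by
the inner rule, and of the error of the outer rule for the integrand g(Q). Both have mean square
O(1/n) with constants free of the dimension s, so the root mean square error is O(n^(-1/2)); δ is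
only slack.

Both estimates come from one bound for randomly shifted lattice rules. Applying h(x) = ∫ h + ∫
k(x,t) h'(t) dt in each coordinate writes the quadrature error as a sum, over nonempty sets u, of
integrals of a lattice kernel against the mixed derivative ∂^u. The square integral of that kernel,
averaged over the shift, is the u-term of the worst-case error without its weight: products of B₂
appear because shift averaging turns the Gram function of k into B₂ (`integral_jumpGram_fract`).
Cauchy–Schwarz over u then gives `IsMixedFamily.integral_sq_error_le`. A component-by-component
vector has squared worst-case error at most (2/n) ∑ γ_u 6^(-|u|)
(`shiftAveragedErrorSq_le_of_isCBCVector`), since a minimum over candidates is at most their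
average, and for n a power of two this average is controlled by explicit character-free sums of B₂.

Inner part: g is Lipschitz on the compact subset of (0,∞) containing all values of `H` and `Q`, so
it suffices to bound E|Q - H|². The likelihood is the exponential of a quadratic form in y - G, and
Gevrey bounds (|u|!)^β κ^|u| b^u survive products and exponentials (`GevreyBound.exp`). The squared
bound factors exactly into the prescribed weight, with exponent τ₁ = 2/(1+λ), and a second weight of
the same type with exponent 2 - τ₁ ≥ 2/3 ≥ p. Both families are summable uniformly in s because βp <
1 (`exists_bound_sum_pod`).

Outer part: θ enters the likelihood only by translating a fixed Gaussian density by G(θ), so `Q` is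
an average of boundedly translated copies of one function of k variables. All derivatives of g(Q)
are therefore bounded independently of s, n, ξ and the inner shift
(`exists_bound_setPartial_xlogx_translateAverage`). -/

theorem abs_bernoulliTwo_le {x : ℝ} (h0 : 0 ≤ x) (h1 : x ≤ 1) : |bernoulliTwo x| ≤ 1 / 6 := by
  unfold bernoulliTwo
  rw [abs_le]
  constructor <;> nlinarith [sq_nonneg (x - 1 / 2)]

theorem abs_bernoulliTwo_fract_le (x : ℝ) : |bernoulliTwo (Int.fract x)| ≤ 1 / 6 :=
  abs_bernoulliTwo_le (Int.fract_nonneg x) (Int.fract_lt_one x).le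

/-- `∑ B₂({i w / n})`, the sum running over the `w < n` coprime to `n`. -/
noncomputable def coprimeSum (n i : ℕ) : ℝ :=
  ∑ w ∈ Finset.range n with w.Coprime n,
    bernoulliTwo (Int.fract ((i : ℝ) * (w : ℝ) / (n : ℝ)))

/-- Multiplication by a unit i permutes the reduced residues modulo n. -/
theorem coprimeSum_of_coprime {n i : ℕ} (h : i.Coprime n) : coprimeSum n i = coprimeSum n 1 := by
  rcases Nat.eq_zero_or_pos n with rfl | hn
  · simp [coprimeSum]
  unfold coprimeSum
  have hfr : ∀ a w : ℕ, Int.fract ((a : ℝ) * (w : ℝ) / (n : ℝ)) = ((a * w % n : ℕ) : ℝ) / n := by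
    intro a w
    rw [← Nat.cast_mul, Int.fract_div_natCast_eq_div_natCast_mod]
  simp only [hfr, one_mul]
  set W : Finset ℕ := {w ∈ Finset.range n | w.Coprime n} with hW
  have hmaps : Set.MapsTo (fun w => i * w % n) W W := by
    intro w hw
    simp only [hW, Finset.coe_filter, Finset.mem_range, Set.mem_ofPred_eq] at hw ⊢
    refine ⟨Nat.mod_lt _ hn, ?_⟩
    have : (i * w).Coprime n := Nat.Coprime.mul_left h hw.2
    rw [Nat.coprime_iff_gcd_eq_one] at this ⊢
    rwa [← Nat.gcd_rec, Nat.gcd_comm]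
  have hinj : Set.InjOn (fun w => i * w % n) W := by
    intro w hw v hv hwv
    simp only [hW, Finset.coe_filter, Finset.mem_range, Set.mem_ofPred_eq] at hw hv
    have h1 : w ≡ v [MOD n] := Nat.ModEq.cancel_left_of_coprime
      (by rwa [Nat.gcd_comm]) hwv
    rwa [Nat.ModEq, Nat.mod_eq_of_lt hw.1, Nat.mod_eq_of_lt hv.1] at h1
  have himg : W.image (fun w => i * w % n) = W :=
    Finset.eq_of_subset_of_card_le (Finset.image_subset_iff.2 hmaps)
      (by rw [Finset.card_image_of_injOn hinj])
  conv_rhs => rw [← himg, Finset.sum_image hinj]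
  simp

theorem filter_coprime_range_two_pow_succ (l : ℕ) :
    {w ∈ Finset.range (2 ^ (l + 1)) | w.Coprime (2 ^ (l + 1))} =
      (Finset.range (2 ^ l)).image fun r => 2 * r + 1 := by
  ext w
  simp only [Finset.mem_filter, Finset.mem_range, Finset.mem_image, pow_succ]
  have : w.Coprime (2 ^ l * 2) ↔ Odd w := by
    rw [← pow_succ, Nat.coprime_pow_right_iff (Nat.succ_pos l), Nat.coprime_two_right]
  rw [this]
  constructor
  · rintro ⟨h, r, rfl⟩
    exact ⟨r, by omega, rfl⟩
  · rintro ⟨r, hr, rfl⟩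
    exact ⟨by omega, r, rfl⟩

theorem coprimeSum_two_pow_succ (l i : ℕ) :
    coprimeSum (2 ^ (l + 1)) i = ∑ r ∈ Finset.range (2 ^ l),
      bernoulliTwo (Int.fract ((i : ℝ) * (2 * r + 1) / (2 ^ (l + 1)))) := by
  unfold coprimeSum
  rw [filter_coprime_range_two_pow_succ, Finset.sum_image (by intro a _ b _ h; simpa using h)]
  simp

/-- Needed at N = 2^l and x = 1/(2N), where the leading parts cancel and only -1/(12N) remains. -/
theorem sum_bernoulliTwo_odd (N : ℕ) (x : ℝ) :
    ∑ r ∈ Finset.range N, bernoulliTwo ((2 * (r : ℝ) + 1) * x) =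
      x ^ 2 * (N * (4 * N ^ 2 - 1) / 3) - x * N ^ 2 + N / 6 := by
  induction N with
  | zero => simp
  | succ N ih =>
    rw [Finset.sum_range_succ, ih, bernoulliTwo]
    push_cast
    ring

theorem coprimeSum_one_two_pow_succ (l : ℕ) :
    coprimeSum (2 ^ (l + 1)) 1 = -(1 / (6 * 2 ^ (l + 1))) := by
  rw [coprimeSum_two_pow_succ]
  have h2 : (0 : ℝ) < 2 ^ l := by positivity
  have : ∀ r ∈ Finset.range (2 ^ l),
      bernoulliTwo (Int.fract (((1 : ℕ) : ℝ) * (2 * r + 1) / (2 ^ (l + 1)))) =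
        bernoulliTwo ((2 * (r : ℝ) + 1) * (1 / 2 ^ (l + 1))) := by
    intro r hr
    rw [Finset.mem_range] at hr
    congr 1
    rw [Int.fract_eq_self.2]
    · simp [div_eq_mul_inv]
    constructor
    · positivity
    · rw [div_lt_one (by positivity), pow_succ]
      have : (r : ℝ) + 1 ≤ 2 ^ l := by exact_mod_cast hr
      push_cast
      linarith
  rw [Finset.sum_congr rfl this, sum_bernoulliTwo_odd, pow_succ]
  push_cast
  field_simp
  ring

/-- Cancelling the factor 2 lowers the modulus to 2^(l+1), and the odd numbers below 2^(l+2) run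
through the odd residues modulo 2^(l+1) exactly twice. -/
theorem coprimeSum_two_mul (l i : ℕ) :
    coprimeSum (2 ^ (l + 2)) (2 * i) = 2 * coprimeSum (2 ^ (l + 1)) i := by
  rw [coprimeSum_two_pow_succ, coprimeSum_two_pow_succ,
    show (2 : ℕ) ^ (l + 1) = 2 ^ l + 2 ^ l by ring, Finset.sum_range_add, two_mul (Finset.sum _ _)]
  congr 1
  · refine Finset.sum_congr rfl fun r _ => ?_
    congr 2
    push_cast
    field_simp
    ring
  · refine Finset.sum_congr rfl fun r _ => ?_
    congr 1
    rw [Int.fract_eq_fract]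
    refine ⟨i, ?_⟩
    push_cast
    field_simp
    ring

theorem sum_Icc_two_mul (N : ℕ) (f : ℕ → ℝ) :
    ∑ i ∈ Finset.Icc 1 (2 * N), f i =
      ∑ i ∈ Finset.Icc 1 N, f (2 * i) + ∑ i ∈ Finset.range N, f (2 * i + 1) := by
  induction N with
  | zero => simp
  | succ N ih =>
    rw [show 2 * (N + 1) = 2 * N + 1 + 1 by ring, Finset.sum_Icc_succ_top (by omega),
      Finset.sum_Icc_succ_top (by omega), ih, Finset.sum_Icc_succ_top (by omega),
      Finset.sum_range_succ, show 2 * (N + 1) = 2 * N + 1 + 1 by ring]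
    ring

/-- The odd i contribute 1/12 in total at every level, and the even i reproduce twice the sum of the
previous level. The recursion a(l+1) = 2 a(l) + 1/12 with a(0) = 1/4 has the stated right-hand side
as its solution. -/
theorem sum_abs_coprimeSum_two_pow_succ_le (l : ℕ) :
    ∑ i ∈ Finset.Icc 1 (2 ^ (l + 1)), |coprimeSum (2 ^ (l + 1)) i| ≤ 2 ^ l / 3 - 1 / 12 := by
  have hodd : ∀ m : ℕ, ∑ i ∈ Finset.range (2 ^ m), |coprimeSum (2 ^ (m + 1)) (2 * i + 1)| =
      1 / 12 := by
    intro m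
    have : ∀ i ∈ Finset.range (2 ^ m), |coprimeSum (2 ^ (m + 1)) (2 * i + 1)| =
        1 / (6 * 2 ^ (m + 1)) := by
      intro i _
      rw [coprimeSum_of_coprime, coprimeSum_one_two_pow_succ, abs_neg, abs_of_pos (by positivity)]
      rw [Nat.coprime_pow_right_iff (Nat.succ_pos m), Nat.coprime_two_right]
      exact ⟨i, rfl⟩
    rw [Finset.sum_congr rfl this, Finset.sum_const, Finset.card_range, nsmul_eq_mul, pow_succ]
    push_cast
    field_simp
    norm_num
  induction l with
  | zero =>
    have h := hodd 0
    rw [show 2 ^ (0 + 1) = 2 * 1 by norm_num, sum_Icc_two_mul]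
    norm_num at h ⊢
    rw [h]
    have : coprimeSum 2 2 = 1 / 6 := by
      have := coprimeSum_two_pow_succ 0 2
      norm_num [bernoulliTwo] at this
      exact this
    rw [this]
    norm_num
  | succ l ih =>
    rw [pow_succ 2 (l + 1), mul_comm, sum_Icc_two_mul, mul_comm, ← pow_succ, hodd (l + 1)]
    simp only [coprimeSum_two_mul, abs_mul, abs_two]
    rw [← Finset.mul_sum]
    rw [pow_succ (2 : ℝ)]
    linarith

/-- Written with the number of candidates `Nat.totient (2 ^ l)`, so that averaging over them divides
it out; the factor 1/3 is 2 · (1/6), with 1/6 the maximum of |B₂| on [0,1]. -/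
theorem sum_abs_coprimeSum_le (l : ℕ) :
    ∑ i ∈ Finset.Icc 1 (2 ^ l), |coprimeSum (2 ^ l) i| ≤ (Nat.totient (2 ^ l) : ℝ) / 3 := by
  cases l with
  | zero => norm_num [coprimeSum, bernoulliTwo, Finset.filter_singleton]
  | succ l =>
    rw [Nat.totient_prime_pow_succ Nat.prime_two]
    have := sum_abs_coprimeSum_two_pow_succ_le l
    push_cast
    linarith

/-! ### The worst-case error of component-by-component vectors -/

/-- The part of `shiftAveragedErrorSq` coming from the sets with largest element `j`. -/
noncomputable def maxTerm {d : ℕ} (n : ℕ) (γ : Finset (Fin d) → ℝ) (j : Fin d) (z : Fin d → ℕ) :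
    ℝ :=
  ∑ v ∈ (Finset.Iio j).powerset, γ (insert j v) * ((1 / (n : ℝ)) * ∑ i ∈ Finset.Icc 1 n,
      ∏ r ∈ insert j v, bernoulliTwo (Int.fract ((i : ℝ) * (z r : ℝ) / (n : ℝ))))

theorem shiftAveragedErrorSq_insert {d : ℕ} (n : ℕ) (γ : Finset (Fin d) → ℝ)
    (D : Finset (Fin d)) (j : Fin d) (hj : j ∉ D) (z : Fin d → ℕ) :
    shiftAveragedErrorSq n γ (insert j D) z = shiftAveragedErrorSq n γ D z +
      ∑ v ∈ D.powerset, γ (insert j v) * ((1 / (n : ℝ)) * ∑ i ∈ Finset.Icc 1 n,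
      ∏ r ∈ insert j v, bernoulliTwo (Int.fract ((i : ℝ) * (z r : ℝ) / (n : ℝ)))) := by
  unfold shiftAveragedErrorSq
  rw [Finset.sum_filter, Finset.sum_powerset_insert hj, Finset.sum_filter]
  simp

theorem shiftAveragedErrorSq_Iic {d : ℕ} (n : ℕ) (γ : Finset (Fin d) → ℝ) (j : Fin d)
    (z : Fin d → ℕ) :
    shiftAveragedErrorSq n γ (Finset.Iic j) z =
      shiftAveragedErrorSq n γ (Finset.Iio j) z + maxTerm n γ j z := by
  rw [← Finset.Iio_insert, shiftAveragedErrorSq_insert _ _ _ _ (by simp), maxTerm]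

theorem shiftAveragedErrorSq_congr {d : ℕ} (n : ℕ) (γ : Finset (Fin d) → ℝ)
    (D : Finset (Fin d)) {z z' : Fin d → ℕ} (h : ∀ j ∈ D, z j = z' j) :
    shiftAveragedErrorSq n γ D z = shiftAveragedErrorSq n γ D z' := by
  unfold shiftAveragedErrorSq
  refine Finset.sum_congr rfl fun u hu => ?_
  rw [Finset.mem_filter, Finset.mem_powerset] at hu
  congr 2
  refine Finset.sum_congr rfl fun i _ => Finset.prod_congr rfl fun j hj => ?_
  rw [h j (hu.1 hj)]

/-- Only the factor of coordinate j depends on the candidate w, so summing over w turns that factor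
into `coprimeSum`. The other factors are at most 1/6 in absolute value. -/
theorem sum_maxTerm_update_le {d : ℕ} (l : ℕ) (γ : Finset (Fin d) → ℝ) (hγ : ∀ u, 0 ≤ γ u)
    (j : Fin d) (z : Fin d → ℕ) :
    ∑ w ∈ Finset.range (2 ^ l) with w.Coprime (2 ^ l), maxTerm (2 ^ l) γ j (Function.update z j w) ≤
      Nat.totient (2 ^ l) * (2 / 2 ^ l *
        ∑ v ∈ (Finset.Iio j).powerset, γ (insert j v) * (1 / 6) ^ (insert j v).card) := by
  unfold maxTerm
  rw [Finset.sum_comm, Finset.mul_sum, Finset.mul_sum]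
  refine Finset.sum_le_sum fun v hv => ?_
  rw [Finset.mem_powerset] at hv
  have hjv : j ∉ v := fun h => by simpa using hv h
  rw [← Finset.mul_sum, ← Finset.mul_sum, Finset.sum_comm]
  set a : ℕ → ℝ := fun i =>
    ∏ r ∈ v, bernoulliTwo (Int.fract ((i : ℝ) * (z r : ℝ) / ((2 ^ l : ℕ) : ℝ))) with ha
  have hsum : ∀ i : ℕ, ∑ w ∈ Finset.range (2 ^ l) with w.Coprime (2 ^ l), ∏ r ∈ insert j v,
      bernoulliTwo (Int.fract ((i : ℝ) * (Function.update z j w r : ℝ) / ((2 ^ l : ℕ) : ℝ))) =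
        coprimeSum (2 ^ l) i * a i := by
    intro i
    rw [coprimeSum, Finset.sum_mul]
    refine Finset.sum_congr rfl fun w _ => ?_
    rw [Finset.prod_insert hjv, Function.update_self, ha]
    congr 1
    refine Finset.prod_congr rfl fun r hr => ?_
    rw [Function.update_of_ne (ne_of_mem_of_not_mem hr hjv)]
  have habs : ∀ i : ℕ, |a i| ≤ (1 / 6) ^ v.card := by
    intro i
    rw [ha, Finset.abs_prod, ← Finset.prod_const]
    exact Finset.prod_le_prod (fun _ _ => abs_nonneg _) fun _ _ => abs_bernoulliTwo_fract_le _
  have hle : ∑ i ∈ Finset.Icc 1 (2 ^ l), coprimeSum (2 ^ l) i * a i ≤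
      (Nat.totient (2 ^ l) : ℝ) / 3 * (1 / 6) ^ v.card := by
    calc _ ≤ ∑ i ∈ Finset.Icc 1 (2 ^ l), |coprimeSum (2 ^ l) i| * (1 / 6) ^ v.card := by
          refine Finset.sum_le_sum fun i _ => (le_abs_self _).trans ?_
          rw [abs_mul]
          exact mul_le_mul_of_nonneg_left (habs i) (abs_nonneg _)
      _ ≤ _ := by
          rw [← Finset.sum_mul]
          exact mul_le_mul_of_nonneg_right (sum_abs_coprimeSum_le l) (by positivity)
  simp only [hsum]
  rw [Finset.card_insert_of_notMem hjv, pow_succ]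
  calc _ ≤ γ (insert j v) * (1 / ((2 ^ l : ℕ) : ℝ) *
        ((Nat.totient (2 ^ l) : ℝ) / 3 * (1 / 6) ^ v.card)) := by
        refine mul_le_mul_of_nonneg_left (mul_le_mul_of_nonneg_left hle (by positivity)) (hγ _)
    _ = _ := by push_cast; ring

/-- The sets not containing j do not see the candidate, so the algorithm in fact minimises
`maxTerm`, and a minimum is at most the average over all candidates. -/
theorem maxTerm_le_of_isCBCVector {d : ℕ} (l : ℕ) (γ : Finset (Fin d) → ℝ) (hγ : ∀ u, 0 ≤ γ u)
    (z : Fin d → ℕ) (hz : IsCBCVector (2 ^ l) γ z) (j : Fin d) :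
    maxTerm (2 ^ l) γ j z ≤ 2 / 2 ^ l *
      ∑ v ∈ (Finset.Iio j).powerset, γ (insert j v) * (1 / 6) ^ (insert j v).card := by
  obtain ⟨-, -, hmin⟩ := hz j
  have hle : ∀ w ∈ {w ∈ Finset.range (2 ^ l) | w.Coprime (2 ^ l)},
      maxTerm (2 ^ l) γ j z ≤ maxTerm (2 ^ l) γ j (Function.update z j w) := by
    intro w hw
    rw [Finset.mem_filter, Finset.mem_range] at hw
    have := hmin w hw.1 hw.2
    rw [shiftAveragedErrorSq_Iic, shiftAveragedErrorSq_Iic,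
      shiftAveragedErrorSq_congr (2 ^ l) γ (Finset.Iio j) (z := Function.update z j w) (z' := z)
        (fun i hi => Function.update_of_ne (Finset.mem_Iio.1 hi).ne _ _)] at this
    linarith
  have h1 := Finset.card_nsmul_le_sum _ _ _ hle
  have h2 := h1.trans (sum_maxTerm_update_le l γ hγ j z)
  have hcard : ({w ∈ Finset.range (2 ^ l) | w.Coprime (2 ^ l)} : Finset ℕ).card =
      Nat.totient (2 ^ l) := by
    rw [Nat.totient]
    congr 1
    ext w
    simp [Nat.coprime_comm]
  rw [hcard, nsmul_eq_mul] at h2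
  exact le_of_mul_le_mul_left h2 (by exact_mod_cast Nat.totient_pos.2 (by positivity))

/-- A nonempty set is uniquely its largest element together with a set of smaller ones; this matches
the order in which the components are chosen. -/
theorem sum_powerset_nonempty_eq_sum_max {d : ℕ} (f : Finset (Fin d) → ℝ) :
    ∑ u ∈ (Finset.univ : Finset (Fin d)).powerset with u.Nonempty, f u =
      ∑ j, ∑ v ∈ (Finset.Iio j).powerset, f (insert j v) := by
  rw [Finset.sum_sigma']
  symm
  refine Finset.sum_bij (fun p _ => insert p.1 p.2) ?_ ?_ ?_ ?_
  · rintro ⟨j, v⟩ _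
    simp
  · rintro ⟨j, v⟩ hv ⟨j', v'⟩ hv' h
    simp only [Finset.mem_sigma, Finset.mem_univ, true_and, Finset.mem_powerset] at hv hv'
    have hlt : ∀ i ∈ v, i < j := fun i hi => Finset.mem_Iio.1 (hv hi)
    have hlt' : ∀ i ∈ v', i < j' := fun i hi => Finset.mem_Iio.1 (hv' hi)
    simp only at h
    have hjj : j = j' := by
      have h1 : j ∈ insert j' v' := h ▸ Finset.mem_insert_self j v
      have h2 : j' ∈ insert j v := h ▸ Finset.mem_insert_self j' v'
      rw [Finset.mem_insert] at h1 h2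
      rcases h1 with h1 | h1
      · exact h1
      rcases h2 with h2 | h2
      · exact h2.symm
      exact absurd (hlt' _ h1) (hlt _ h2).not_gt
    subst hjj
    have : v = v' := by
      rw [← Finset.erase_insert (fun h => (hlt j h).false : j ∉ v), h,
        Finset.erase_insert (fun h => (hlt' j h).false : j ∉ v')]
    rw [this]
  · intro u hu
    rw [Finset.mem_filter] at hu
    refine ⟨⟨u.max' hu.2, u.erase (u.max' hu.2)⟩, ?_, ?_⟩
    · simp only [Finset.mem_sigma, Finset.mem_univ, true_and, Finset.mem_powerset]
      intro i hi
      rw [Finset.mem_Iio]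
      exact Finset.lt_max'_of_mem_erase_max' u hu.2 hi
    · exact Finset.insert_erase (Finset.max'_mem u hu.2)
  · intro _ _
    rfl

/-- The component-by-component algorithm with `n = 2 ^ l` points attains the squared
shift-averaged worst-case error `O(1 / n)`. -/
theorem shiftAveragedErrorSq_le_of_isCBCVector {d : ℕ} (l : ℕ) (γ : Finset (Fin d) → ℝ)
    (hγ : ∀ u, 0 ≤ γ u) (z : Fin d → ℕ) (hz : IsCBCVector (2 ^ l) γ z) :
    shiftAveragedErrorSq (2 ^ l) γ Finset.univ z ≤ 2 / 2 ^ l *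
      ∑ u ∈ (Finset.univ : Finset (Fin d)).powerset with u.Nonempty, γ u * (1 / 6) ^ u.card := by
  have h : shiftAveragedErrorSq (2 ^ l) γ Finset.univ z = ∑ j, maxTerm (2 ^ l) γ j z := by
    rw [shiftAveragedErrorSq, sum_powerset_nonempty_eq_sum_max]
    rfl
  rw [h, sum_powerset_nonempty_eq_sum_max, Finset.mul_sum]
  exact Finset.sum_le_sum fun j _ => maxTerm_le_of_isCBCVector l γ hγ z hz j

/-! ### The uniform distribution -/

/-- The uniform distribution on `[0,1]`. -/
noncomputable def uniformUnit : Measure ℝ := volume.restrict (Set.Icc 0 1)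

instance : IsProbabilityMeasure uniformUnit :=
  ⟨by simp [uniformUnit]⟩

theorem uniformCube_eq_pi (d : ℕ) : uniformCube d = Measure.pi fun _ => uniformUnit := by
  rw [uniformCube, ← Set.pi_univ_Icc, volume_pi, Measure.restrict_pi_pi]
  rfl

instance (d : ℕ) : IsProbabilityMeasure (uniformCube d) := by
  rw [uniformCube_eq_pi]
  infer_instance

theorem integral_uniformUnit (f : ℝ → ℝ) : ∫ t, f t ∂uniformUnit = ∫ t in (0 : ℝ)..1, f t := by
  rw [uniformUnit, integral_Icc_eq_integral_Ioc, intervalIntegral.integral_of_le zero_le_one]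

theorem ae_mem_uniformCube (d : ℕ) :
    ∀ᵐ t ∂uniformCube d, t ∈ Set.Icc (fun _ => (0 : ℝ)) (fun _ : Fin d => (1 : ℝ)) :=
  ae_restrict_mem measurableSet_Icc

/-- Resampling one coordinate independently leaves the uniform distribution unchanged. This lets a
single coordinate be integrated without splitting the product space. -/
theorem measurePreserving_update {d : ℕ} (j : Fin d) :
    MeasurePreserving (fun p : (Fin d → ℝ) × ℝ => Function.update p.1 j p.2)
      ((uniformCube d).prod uniformUnit) (uniformCube d) := by
  have hmeas : Measurable fun p : (Fin d → ℝ) × ℝ => Function.update p.1 j p.2 := by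
    rw [measurable_pi_iff]
    intro i
    by_cases h : i = j
    · subst h
      simpa using measurable_snd
    · simp only [Function.update_of_ne h]
      exact (measurable_pi_apply i).comp measurable_fst
  refine ⟨hmeas, ?_⟩
  rw [uniformCube_eq_pi]
  symm
  refine Measure.pi_eq fun S hS => ?_
  rw [Measure.map_apply hmeas (MeasurableSet.univ_pi hS)]
  have : (fun p : (Fin d → ℝ) × ℝ => Function.update p.1 j p.2) ⁻¹' Set.univ.pi S =
      (Set.univ.pi (Function.update S j Set.univ)) ×ˢ S j := by
    ext ⟨t, r⟩
    simp only [Set.mem_preimage, Set.mem_univ_pi, Set.mem_prod]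
    constructor
    · intro h
      refine ⟨fun i => ?_, by simpa using h j⟩
      by_cases hi : i = j
      · subst hi; simp
      · simpa [Function.update_of_ne hi] using h i
    · rintro ⟨h, h'⟩ i
      by_cases hi : i = j
      · subst hi; simpa using h'
      · simpa [Function.update_of_ne hi] using h i
  rw [this, Measure.prod_prod, Measure.pi_pi, ← Finset.mul_prod_erase _ _ (Finset.mem_univ j),
    ← Finset.mul_prod_erase _ (fun i => uniformUnit (S i)) (Finset.mem_univ j)]
  rw [Function.update_self, measure_univ, one_mul, mul_comm]
  congr 1
  refine Finset.prod_congr rfl fun i hi => ?_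
  rw [Function.update_of_ne (Finset.ne_of_mem_erase hi)]

theorem integral_uniformCube_update {d : ℕ} (j : Fin d) {f : (Fin d → ℝ) → ℝ}
    (hf : Integrable f (uniformCube d)) :
    ∫ t, f t ∂uniformCube d =
      ∫ t, ∫ r, f (Function.update t j r) ∂uniformUnit ∂uniformCube d := by
  have hmp := measurePreserving_update j
  rw [← hmp.map_eq] at hf
  conv_lhs => rw [← hmp.map_eq, integral_map hmp.measurable.aemeasurable hf.aestronglyMeasurable]
  exact integral_prod _ (hf.comp_measurable hmp.measurable)

/-! ### The kernel -/

/-- The Peano kernel of the formula `h(x) = ∫ h + ∫ k(x,t) h'(t) dt` on `[0,1]`. -/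
noncomputable def jumpKernel (x t : ℝ) : ℝ := t - if x < t then 1 else 0

/-- `∫ k(x,t) k(y,t) dt`. -/
noncomputable def jumpGram (x y : ℝ) : ℝ := 1 / 3 + (x ^ 2 + y ^ 2) / 2 - max x y

theorem measurable_jumpKernel : Measurable fun p : ℝ × ℝ => jumpKernel p.1 p.2 := by
  unfold jumpKernel
  exact measurable_snd.sub
    (Measurable.ite (measurableSet_lt measurable_fst measurable_snd) measurable_const
      measurable_const)

theorem abs_jumpKernel_le (x : ℝ) {t : ℝ} (ht : t ∈ Set.Icc (0 : ℝ) 1) : |jumpKernel x t| ≤ 1 := by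
  unfold jumpKernel
  rw [abs_le]
  split_ifs <;> constructor <;> linarith [ht.1, ht.2]

/-- The integrand is a different quadratic polynomial on each of [0,x], [x,y] and [y,1]. -/
theorem integral_jumpKernel_mul_of_le {x y : ℝ} (hx : 0 ≤ x) (hxy : x ≤ y) (hy : y ≤ 1) :
    ∫ t, jumpKernel x t * jumpKernel y t ∂uniformUnit = jumpGram x y := by
  have hint : ∀ a b : ℝ, 0 ≤ a → a ≤ b → b ≤ 1 →
      IntervalIntegrable (fun t => jumpKernel x t * jumpKernel y t) volume a b := by
    intro a b ha hab hb
    rw [intervalIntegrable_iff_integrableOn_Icc_of_le hab]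
    refine Measure.integrableOn_of_bounded (M := 1) (by simp) ?_ ?_
    · exact ((measurable_jumpKernel.comp (measurable_const.prodMk measurable_id)).mul
        (measurable_jumpKernel.comp (measurable_const.prodMk measurable_id))).aestronglyMeasurable
    · refine (ae_restrict_mem measurableSet_Icc).mono fun t ht => ?_
      have ht' : t ∈ Set.Icc (0 : ℝ) 1 := ⟨ha.trans ht.1, ht.2.trans hb⟩
      rw [norm_mul]
      exact mul_le_one₀ (abs_jumpKernel_le x ht') (norm_nonneg _) (abs_jumpKernel_le y ht')
  rw [integral_uniformUnit, ← intervalIntegral.integral_add_adjacent_intervals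
      (hint 0 x le_rfl hx (hxy.trans hy)) (hint x 1 hx (hxy.trans hy) le_rfl),
    ← intervalIntegral.integral_add_adjacent_intervals
      (hint x y hx hxy hy) (hint y 1 (hx.trans hxy) hy le_rfl)]
  have h1 : ∫ t in (0 : ℝ)..x, jumpKernel x t * jumpKernel y t = ∫ t in (0 : ℝ)..x, t ^ 2 := by
    refine intervalIntegral.integral_congr_Ioo_of_le hx fun t ht => ?_
    rw [jumpKernel, jumpKernel, if_neg ht.2.not_gt, if_neg (ht.2.trans_le hxy).not_gt]
    ring
  have h2 : ∫ t in x..y, jumpKernel x t * jumpKernel y t = ∫ t in x..y, (t ^ 2 - t) := by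
    refine intervalIntegral.integral_congr_Ioo_of_le hxy fun t ht => ?_
    rw [jumpKernel, jumpKernel, if_pos ht.1, if_neg ht.2.not_gt]
    ring
  have h3 : ∫ t in y..1, jumpKernel x t * jumpKernel y t =
      ∫ t in y..1, (t ^ 2 - 2 * t + 1) := by
    refine intervalIntegral.integral_congr_Ioo_of_le hy fun t ht => ?_
    rw [jumpKernel, jumpKernel, if_pos ht.1, if_pos (hxy.trans_lt ht.1)]
    ring
  rw [h1, h2, h3, intervalIntegral.integral_sub (by simp) (by simp),
    intervalIntegral.integral_add (by apply Continuous.intervalIntegrable; fun_prop) (by simp),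
    intervalIntegral.integral_sub (by simp) (by apply Continuous.intervalIntegrable; fun_prop),
    intervalIntegral.integral_const_mul]
  simp only [integral_pow, integral_id, intervalIntegral.integral_const, jumpGram, max_eq_right hxy]
  norm_num
  ring

theorem jumpGram_comm (x y : ℝ) : jumpGram x y = jumpGram y x := by
  rw [jumpGram, jumpGram, max_comm, add_comm (x ^ 2)]

theorem integral_jumpKernel_mul {x y : ℝ} (hx : x ∈ Set.Icc (0 : ℝ) 1)
    (hy : y ∈ Set.Icc (0 : ℝ) 1) :
    ∫ t, jumpKernel x t * jumpKernel y t ∂uniformUnit = jumpGram x y := by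
  rcases le_total x y with h | h
  · exact integral_jumpKernel_mul_of_le hx.1 h hy.2
  · rw [jumpGram_comm, ← integral_jumpKernel_mul_of_le hy.1 h hx.2]
    simp only [mul_comm]

theorem measurable_jumpGram_fract (a b : ℝ) :
    Measurable fun t => jumpGram (Int.fract (a + t)) (Int.fract (b + t)) := by
  unfold jumpGram
  fun_prop

theorem abs_jumpGram_le {x y : ℝ} (hx : x ∈ Set.Icc (0 : ℝ) 1) (hy : y ∈ Set.Icc (0 : ℝ) 1) :
    |jumpGram x y| ≤ 4 / 3 := by
  obtain ⟨hx0, hx1⟩ := hx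
  obtain ⟨hy0, hy1⟩ := hy
  unfold jumpGram
  have h1 : max x y ≤ 1 := max_le hx1 hy1
  have h2 : 0 ≤ max x y := hx0.trans (le_max_left _ _)
  rw [abs_le]
  constructor <;> nlinarith

theorem fract_mem_Icc (x : ℝ) : Int.fract x ∈ Set.Icc (0 : ℝ) 1 :=
  ⟨Int.fract_nonneg x, (Int.fract_lt_one x).le⟩

/-- By periodicity the shift may be moved by -b, leaving fract(c + t) and t with c = fract(a - b).
The integral splits at t = 1 - c, where c + t wraps around. -/
theorem integral_jumpGram_fract (a b : ℝ) :
    ∫ t, jumpGram (Int.fract (a + t)) (Int.fract (b + t)) ∂uniformUnit =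
      bernoulliTwo (Int.fract (a - b)) := by
  rw [integral_uniformUnit]
  set c := Int.fract (a - b) with hc
  have hc0 : 0 ≤ c := Int.fract_nonneg _
  have hc1 : c < 1 := Int.fract_lt_one _
  set shifted : ℝ → ℝ := fun t => jumpGram (Int.fract (a + t)) (Int.fract (b + t)) with h_shift
  have hper : Function.Periodic shifted 1 := by
    intro t
    simp only [h_shift, ← add_assoc, Int.fract_add_one]
  have h1 : ∫ t in (0 : ℝ)..1, shifted t = ∫ t in (0 : ℝ)..1, shifted (t - b) := by
    have := hper.intervalIntegral_add_eq 0 (-b)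
    rw [zero_add] at this
    rw [this, intervalIntegral.integral_comp_sub_right]
    congr 1 <;> ring
  have h2 : ∀ t, shifted (t - b) = jumpGram (Int.fract (c + t)) (Int.fract t) := by
    intro t
    simp only [h_shift]
    congr 1
    · rw [Int.fract_eq_fract]
      refine ⟨⌊a - b⌋, ?_⟩
      rw [hc, Int.fract]
      ring
    · congr 1
      ring
  have hint : ∀ p q : ℝ, IntervalIntegrable
      (fun t => jumpGram (Int.fract (c + t)) (Int.fract t)) volume p q := by
    intro p q
    rw [intervalIntegrable_iff]
    refine Measure.integrableOn_of_bounded (M := 4 / 3) (by simp) ?_ ?_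
    · have := measurable_jumpGram_fract c 0
      simp only [zero_add] at this
      exact this.aestronglyMeasurable
    · exact Filter.Eventually.of_forall fun t => abs_jumpGram_le (fract_mem_Icc _) (fract_mem_Icc _)
  rw [h1]
  simp only [h2]
  rw [← intervalIntegral.integral_add_adjacent_intervals (hint 0 (1 - c)) (hint (1 - c) 1)]
  have h3 : ∫ t in (0 : ℝ)..(1 - c), jumpGram (Int.fract (c + t)) (Int.fract t) =
      ∫ t in (0 : ℝ)..(1 - c), (t ^ 2 + (c - 1) * t + (1 / 3 + c ^ 2 / 2 - c)) := by
    refine intervalIntegral.integral_congr_Ioo_of_le (by linarith) fun t ht => ?_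
    rw [Int.fract_eq_self.2 ⟨by linarith [ht.1], by linarith [ht.2]⟩,
      Int.fract_eq_self.2 ⟨by linarith [ht.1], by linarith [ht.2]⟩, jumpGram,
      max_eq_left (by linarith)]
    ring
  have h4 : ∫ t in (1 - c)..1, jumpGram (Int.fract (c + t)) (Int.fract t) =
      ∫ t in (1 - c)..1, (t ^ 2 + (c - 2) * t + (1 / 3 + (c - 1) ^ 2 / 2)) := by
    refine intervalIntegral.integral_congr_Ioo_of_le (by linarith) fun t ht => ?_
    have : Int.fract (c + t) = c + t - 1 := by
      rw [Int.fract_eq_iff]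
      exact ⟨by linarith [ht.1], by linarith [ht.2], 1, by push_cast; ring⟩
    rw [this, Int.fract_eq_self.2 ⟨by linarith [ht.1], by linarith [ht.2]⟩, jumpGram,
      max_eq_right (by linarith)]
    ring
  have h5 : ∀ p q m e : ℝ, ∫ t in p..q, (t ^ 2 + m * t + e) =
      (q ^ 3 - p ^ 3) / 3 + m * ((q ^ 2 - p ^ 2) / 2) + (q - p) * e := by
    intro p q m e
    rw [intervalIntegral.integral_add (by apply Continuous.intervalIntegrable; fun_prop) (by simp),
      intervalIntegral.integral_add (by simp) (by apply Continuous.intervalIntegrable; fun_prop),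
      intervalIntegral.integral_const_mul]
    simp only [integral_pow, integral_id, intervalIntegral.integral_const, smul_eq_mul]
    norm_num
  rw [h3, h4, h5, h5, bernoulliTwo]
  ring

/-- First-order Taylor formula with the kernel `jumpKernel`. -/
theorem eq_integral_add_integral_jumpKernel_mul {h h' : ℝ → ℝ} (hh' : ContinuousOn h' (Set.Icc 0 1))
    (hd : ∀ t ∈ Set.Icc (0 : ℝ) 1, HasDerivWithinAt h (h' t) (Set.Icc 0 1) t) {x : ℝ}
    (hx : x ∈ Set.Icc (0 : ℝ) 1) :
    h x = ∫ t, h t ∂uniformUnit + ∫ t, jumpKernel x t * h' t ∂uniformUnit := by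
  have hh : ContinuousOn h (Set.Icc 0 1) := fun t ht => (hd t ht).continuousWithinAt
  have hd' : ∀ t ∈ Set.Ioo (0 : ℝ) 1, HasDerivAt h (h' t) t := fun t ht =>
    (hd t (Set.Ioo_subset_Icc_self ht)).hasDerivAt (Icc_mem_nhds ht.1 ht.2)
  have hm : ContinuousOn (fun t => t * h' t) (Set.Icc 0 1) := continuousOn_id.mul hh'
  have hi : ∀ {f : ℝ → ℝ}, ContinuousOn f (Set.Icc 0 1) → ∀ {p q : ℝ}, 0 ≤ p → p ≤ q → q ≤ 1 →
      IntervalIntegrable f volume p q := fun hf p q h0 h1 h2 =>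
    (hf.mono (by rw [Set.uIcc_of_le h1]; exact Set.Icc_subset_Icc h0 h2)).intervalIntegrable
  -- The integrand is the derivative of t h(t). Together with ∫_x^1 h' = h(1) - h(x), which the jump
  -- part of the kernel produces, the value h(1) cancels.
  have h1 : ∫ t in (0 : ℝ)..1, (h t + t * h' t) = h 1 := by
    rw [intervalIntegral.integral_eq_sub_of_hasDerivAt_of_le (f := fun t => t * h t) zero_le_one
      (continuousOn_id.mul hh)]
    · simp
    · intro t ht
      have := (hasDerivAt_id' t).mul (hd' t ht)
      rw [one_mul] at this
      exact this
    · exact hi (hh.add hm) le_rfl zero_le_one le_rfl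
  rw [intervalIntegral.integral_add (hi hh le_rfl zero_le_one le_rfl)
    (hi hm le_rfl zero_le_one le_rfl)] at h1
  have h2 : ∫ t in x..1, h' t = h 1 - h x :=
    intervalIntegral.integral_eq_sub_of_hasDerivAt_of_le hx.2
      (hh.mono (Set.Icc_subset_Icc_left hx.1))
      (fun t ht => hd' t ⟨hx.1.trans_lt ht.1, ht.2⟩) (hi hh' hx.1 hx.2 le_rfl)
  have hi1 : IntervalIntegrable (fun t => t * h' t) volume 0 1 :=
    hi hm le_rfl zero_le_one le_rfl
  have hind : (fun t => (if x < t then 1 else 0) * h' t) = (Set.Ioi x).indicator h' := by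
    ext t
    by_cases ht : x < t <;> simp [Set.indicator, ht]
  have hi2 : IntervalIntegrable (fun t => (if x < t then 1 else 0) * h' t) volume 0 1 := by
    rw [hind, intervalIntegrable_iff_integrableOn_Ioc_of_le zero_le_one]
    have := hi hh' le_rfl zero_le_one le_rfl
    rw [intervalIntegrable_iff_integrableOn_Ioc_of_le zero_le_one] at this
    exact this.indicator measurableSet_Ioi
  have h3 : ∫ t in (0 : ℝ)..1, (if x < t then 1 else 0) * h' t = ∫ t in x..1, h' t := by
    rw [hind, intervalIntegral.integral_of_le zero_le_one, intervalIntegral.integral_of_le hx.2,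
      setIntegral_indicator measurableSet_Ioi]
    congr 2
    ext t
    simp only [Set.mem_inter_iff, Set.mem_Ioc, Set.mem_Ioi]
    constructor
    · rintro ⟨⟨_, a⟩, b⟩
      exact ⟨b, a⟩
    · rintro ⟨a, b⟩
      exact ⟨⟨hx.1.trans_lt a, b⟩, a⟩
  rw [integral_uniformUnit, integral_uniformUnit]
  simp only [jumpKernel, sub_mul]
  rw [intervalIntegral.integral_sub hi1 hi2, h3, h2]
  linarith

/-! ### Representation by mixed first derivatives -/

/-- The unit cube `[0,1]^d`. -/
def unitCube (d : ℕ) : Set (Fin d → ℝ) := Set.Icc (fun _ => 0) (fun _ => 1)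

theorem mem_unitCube {d : ℕ} {x : Fin d → ℝ} : x ∈ unitCube d ↔ ∀ j, x j ∈ Set.Icc (0 : ℝ) 1 := by
  simp only [unitCube, Set.mem_Icc, Pi.le_def, forall_and]

theorem ae_mem_unitCube (d : ℕ) : ∀ᵐ t ∂uniformCube d, t ∈ unitCube d := ae_mem_uniformCube d

theorem update_mem_unitCube {d : ℕ} {x : Fin d → ℝ} (hx : x ∈ unitCube d) (j : Fin d) {r : ℝ}
    (hr : r ∈ Set.Icc (0 : ℝ) 1) : Function.update x j r ∈ unitCube d := by
  rw [mem_unitCube] at hx ⊢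
  intro i
  by_cases h : i = j
  · subst h; simpa using hr
  · simpa [Function.update_of_ne h] using hx i

theorem piecewise_mem_unitCube {d : ℕ} {t x : Fin d → ℝ} (ht : t ∈ unitCube d)
    (hx : x ∈ unitCube d) (A : Finset (Fin d)) : A.piecewise t x ∈ unitCube d := by
  rw [mem_unitCube] at *
  intro i
  by_cases h : i ∈ A <;> simp [h, ht i, hx i]

theorem shiftedLatticePoint_mem_unitCube {d : ℕ} (n : ℕ) (z : Fin d → ℕ) (Δ : Fin d → ℝ) (i : ℕ) :
    shiftedLatticePoint n z Δ i ∈ unitCube d :=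
  mem_unitCube.2 fun _ => fract_mem_Icc _

/-- `D` is a family of mixed first derivatives on the unit cube: `D (insert j u)` is the partial
derivative of `D u` in direction `j` whenever `j` is smaller than all elements of `u`. -/
structure IsMixedFamily {d : ℕ} (D : Finset (Fin d) → (Fin d → ℝ) → ℝ) : Prop where
  continuous : ∀ u, Continuous (D u)
  hasDerivWithinAt : ∀ (u : Finset (Fin d)) (j : Fin d), (∀ i ∈ u, j < i) → ∀ x ∈ unitCube d,
    HasDerivWithinAt (fun r => D u (Function.update x j r)) (D (insert j u) x) (Set.Icc 0 1) (x j)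

theorem isCompact_unitCube (d : ℕ) : IsCompact (unitCube d) := isCompact_Icc

theorem exists_bound_on_unitCube {d : ℕ} {f : (Fin d → ℝ) → ℝ} (hf : Continuous f) :
    ∃ M : ℝ, ∀ x ∈ unitCube d, |f x| ≤ M :=
  (isCompact_unitCube d).exists_bound_of_continuousOn hf.continuousOn

theorem integrable_of_bound_on_unitCube {d : ℕ} {f : (Fin d → ℝ) → ℝ} (hf : Measurable f) {M : ℝ}
    (hM : ∀ x ∈ unitCube d, |f x| ≤ M) : Integrable f (uniformCube d) :=
  Integrable.of_bound hf.aestronglyMeasurable M ((ae_mem_unitCube d).mono fun x hx => hM x hx)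

theorem measurable_prod_jumpKernel {d : ℕ} (u : Finset (Fin d)) (x : Fin d → ℝ) :
    Measurable fun t : Fin d → ℝ => ∏ j ∈ u, jumpKernel (x j) (t j) :=
  Finset.measurable_prod _ fun j _ =>
    measurable_jumpKernel.comp (measurable_const.prodMk (measurable_pi_apply j))

theorem abs_prod_jumpKernel_le {d : ℕ} (u : Finset (Fin d)) (x : Fin d → ℝ) {t : Fin d → ℝ}
    (ht : t ∈ unitCube d) : |∏ j ∈ u, jumpKernel (x j) (t j)| ≤ 1 := by
  rw [Finset.abs_prod]
  exact Finset.prod_le_one (fun _ _ => abs_nonneg _)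
    fun j _ => abs_jumpKernel_le _ (mem_unitCube.1 ht j)

theorem continuous_piecewise_left {d : ℕ} (A : Finset (Fin d)) (x : Fin d → ℝ) :
    Continuous fun t : Fin d → ℝ => A.piecewise t x := by
  refine continuous_pi fun i => ?_
  by_cases h : i ∈ A
  · simpa [h] using continuous_apply i
  · simpa [h] using continuous_const

theorem integrable_prod_jumpKernel_mul {d : ℕ} (u : Finset (Fin d)) (x : Fin d → ℝ)
    (hx : x ∈ unitCube d) {f : (Fin d → ℝ) → ℝ} (hf : Continuous f) (A : Finset (Fin d)) :
    Integrable (fun t => (∏ j ∈ u, jumpKernel (x j) (t j)) * f (A.piecewise t x))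
      (uniformCube d) := by
  obtain ⟨M, hM⟩ := exists_bound_on_unitCube hf
  refine integrable_of_bound_on_unitCube (M := M)
    ((measurable_prod_jumpKernel u x).mul
      (hf.measurable.comp (continuous_piecewise_left A x).measurable)) fun t ht => ?_
  rw [abs_mul]
  calc _ ≤ 1 * M := mul_le_mul (abs_prod_jumpKernel_le u x ht)
        (hM _ (piecewise_mem_unitCube ht hx A)) (abs_nonneg _) zero_le_one
    _ = M := one_mul M

/-- Coordinates in `A` are integrated out, the others stay frozen at x. Adding a coordinate j splits
each term in two by the one-dimensional formula: either D u is averaged in direction j, or it is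
differentiated there against the kernel. Coordinates are added in decreasing order because
`IsMixedFamily` differentiates only in directions below those already in u. -/
theorem IsMixedFamily.eq_sum_integral_piecewise {d : ℕ} {D : Finset (Fin d) → (Fin d → ℝ) → ℝ}
    (hD : IsMixedFamily D) {x : Fin d → ℝ} (hx : x ∈ unitCube d) (A : Finset (Fin d)) :
    D ∅ x = ∑ u ∈ A.powerset,
      ∫ t, (∏ j ∈ u, jumpKernel (x j) (t j)) * D u (A.piecewise t x) ∂uniformCube d := by
  induction A using Finset.induction_on_min with
  | empty => simp
  | insert j A hj ih =>
    have hjA : j ∉ A := fun h => (hj j h).false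
    rw [ih, Finset.sum_powerset_insert hjA, ← Finset.sum_add_distrib]
    refine Finset.sum_congr rfl fun u hu => ?_
    rw [Finset.mem_powerset] at hu
    have hju : j ∉ u := fun h => hjA (hu h)
    rw [integral_uniformCube_update j
        (integrable_prod_jumpKernel_mul u x hx (hD.continuous u) (insert j A)),
      integral_uniformCube_update j
        (integrable_prod_jumpKernel_mul (insert j u) x hx (hD.continuous _) (insert j A))]
    have hprod : ∀ (t : Fin d → ℝ) (r : ℝ), ∏ i ∈ u, jumpKernel (x i) (Function.update t j r i) =
        ∏ i ∈ u, jumpKernel (x i) (t i) := fun t r => Finset.prod_congr rfl fun i hi => by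
      rw [Function.update_of_ne (ne_of_mem_of_not_mem hi hju)]
    have hpw : ∀ (t : Fin d → ℝ) (r : ℝ), (insert j A).piecewise (Function.update t j r) x =
        Function.update (A.piecewise t x) j r := by
      intro t r
      rw [Finset.piecewise_insert, Function.update_self]
      congr 1
      refine Finset.piecewise_congr A (fun i hi => ?_) fun i _ => rfl
      rw [Function.update_of_ne (ne_of_mem_of_not_mem hi hjA)]
    simp only [hpw, Finset.prod_insert hju, hprod, Function.update_self, mul_assoc,
      integral_const_mul]
    have hmul : ∀ (t : Fin d → ℝ), (fun r => jumpKernel (x j) r *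
        ((∏ i ∈ u, jumpKernel (x i) (t i)) * D (insert j u) (Function.update (A.piecewise t x) j r)))
        = fun r => (∏ i ∈ u, jumpKernel (x i) (t i)) *
          (jumpKernel (x j) r * D (insert j u) (Function.update (A.piecewise t x) j r)) := by
      intro t; ext r; ring
    simp only [hmul, integral_const_mul]
    have hi1 : Integrable (fun t => (∏ i ∈ u, jumpKernel (x i) (t i)) *
        ∫ r, D u (Function.update (A.piecewise t x) j r) ∂uniformUnit) (uniformCube d) := by
      have := (integrable_prod_jumpKernel_mul u x hx (hD.continuous u) (insert j A))
      have hmp := measurePreserving_update j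
      rw [← hmp.map_eq] at this
      have := (this.comp_measurable hmp.measurable).integral_prod_left
      simpa only [Function.comp_def, hpw, hprod, integral_const_mul] using this
    have hi2 : Integrable (fun t => (∏ i ∈ u, jumpKernel (x i) (t i)) *
        ∫ r, jumpKernel (x j) r * D (insert j u) (Function.update (A.piecewise t x) j r)
          ∂uniformUnit) (uniformCube d) := by
      have := (integrable_prod_jumpKernel_mul (insert j u) x hx (hD.continuous (insert j u))
        (insert j A))
      have hmp := measurePreserving_update j
      rw [← hmp.map_eq] at this
      have := (this.comp_measurable hmp.measurable).integral_prod_left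
      simpa only [Function.comp_def, hpw, hprod, Finset.prod_insert hju, Function.update_self,
        mul_assoc, hmul, integral_const_mul] using this
    rw [← integral_add hi1 hi2]
    refine integral_congr_ae ((ae_mem_unitCube d).mono fun t ht => ?_)
    have hy := piecewise_mem_unitCube ht hx A
    have hyj : A.piecewise t x j = x j := by simp [hjA]
    -- The formula is used along the line through the partly frozen point, whose j-th coordinate is
    -- still x j.
    have key := eq_integral_add_integral_jumpKernel_mul
      (h := fun r => D u (Function.update (A.piecewise t x) j r))
      (h' := fun r => D (insert j u) (Function.update (A.piecewise t x) j r)) (x := x j)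
      ((hD.continuous _).comp (continuous_const.update j continuous_id)).continuousOn
      (fun r hr => by
        have := hD.hasDerivWithinAt u j (fun i hi => hj i (hu hi)) _ (update_mem_unitCube hy j hr)
        simpa using this) (mem_unitCube.1 hx j)
    rw [← hyj, Function.update_eq_self] at key
    simp only
    rw [← mul_add, key, hyj]

/-- With every coordinate integrated out, the term of the empty set is exactly the integral being
subtracted. -/
theorem IsMixedFamily.sub_integral_eq {d : ℕ} {D : Finset (Fin d) → (Fin d → ℝ) → ℝ}
    (hD : IsMixedFamily D) {x : Fin d → ℝ} (hx : x ∈ unitCube d) :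
    D ∅ x - ∫ t, D ∅ t ∂uniformCube d =
      ∑ u ∈ (Finset.univ : Finset (Fin d)).powerset with u.Nonempty,
        ∫ t, (∏ j ∈ u, jumpKernel (x j) (t j)) * D u t ∂uniformCube d := by
  rw [hD.eq_sum_integral_piecewise hx Finset.univ, Finset.sum_filter,
    ← Finset.sum_erase_add _ _ (Finset.empty_mem_powerset _),
    ← Finset.sum_erase_add (a := ∅) _ _ (Finset.empty_mem_powerset _)]
  simp only [Finset.piecewise_univ, Finset.prod_empty, one_mul, add_sub_cancel_right,
    Finset.not_nonempty_empty, if_false, add_zero]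
  refine Finset.sum_congr rfl fun u hu => ?_
  rw [if_pos (Finset.nonempty_iff_ne_empty.2 (Finset.ne_of_mem_erase hu))]

/-! ### The mean square error of randomly shifted lattice rules -/

theorem integral_prod_uniformCube {d : ℕ} (u : Finset (Fin d)) (f : Fin d → ℝ → ℝ) :
    ∫ t, ∏ j ∈ u, f j (t j) ∂uniformCube d = ∏ j ∈ u, ∫ r, f j r ∂uniformUnit := by
  have h : ∀ t : Fin d → ℝ, ∏ j ∈ u, f j (t j) =
      ∏ j, (fun j r => if j ∈ u then f j r else 1) j (t j) := by
    intro t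
    simp [Finset.prod_ite_mem]
  simp only [h]
  rw [uniformCube_eq_pi, integral_fintype_prod_eq_prod (fun j r => if j ∈ u then f j r else 1),
    ← Finset.prod_subset (Finset.subset_univ u)]
  · exact Finset.prod_congr rfl fun j hj => by simp [hj]
  · intro j _ hj
    simp [hj]

theorem sq_integral_le_integral_sq {Ω : Type*} [MeasurableSpace Ω] (μ : Measure Ω)
    [IsProbabilityMeasure μ] {f : Ω → ℝ} (hf : Integrable f μ)
    (hf2 : Integrable (fun x => f x ^ 2) μ) : (∫ x, f x ∂μ) ^ 2 ≤ ∫ x, f x ^ 2 ∂μ := by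
  set m := ∫ x, f x ∂μ with hm
  have h : 0 ≤ ∫ x, (f x - m) ^ 2 ∂μ := integral_nonneg fun _ => sq_nonneg _
  have h1 : ∀ x, (f x - m) ^ 2 = f x ^ 2 - 2 * m * f x + m ^ 2 := fun x => by ring
  simp only [h1] at h
  have h2 : Integrable (fun x => f x ^ 2 - 2 * m * f x) μ := hf2.sub (hf.const_mul _)
  rw [integral_add h2 (integrable_const _),
    integral_sub hf2 (hf.const_mul _), integral_const_mul, ← hm] at h
  simp at h
  nlinarith

theorem sum_Icc_periodic {f : ℤ → ℝ} {n : ℕ} (hf : ∀ m, f (m + n) = f m) (k : ℕ) :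
    ∑ i ∈ Finset.Icc 1 n, f (i - k) = ∑ i ∈ Finset.Icc 1 n, f i := by
  have hIcc : ∀ g : ℕ → ℝ, ∑ i ∈ Finset.Icc 1 n, g i = ∑ i ∈ Finset.range n, g (i + 1) := by
    intro g
    rw [Finset.range_eq_Ico, Finset.sum_Ico_add', ← Finset.Ico_succ_right_eq_Icc]
    simp
  induction k with
  | zero => simp
  | succ k ih =>
    rw [← ih, hIcc, hIcc]
    have h1 := Finset.sum_range_succ (fun i : ℕ => f (i - k)) n
    have h2 := Finset.sum_range_succ' (fun i : ℕ => f (i - k)) n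
    have h3 : f ((n : ℤ) - k) = f (((0 : ℕ) : ℤ) - k) := by
      rw [← hf (((0 : ℕ) : ℤ) - k)]
      congr 1
      push_cast
      ring
    have h4 : ∀ i : ℕ, f (((i + 1 : ℕ) : ℤ) - ((k + 1 : ℕ) : ℤ)) = f (i - k) := by
      intro i
      congr 1
      push_cast
      ring
    simp only [h4]
    linarith

/-- The lattice points form a group modulo one: for fixed i' the difference i - i' again runs
through all residues modulo n, so the double sum collapses. -/
theorem sum_sum_prod_bernoulliTwo {d : ℕ} {n : ℕ} (hn : 0 < n) (z : Fin d → ℕ)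
    (u : Finset (Fin d)) :
    ∑ i ∈ Finset.Icc 1 n, ∑ i' ∈ Finset.Icc 1 n, ∏ j ∈ u,
        bernoulliTwo (Int.fract ((i : ℝ) * z j / n - (i' : ℝ) * z j / n)) =
      n * ∑ i ∈ Finset.Icc 1 n, ∏ j ∈ u, bernoulliTwo (Int.fract ((i : ℝ) * z j / n)) := by
  have hn' : (n : ℝ) ≠ 0 := by exact_mod_cast hn.ne'
  set f : ℤ → ℝ := fun m => ∏ j ∈ u, bernoulliTwo (Int.fract ((m : ℝ) * z j / n)) with hf
  have hper : ∀ m, f (m + n) = f m := by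
    intro m
    simp only [hf]
    refine Finset.prod_congr rfl fun j _ => ?_
    congr 1
    rw [Int.fract_eq_fract]
    refine ⟨z j, ?_⟩
    push_cast
    field_simp
    ring
  rw [Finset.sum_comm]
  have : ∀ i' ∈ Finset.Icc 1 n, ∑ i ∈ Finset.Icc 1 n, ∏ j ∈ u,
      bernoulliTwo (Int.fract ((i : ℝ) * z j / n - (i' : ℝ) * z j / n)) =
        ∑ i ∈ Finset.Icc 1 n, ∏ j ∈ u, bernoulliTwo (Int.fract ((i : ℝ) * z j / n)) := by
    intro i' _
    have := sum_Icc_periodic hper i'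
    simp only [hf] at this
    push_cast at this
    rw [← this]
    refine Finset.sum_congr rfl fun i _ => Finset.prod_congr rfl fun j _ => ?_
    congr 2
    ring
  rw [Finset.sum_congr rfl this, Finset.sum_const, Nat.card_Icc, nsmul_eq_mul]
  simp

/-- The average over the lattice points of the product kernel `∏_{j ∈ u} k(x_j, t_j)`. -/
noncomputable def latticeKernel {d : ℕ} (n : ℕ) (z : Fin d → ℕ) (u : Finset (Fin d))
    (Δ t : Fin d → ℝ) : ℝ :=
  latticeRule n z Δ fun x => ∏ j ∈ u, jumpKernel (x j) (t j)

theorem measurable_latticeKernel {d : ℕ} (n : ℕ) (z : Fin d → ℕ) (u : Finset (Fin d))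
    (Δ : Fin d → ℝ) : Measurable (latticeKernel n z u Δ) :=
  measurable_const.mul (Finset.measurable_sum _ fun _ _ => measurable_prod_jumpKernel u _)

theorem abs_latticeRule_le {d : ℕ} {n : ℕ} (hn : 0 < n) (z : Fin d → ℕ) (Δ : Fin d → ℝ)
    {f : (Fin d → ℝ) → ℝ} {M : ℝ} (hM : ∀ x ∈ unitCube d, |f x| ≤ M) :
    |latticeRule n z Δ f| ≤ M := by
  have hn' : (0 : ℝ) < n := by exact_mod_cast hn
  rw [latticeRule, abs_mul, abs_of_pos (by positivity)]
  calc _ ≤ 1 / (n : ℝ) * ∑ i ∈ Finset.Icc 1 n, M := by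
        refine mul_le_mul_of_nonneg_left ((Finset.abs_sum_le_sum_abs _ _).trans
          (Finset.sum_le_sum fun i _ => hM _ (shiftedLatticePoint_mem_unitCube n z Δ i)))
          (by positivity)
    _ = M := by
        rw [Finset.sum_const, Nat.card_Icc, nsmul_eq_mul]
        simp only [Nat.add_sub_cancel]
        field_simp

theorem abs_latticeKernel_le {d : ℕ} {n : ℕ} (hn : 0 < n) (z : Fin d → ℕ) (u : Finset (Fin d))
    (Δ : Fin d → ℝ) {t : Fin d → ℝ} (ht : t ∈ unitCube d) : |latticeKernel n z u Δ t| ≤ 1 :=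
  abs_latticeRule_le hn z Δ fun x _ => abs_prod_jumpKernel_le u x ht

theorem integral_latticeKernel_sq {d : ℕ} (n : ℕ) (z : Fin d → ℕ) (u : Finset (Fin d))
    (Δ : Fin d → ℝ) :
    ∫ t, latticeKernel n z u Δ t ^ 2 ∂uniformCube d =
      (1 / (n : ℝ)) ^ 2 * ∑ i ∈ Finset.Icc 1 n, ∑ i' ∈ Finset.Icc 1 n, ∏ j ∈ u,
        jumpGram (shiftedLatticePoint n z Δ i j) (shiftedLatticePoint n z Δ i' j) := by
  have hsq : ∀ t, latticeKernel n z u Δ t ^ 2 = (1 / (n : ℝ)) ^ 2 *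
      ∑ i ∈ Finset.Icc 1 n, ∑ i' ∈ Finset.Icc 1 n, ∏ j ∈ u,
        (jumpKernel (shiftedLatticePoint n z Δ i j) (t j) *
          jumpKernel (shiftedLatticePoint n z Δ i' j) (t j)) := by
    intro t
    rw [latticeKernel, latticeRule, mul_pow, sq (Finset.sum _ _), Finset.sum_mul_sum]
    simp only [Finset.prod_mul_distrib]
  have hint : ∀ i i', Integrable (fun t => ∏ j ∈ u,
        (jumpKernel (shiftedLatticePoint n z Δ i j) (t j) *
          jumpKernel (shiftedLatticePoint n z Δ i' j) (t j))) (uniformCube d) := by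
    intro i i'
    simp only [Finset.prod_mul_distrib]
    refine integrable_of_bound_on_unitCube (M := 1)
      ((measurable_prod_jumpKernel u _).mul (measurable_prod_jumpKernel u _)) fun t ht => ?_
    rw [abs_mul]
    exact mul_le_one₀ (abs_prod_jumpKernel_le u _ ht) (abs_nonneg _)
      (abs_prod_jumpKernel_le u _ ht)
  simp only [hsq]
  rw [integral_const_mul, integral_finsetSum _ fun i _ => integrable_finsetSum _
    fun i' _ => hint i i']
  congr 1
  refine Finset.sum_congr rfl fun i _ => ?_
  rw [integral_finsetSum _ fun i' _ => hint i i']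
  refine Finset.sum_congr rfl fun i' _ => ?_
  rw [integral_prod_uniformCube u fun j r => jumpKernel (shiftedLatticePoint n z Δ i j) r *
    jumpKernel (shiftedLatticePoint n z Δ i' j) r]
  exact Finset.prod_congr rfl fun j _ =>
    integral_jumpKernel_mul (fract_mem_Icc _) (fract_mem_Icc _)

theorem integrable_prod_jumpGram {d : ℕ} (n : ℕ) (z : Fin d → ℕ) (u : Finset (Fin d))
    (i i' : ℕ) : Integrable (fun Δ => ∏ j ∈ u,
      jumpGram (shiftedLatticePoint n z Δ i j) (shiftedLatticePoint n z Δ i' j))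
        (uniformCube d) := by
  refine integrable_of_bound_on_unitCube (M := ∏ j ∈ u, 4 / 3)
    (Finset.measurable_prod _ fun j _ => ?_) fun Δ _ => ?_
  · exact (measurable_jumpGram_fract ((i : ℝ) * z j / n) ((i' : ℝ) * z j / n)).comp
      (measurable_pi_apply j)
  · rw [Finset.abs_prod]
    exact Finset.prod_le_prod (fun _ _ => abs_nonneg _) fun j _ =>
      abs_jumpGram_le (fract_mem_Icc _) (fract_mem_Icc _)

theorem integrable_integral_latticeKernel_sq {d : ℕ} (n : ℕ) (z : Fin d → ℕ)
    (u : Finset (Fin d)) :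
    Integrable (fun Δ => ∫ t, latticeKernel n z u Δ t ^ 2 ∂uniformCube d) (uniformCube d) := by
  simp only [integral_latticeKernel_sq]
  exact (integrable_finsetSum _ fun i _ => integrable_finsetSum _ fun i' _ =>
    integrable_prod_jumpGram n z u i i').const_mul _

/-- Expanding the square gives a product of Gram functions for each pair of lattice points. The
shift average acts on each coordinate separately and leaves B₂ of the difference, from which the
shift has disappeared. -/
theorem integral_integral_latticeKernel_sq {d : ℕ} {n : ℕ} (hn : 0 < n) (z : Fin d → ℕ)
    (u : Finset (Fin d)) :
    ∫ Δ, ∫ t, latticeKernel n z u Δ t ^ 2 ∂uniformCube d ∂uniformCube d =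
      1 / (n : ℝ) * ∑ i ∈ Finset.Icc 1 n,
        ∏ j ∈ u, bernoulliTwo (Int.fract ((i : ℝ) * (z j : ℝ) / (n : ℝ))) := by
  have hn' : (n : ℝ) ≠ 0 := by exact_mod_cast hn.ne'
  simp only [integral_latticeKernel_sq]
  rw [integral_const_mul, integral_finsetSum _ fun i _ => integrable_finsetSum _ fun i' _ =>
    integrable_prod_jumpGram n z u i i']
  have : ∀ i ∈ Finset.Icc 1 n, ∫ Δ, ∑ i' ∈ Finset.Icc 1 n, ∏ j ∈ u,
      jumpGram (shiftedLatticePoint n z Δ i j) (shiftedLatticePoint n z Δ i' j) ∂uniformCube d =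
      ∑ i' ∈ Finset.Icc 1 n, ∏ j ∈ u,
        bernoulliTwo (Int.fract ((i : ℝ) * z j / n - (i' : ℝ) * z j / n)) := by
    intro i _
    rw [integral_finsetSum _ fun i' _ => integrable_prod_jumpGram n z u i i']
    refine Finset.sum_congr rfl fun i' _ => ?_
    simp only [shiftedLatticePoint]
    rw [integral_prod_uniformCube u fun j r => jumpGram (Int.fract ((i : ℝ) * z j / n + r))
      (Int.fract ((i' : ℝ) * z j / n + r))]
    exact Finset.prod_congr rfl fun j _ => integral_jumpGram_fract _ _
  rw [Finset.sum_congr rfl this, sum_sum_prod_bernoulliTwo hn]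
  field_simp

theorem IsMixedFamily.latticeRule_sub_integral {d : ℕ} {D : Finset (Fin d) → (Fin d → ℝ) → ℝ}
    (hD : IsMixedFamily D) {n : ℕ} (hn : 0 < n) (z : Fin d → ℕ) (Δ : Fin d → ℝ) :
    latticeRule n z Δ (D ∅) - ∫ t, D ∅ t ∂uniformCube d =
      ∑ u ∈ (Finset.univ : Finset (Fin d)).powerset with u.Nonempty,
        ∫ t, latticeKernel n z u Δ t * D u t ∂uniformCube d := by
  have hn' : (n : ℝ) ≠ 0 := by exact_mod_cast hn.ne'
  have h1 : latticeRule n z Δ (D ∅) - ∫ t, D ∅ t ∂uniformCube d =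
      1 / (n : ℝ) * ∑ i ∈ Finset.Icc 1 n, (D ∅ (shiftedLatticePoint n z Δ i) -
        ∫ t, D ∅ t ∂uniformCube d) := by
    rw [Finset.sum_sub_distrib, Finset.sum_const, Nat.card_Icc, nsmul_eq_mul, latticeRule]
    simp only [Nat.add_sub_cancel]
    field_simp
  rw [h1, Finset.sum_congr rfl fun i _ =>
    hD.sub_integral_eq (shiftedLatticePoint_mem_unitCube n z Δ i), Finset.sum_comm, Finset.mul_sum]
  refine Finset.sum_congr rfl fun u _ => ?_
  rw [← integral_finsetSum, ← integral_const_mul]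
  · refine integral_congr_ae (Filter.Eventually.of_forall fun t => ?_)
    simp only [latticeKernel, latticeRule, ← Finset.sum_mul]
    ring
  · intro i _
    have := integrable_prod_jumpKernel_mul u _ (shiftedLatticePoint_mem_unitCube n z Δ i)
      (hD.continuous u) Finset.univ
    simpa only [Finset.piecewise_univ] using this

theorem sq_integral_latticeKernel_mul_le {d : ℕ} {n : ℕ} (hn : 0 < n) (z : Fin d → ℕ)
    (u : Finset (Fin d)) (Δ : Fin d → ℝ) {f : (Fin d → ℝ) → ℝ} (hf : Measurable f) {M : ℝ}
    (hM : ∀ x ∈ unitCube d, |f x| ≤ M) :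
    (∫ t, latticeKernel n z u Δ t * f t ∂uniformCube d) ^ 2 ≤
      M ^ 2 * ∫ t, latticeKernel n z u Δ t ^ 2 ∂uniformCube d := by
  have hmeas : Measurable fun t => latticeKernel n z u Δ t * f t :=
    (measurable_latticeKernel n z u Δ).mul hf
  have hb : ∀ t ∈ unitCube d, |latticeKernel n z u Δ t * f t| ≤ 1 * M := by
    intro t ht
    rw [abs_mul]
    exact mul_le_mul (abs_latticeKernel_le hn z u Δ ht) (hM t ht) (abs_nonneg _) zero_le_one
  have hi2 : Integrable (fun t => (latticeKernel n z u Δ t * f t) ^ 2) (uniformCube d) := by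
    refine integrable_of_bound_on_unitCube (M := (1 * M) ^ 2) (hmeas.pow_const 2) fun t ht => ?_
    rw [abs_pow]
    exact pow_le_pow_left₀ (abs_nonneg _) (hb t ht) 2
  have hi3 : Integrable (fun t => latticeKernel n z u Δ t ^ 2) (uniformCube d) := by
    refine integrable_of_bound_on_unitCube (M := 1)
      ((measurable_latticeKernel n z u Δ).pow_const 2) fun t ht => ?_
    rw [abs_pow]
    exact pow_le_one₀ (abs_nonneg _) (abs_latticeKernel_le hn z u Δ ht)
  refine (sq_integral_le_integral_sq _ (integrable_of_bound_on_unitCube hmeas hb) hi2).trans ?_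
  rw [← integral_const_mul]
  refine integral_mono_ae hi2 (hi3.const_mul _) ((ae_mem_unitCube d).mono fun t ht => ?_)
  simp only
  rw [mul_pow, mul_comm]
  refine mul_le_mul_of_nonneg_right ?_ (sq_nonneg _)
  rw [← sq_abs (f t)]
  exact pow_le_pow_left₀ (abs_nonneg _) (hM t ht) 2

/-- The mean square error of a randomly shifted lattice rule is at most the squared norm of the
integrand times the squared shift-averaged worst-case error. -/
theorem IsMixedFamily.integral_sq_error_le {d : ℕ} {D : Finset (Fin d) → (Fin d → ℝ) → ℝ}
    (hD : IsMixedFamily D) {n : ℕ} (hn : 0 < n) (z : Fin d → ℕ) {γ M N : Finset (Fin d) → ℝ}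
    (hγ : ∀ u, 0 ≤ γ u) (hN : ∀ u, 0 ≤ N u) (hMN : ∀ u, M u ^ 2 ≤ γ u * N u)
    (hM : ∀ u, ∀ x ∈ unitCube d, |D u x| ≤ M u) :
    ∫ Δ, (latticeRule n z Δ (D ∅) - ∫ t, D ∅ t ∂uniformCube d) ^ 2 ∂uniformCube d ≤
      (∑ u ∈ (Finset.univ : Finset (Fin d)).powerset with u.Nonempty, N u) *
        shiftAveragedErrorSq n γ Finset.univ z := by
  set r : Finset (Fin d) → (Fin d → ℝ) → ℝ := fun u Δ =>
    ∫ t, latticeKernel n z u Δ t ^ 2 ∂uniformCube d with hr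
  have hr0 : ∀ u Δ, 0 ≤ r u Δ := fun u Δ => integral_nonneg fun _ => sq_nonneg _
  have hri : ∀ u, Integrable (r u) (uniformCube d) :=
    fun u => integrable_integral_latticeKernel_sq n z u
  have hpt : ∀ Δ, (latticeRule n z Δ (D ∅) - ∫ t, D ∅ t ∂uniformCube d) ^ 2 ≤
      (∑ u ∈ (Finset.univ : Finset (Fin d)).powerset with u.Nonempty, N u) *
        ∑ u ∈ (Finset.univ : Finset (Fin d)).powerset with u.Nonempty, γ u * r u Δ := by
    intro Δ
    rw [hD.latticeRule_sub_integral hn]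
    -- Cauchy–Schwarz over u, in the form a_u² ≤ N_u · (γ_u r_u). Stating the hypothesis as M_u² ≤
    -- γ_u N_u avoids dividing by weights, which vanish when some b_j = 0.
    refine Finset.sum_sq_le_sum_mul_sum_of_sq_le_mul _ (fun u _ => hN u)
      (fun u _ => mul_nonneg (hγ u) (hr0 u Δ)) fun u _ => ?_
    calc _ ≤ M u ^ 2 * r u Δ :=
          sq_integral_latticeKernel_mul_le hn z u Δ (hD.continuous u).measurable (hM u)
      _ ≤ γ u * N u * r u Δ := mul_le_mul_of_nonneg_right (hMN u) (hr0 u Δ)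
      _ = _ := by ring
  refine (integral_mono_of_nonneg (Filter.Eventually.of_forall fun _ => sq_nonneg _)
    ((integrable_finsetSum _ fun u _ => (hri u).const_mul (γ u)).const_mul _)
    (Filter.Eventually.of_forall hpt)).trans_eq ?_
  rw [integral_const_mul, integral_finsetSum _ fun u _ => (hri u).const_mul (γ u)]
  congr 1
  refine Finset.sum_congr rfl fun u _ => ?_
  rw [integral_const_mul, hr, integral_integral_latticeKernel_sq hn]

/-! ### Mixed first partial derivatives -/

section PartialDerivatives

variable {d : ℕ} {E : Type*} [NormedAddCommGroup E] [NormedSpace ℝ E]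

/-- The partial derivative in direction `j`, within `S`. -/
noncomputable def partialWithin (S : Set (Fin d → ℝ)) (j : Fin d) (F : (Fin d → ℝ) → E)
    (x : Fin d → ℝ) : E :=
  fderivWithin ℝ F S x (Pi.single j 1)

/-- Iterated partial derivatives along a list, the last element of the list first. -/
noncomputable def listPartial (S : Set (Fin d → ℝ)) (L : List (Fin d)) (F : (Fin d → ℝ) → E) :
    (Fin d → ℝ) → E :=
  L.foldr (partialWithin S) F

/-- The mixed first partial derivative `∂^u F` in the directions `j ∈ u`. -/
noncomputable def setPartial (S : Set (Fin d → ℝ)) (u : Finset (Fin d)) (F : (Fin d → ℝ) → E) :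
    (Fin d → ℝ) → E :=
  listPartial S (u.sort (· ≤ ·)) F

variable {S : Set (Fin d → ℝ)}

theorem setPartial_empty (F : (Fin d → ℝ) → E) : setPartial S ∅ F = F := by
  simp [setPartial, listPartial]

/-- Derivatives are taken in a fixed order, the smallest index outermost and the largest innermost.
An index can thus be added at either end without commuting derivatives: at the bottom for the
Leibniz rule, at the top for the exponential. -/
theorem setPartial_insert_min {u : Finset (Fin d)} {j : Fin d} (h : ∀ i ∈ u, j < i)
    (F : (Fin d → ℝ) → E) :
    setPartial S (insert j u) F = partialWithin S j (setPartial S u F) := by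
  rw [setPartial, Finset.sort_insert _ (fun i hi => (h i hi).le) (fun hj => (h j hj).false)]
  rfl

theorem sort_insert_max {u : Finset (Fin d)} {j : Fin d} (h : ∀ i ∈ u, i < j) :
    (insert j u).sort (· ≤ ·) = u.sort (· ≤ ·) ++ [j] := by
  have hj : j ∉ u := fun hj => (h j hj).false
  refine List.Perm.eq_of_pairwise' (r := (· ≤ ·)) (Finset.pairwise_sort _ _) ?_ ?_
  · rw [List.pairwise_append]
    refine ⟨Finset.pairwise_sort _ _, List.pairwise_singleton _ _, ?_⟩
    intro a ha b hb
    rw [List.mem_singleton] at hb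
    rw [Finset.mem_sort] at ha
    exact hb ▸ (h a ha).le
  · rw [List.perm_ext_iff_of_nodup (Finset.sort_nodup _ _)]
    · intro a
      simp [or_comm]
    · rw [List.nodup_append]
      refine ⟨Finset.sort_nodup _ _, List.nodup_singleton _, ?_⟩
      intro a ha b hb hab
      rw [List.mem_singleton] at hb
      rw [Finset.mem_sort] at ha
      exact hj (hb ▸ hab ▸ ha)

theorem setPartial_insert_max {u : Finset (Fin d)} {j : Fin d} (h : ∀ i ∈ u, i < j)
    (F : (Fin d → ℝ) → E) :
    setPartial S (insert j u) F = setPartial S u (partialWithin S j F) := by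
  rw [setPartial, sort_insert_max h, listPartial, List.foldr_append]
  rfl

theorem contDiffOn_partialWithin (hS : UniqueDiffOn ℝ S) (j : Fin d) {F : (Fin d → ℝ) → E}
    (hF : ContDiffOn ℝ ∞ F S) : ContDiffOn ℝ ∞ (partialWithin S j F) S :=
  (hF.fderivWithin hS (by simp)).clm_apply contDiffOn_const

theorem contDiffOn_listPartial (hS : UniqueDiffOn ℝ S) (L : List (Fin d)) {F : (Fin d → ℝ) → E}
    (hF : ContDiffOn ℝ ∞ F S) : ContDiffOn ℝ ∞ (listPartial S L F) S := by
  induction L with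
  | nil => exact hF
  | cons j L ih => exact contDiffOn_partialWithin hS j ih

theorem contDiffOn_setPartial (hS : UniqueDiffOn ℝ S) (u : Finset (Fin d)) {F : (Fin d → ℝ) → E}
    (hF : ContDiffOn ℝ ∞ F S) : ContDiffOn ℝ ∞ (setPartial S u F) S :=
  contDiffOn_listPartial hS _ hF

theorem partialWithin_congr {F G : (Fin d → ℝ) → E} (h : Set.EqOn F G S) (j : Fin d) :
    Set.EqOn (partialWithin S j F) (partialWithin S j G) S := fun x hx => by
  rw [partialWithin, partialWithin, fderivWithin_congr h (h hx)]

theorem setPartial_congr {F G : (Fin d → ℝ) → E} (h : Set.EqOn F G S) (u : Finset (Fin d)) :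
    Set.EqOn (setPartial S u F) (setPartial S u G) S := by
  rw [setPartial, setPartial]
  induction u.sort (· ≤ ·) with
  | nil => exact h
  | cons j L ih => exact partialWithin_congr ih j

theorem listPartial_eq_iteratedFDerivWithin (hS : UniqueDiffOn ℝ S) (L : List (Fin d))
    {F : (Fin d → ℝ) → E} (hF : ContDiffOn ℝ ∞ F S) {x : Fin d → ℝ} (hx : x ∈ S) :
    listPartial S L F x =
      iteratedFDerivWithin ℝ L.length F S x fun i => Pi.single (L.get i) (1 : ℝ) := by
  induction L generalizing x with
  | nil => simp [listPartial]
  | cons j L ih =>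
    rw [show listPartial S (j :: L) F = partialWithin S j (listPartial S L F) from rfl]
    rw [partialWithin_congr (fun y hy => ih hy) j hx, partialWithin]
    have hd : DifferentiableWithinAt ℝ (iteratedFDerivWithin ℝ L.length F S) S x :=
      (hF.differentiableOn_iteratedFDerivWithin
        (by exact_mod_cast WithTop.coe_lt_top _) hS) x hx
    rw [fderivWithin_continuousMultilinear_apply_const_apply (hS x hx) hd]
    rfl

theorem hasFDerivWithinAt_of_contDiffOn {F : (Fin d → ℝ) → E} (hF : ContDiffOn ℝ ∞ F S)
    {x : Fin d → ℝ} (hx : x ∈ S) : HasFDerivWithinAt F (fderivWithin ℝ F S x) S x :=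
  ((hF.differentiableOn (by simp)) x hx).hasFDerivWithinAt

theorem partialWithin_mul (hS : UniqueDiffOn ℝ S) {F G : (Fin d → ℝ) → ℝ}
    (hF : ContDiffOn ℝ ∞ F S) (hG : ContDiffOn ℝ ∞ G S) (j : Fin d) {x : Fin d → ℝ} (hx : x ∈ S) :
    partialWithin S j (fun y => F y * G y) x =
      partialWithin S j F x * G x + F x * partialWithin S j G x := by
  have := ((hasFDerivWithinAt_of_contDiffOn hF hx).mul
    (hasFDerivWithinAt_of_contDiffOn hG hx)).fderivWithin (hS x hx)
  simp only [partialWithin]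
  rw [show (fun y => F y * G y) = F * G from rfl, this]
  simp
  ring

theorem partialWithin_sum (hS : UniqueDiffOn ℝ S) {ι : Type*} (t : Finset ι)
    {F : ι → (Fin d → ℝ) → E} (hF : ∀ i ∈ t, ContDiffOn ℝ ∞ (F i) S) (j : Fin d) {x : Fin d → ℝ}
    (hx : x ∈ S) :
    partialWithin S j (fun y => ∑ i ∈ t, F i y) x = ∑ i ∈ t, partialWithin S j (F i) x := by
  have := (HasFDerivWithinAt.fun_sum fun i hi =>
    hasFDerivWithinAt_of_contDiffOn (hF i hi) hx).fderivWithin (hS x hx)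
  simp only [partialWithin]
  rw [this]
  simp

theorem setPartial_sum (hS : UniqueDiffOn ℝ S) {ι : Type*} (t : Finset ι)
    {F : ι → (Fin d → ℝ) → E} (hF : ∀ i ∈ t, ContDiffOn ℝ ∞ (F i) S) (u : Finset (Fin d))
    {x : Fin d → ℝ} (hx : x ∈ S) :
    setPartial S u (fun y => ∑ i ∈ t, F i y) x = ∑ i ∈ t, setPartial S u (F i) x := by
  induction u using Finset.induction_on_min generalizing x with
  | empty => simp [setPartial_empty]
  | insert j u hj ih =>
    simp only [setPartial_insert_min hj]
    rw [partialWithin_congr (fun y hy => ih hy) j hx,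
      partialWithin_sum hS t (fun i hi => contDiffOn_setPartial hS u (hF i hi)) j hx]

theorem partialWithin_const (c : E) (j : Fin d) :
    partialWithin S j (fun _ => c) = fun _ => 0 := by
  ext x
  simp [partialWithin]

theorem setPartial_const {u : Finset (Fin d)} (hu : u.Nonempty) (c : E) :
    setPartial S u (fun _ => c) = fun _ => 0 := by
  induction u using Finset.induction_on_min with
  | empty => simp at hu
  | insert j u hj ih =>
    rw [setPartial_insert_min hj]
    rcases u.eq_empty_or_nonempty with rfl | hne
    · rw [setPartial_empty, partialWithin_const]
    · rw [ih hne, partialWithin_const]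

/-- The Leibniz rule for mixed first derivatives. -/
theorem setPartial_mul (hS : UniqueDiffOn ℝ S) {F G : (Fin d → ℝ) → ℝ}
    (hF : ContDiffOn ℝ ∞ F S) (hG : ContDiffOn ℝ ∞ G S) (u : Finset (Fin d)) {x : Fin d → ℝ}
    (hx : x ∈ S) :
    setPartial S u (fun y => F y * G y) x =
      ∑ w ∈ u.powerset, setPartial S w F x * setPartial S (u \ w) G x := by
  induction u using Finset.induction_on_min generalizing x with
  | empty => simp [setPartial_empty]
  | insert j u hj ih =>
    have hju : j ∉ u := fun h => (hj j h).false
    rw [setPartial_insert_min hj, partialWithin_congr (fun y hy => ih hy) j hx,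
      partialWithin_sum hS _ (fun w _ => (contDiffOn_setPartial hS w hF).mul
        (contDiffOn_setPartial hS (u \ w) hG)) j hx,
      Finset.sum_powerset_insert hju, ← Finset.sum_add_distrib]
    refine Finset.sum_congr rfl fun w hw => ?_
    rw [Finset.mem_powerset] at hw
    have hjw : j ∉ w := fun h => hju (hw h)
    rw [partialWithin_mul hS (contDiffOn_setPartial hS w hF) (contDiffOn_setPartial hS _ hG) j hx,
      ← setPartial_insert_min (fun i hi => hj i (hw hi)),
      ← setPartial_insert_min (fun i hi => hj i (Finset.sdiff_subset hi)),
      Finset.insert_sdiff_of_notMem _ hjw, Finset.insert_sdiff_insert,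
      Finset.sdiff_insert_of_notMem hju, add_comm]

theorem partialWithin_exp (hS : UniqueDiffOn ℝ S) {q : (Fin d → ℝ) → ℝ}
    (hq : ContDiffOn ℝ ∞ q S) (j : Fin d) {x : Fin d → ℝ} (hx : x ∈ S) :
    partialWithin S j (fun y => Real.exp (q y)) x =
      partialWithin S j q x * Real.exp (q x) := by
  have := ((hasFDerivWithinAt_of_contDiffOn hq hx).exp).fderivWithin (hS x hx)
  simp only [partialWithin]
  rw [this]
  simp [mul_comm]

/-- The innermost derivative turns exp q into (∂_j q) exp q, and the Leibniz rule distributes the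
remaining ones. The derivatives of exp q left on the right have strictly lower order, which makes
this a recursion. -/
theorem setPartial_exp_insert_max (hS : UniqueDiffOn ℝ S) {q : (Fin d → ℝ) → ℝ}
    (hq : ContDiffOn ℝ ∞ q S) {u : Finset (Fin d)} {j : Fin d} (hj : ∀ i ∈ u, i < j)
    {x : Fin d → ℝ} (hx : x ∈ S) :
    setPartial S (insert j u) (fun y => Real.exp (q y)) x =
      ∑ w ∈ u.powerset, setPartial S (insert j w) q x *
        setPartial S (u \ w) (fun y => Real.exp (q y)) x := by
  rw [setPartial_insert_max hj, setPartial_congr (fun y hy => partialWithin_exp hS hq j hy) u hx,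
    setPartial_mul hS (contDiffOn_partialWithin hS j hq) hq.exp u hx]
  refine Finset.sum_congr rfl fun w hw => ?_
  rw [setPartial_insert_max fun i hi => hj i (Finset.mem_powerset.1 hw hi)]

theorem setPartial_clm {E' : Type*} [NormedAddCommGroup E'] [NormedSpace ℝ E']
    (hS : UniqueDiffOn ℝ S) (A : E →L[ℝ] E') {F : (Fin d → ℝ) → E} (hF : ContDiffOn ℝ ∞ F S)
    (u : Finset (Fin d)) {x : Fin d → ℝ} (hx : x ∈ S) :
    setPartial S u (fun y => A (F y)) x = A (setPartial S u F x) := by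
  induction u using Finset.induction_on_min generalizing x with
  | empty => simp [setPartial_empty]
  | insert j u hj ih =>
    simp only [setPartial_insert_min hj]
    rw [partialWithin_congr (fun y hy => ih hy) j hx]
    have := (A.hasFDerivAt.comp_hasFDerivWithinAt x
      (hasFDerivWithinAt_of_contDiffOn (contDiffOn_setPartial hS u hF) hx)).fderivWithin (hS x hx)
    simp only [partialWithin]
    rw [show (fun y => A (setPartial S u F y)) = A ∘ setPartial S u F from rfl, this]
    simp

theorem flatMap_replicate_indicator (u : Finset (Fin d)) (L : List (Fin d)) :
    (L.flatMap fun j => List.replicate (if j ∈ u then 1 else 0) j) = L.filter (· ∈ u) := by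
  induction L with
  | nil => rfl
  | cons j L ih =>
    rw [List.flatMap_cons, ih]
    by_cases h : j ∈ u <;> simp [h]

/-- Both lists are increasing with the same members, so the two notions of mixed derivative agree
without appeal to symmetry of higher derivatives. -/
theorem multiIndexDirs_indicator (u : Finset (Fin d)) :
    multiIndexDirs (fun j => if j ∈ u then 1 else 0) = u.sort (· ≤ ·) := by
  rw [multiIndexDirs, flatMap_replicate_indicator]
  refine List.Perm.eq_of_pairwise' (r := (· ≤ ·)) ?_ (Finset.pairwise_sort _ _) ?_
  · exact ((List.pairwise_lt_finRange d).imp fun h => h.le).filter _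
  · rw [List.perm_ext_iff_of_nodup ((List.nodup_finRange d).filter _) (Finset.sort_nodup _ _)]
    intro a
    simp

theorem setPartial_eq_mixedPartial (hS : UniqueDiffOn ℝ S) {F : (Fin d → ℝ) → E}
    (hF : ContDiffOn ℝ ∞ F S) (u : Finset (Fin d)) {x : Fin d → ℝ} (hx : x ∈ S) :
    setPartial S u F x = mixedPartial (fun j => if j ∈ u then 1 else 0) F S x := by
  rw [setPartial, listPartial_eq_iteratedFDerivWithin hS _ hF hx, mixedPartial,
    multiIndexDirs_indicator]

theorem norm_setPartial_le_norm_iteratedFDerivWithin (hS : UniqueDiffOn ℝ S)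
    {F : (Fin d → ℝ) → E} (hF : ContDiffOn ℝ ∞ F S) (u : Finset (Fin d)) {x : Fin d → ℝ}
    (hx : x ∈ S) : ‖setPartial S u F x‖ ≤ ‖iteratedFDerivWithin ℝ u.card F S x‖ := by
  rw [setPartial, listPartial_eq_iteratedFDerivWithin hS _ hF hx]
  refine (ContinuousMultilinearMap.le_opNorm _ _).trans_eq ?_
  have hlen : ∀ n : ℕ, n = u.card →
      ‖iteratedFDerivWithin ℝ n F S x‖ = ‖iteratedFDerivWithin ℝ u.card F S x‖ := by
    rintro n rfl
    rfl
  rw [hlen _ (Finset.length_sort _)]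
  simp [Pi.norm_single]

end PartialDerivatives

/-! ### Mixed families of smooth functions on translated cubes -/

/-- The translated cube `[a, a+1]^d`. -/
def shiftedCube (d : ℕ) (a : ℝ) : Set (Fin d → ℝ) := Set.Icc (fun _ => a) (fun _ => a + 1)

/-- The projection onto the unit cube, followed by the translation to `[a, a+1]^d`. -/
noncomputable def clampShift {d : ℕ} (a : ℝ) (x : Fin d → ℝ) : Fin d → ℝ :=
  fun j => max 0 (min 1 (x j)) + a

theorem clampShift_mem {d : ℕ} (a : ℝ) (x : Fin d → ℝ) : clampShift a x ∈ shiftedCube d a := by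
  simp only [shiftedCube, clampShift, Set.mem_Icc, Pi.le_def]
  refine ⟨fun j => ?_, fun j => ?_⟩
  · have := le_max_left 0 (min 1 (x j))
    linarith
  · have : max 0 (min 1 (x j)) ≤ 1 := max_le zero_le_one (min_le_left _ _)
    linarith

theorem clampShift_eq {d : ℕ} (a : ℝ) {x : Fin d → ℝ} (hx : x ∈ unitCube d) :
    clampShift a x = fun j => x j + a := by
  ext j
  obtain ⟨h0, h1⟩ := mem_unitCube.1 hx j
  rw [clampShift, min_eq_right h1, max_eq_right h0]

theorem continuous_clampShift {d : ℕ} (a : ℝ) : Continuous (clampShift a : (Fin d → ℝ) → _) := by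
  unfold clampShift
  fun_prop

theorem uniqueDiffOn_shiftedCube (d : ℕ) (a : ℝ) : UniqueDiffOn ℝ (shiftedCube d a) := by
  rw [shiftedCube, ← Set.pi_univ_Icc]
  exact UniqueDiffOn.univ_pi fun _ => uniqueDiffOn_Icc (by linarith)

/-- Clamping extends derivatives defined on the closed cube to continuous functions on the whole
space. On the unit cube the clamp is the identity, leaving a mere translation, so derivatives there
are unaffected. -/
theorem isMixedFamily_setPartial {d : ℕ} (a : ℝ) {F : (Fin d → ℝ) → ℝ}
    (hF : ContDiffOn ℝ ∞ F (shiftedCube d a)) :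
    IsMixedFamily fun u x => setPartial (shiftedCube d a) u F (clampShift a x) := by
  have hS := uniqueDiffOn_shiftedCube d a
  refine ⟨fun u => ?_, fun u j hj x hx => ?_⟩
  · exact (contDiffOn_setPartial hS u hF).continuousOn.comp_continuous
      (continuous_clampShift a) (clampShift_mem a)
  · rw [setPartial_insert_min hj, partialWithin]
    have hmem : ∀ r ∈ Set.Icc (0 : ℝ) 1, clampShift a (Function.update x j r) =
        fun i => Function.update x j r i + a :=
      fun r hr => clampShift_eq a (update_mem_unitCube hx j hr)
    have hmaps : Set.MapsTo (fun r i => Function.update x j r i + a) (Set.Icc (0 : ℝ) 1)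
        (shiftedCube d a) := fun r hr => by
      have := clampShift_mem a (Function.update x j r)
      rwa [hmem r hr] at this
    have hcurve : HasDerivWithinAt (fun r i => Function.update x j r i + a)
        (Pi.single j (1 : ℝ) : Fin d → ℝ) (Set.Icc 0 1) (x j) :=
      ((hasDerivAt_update x j (x j)).add_const (fun _ => a)).hasDerivWithinAt
    have hpt : (fun i => Function.update x j (x j) i + a) = clampShift a x := by
      rw [Function.update_eq_self, clampShift_eq a hx]
    have hf := hasFDerivWithinAt_of_contDiffOn (contDiffOn_setPartial hS u hF)
      (clampShift_mem a x)
    rw [← hpt] at hf ⊢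
    have := hf.comp_hasDerivWithinAt (x j) hcurve hmaps
    refine this.congr (fun r hr => ?_) ?_
    · simp only [Function.comp, hmem r hr]
    · simp only [Function.comp, hmem (x j) (mem_unitCube.1 hx j)]

/-- The mean square error of a randomly shifted lattice rule for a smooth integrand on a
translated cube. -/
theorem integral_sq_error_le_of_contDiffOn {d : ℕ} (a : ℝ) {F : (Fin d → ℝ) → ℝ}
    (hF : ContDiffOn ℝ ∞ F (shiftedCube d a)) {n : ℕ} (hn : 0 < n) (z : Fin d → ℕ)
    {γ M N : Finset (Fin d) → ℝ}
    (hγ : ∀ u, 0 ≤ γ u) (hN : ∀ u, 0 ≤ N u) (hMN : ∀ u, M u ^ 2 ≤ γ u * N u)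
    (hM : ∀ u, ∀ x ∈ shiftedCube d a, |setPartial (shiftedCube d a) u F x| ≤ M u) :
    ∫ Δ, (latticeRule n z Δ (fun x => F (clampShift a x)) -
        ∫ x, F (clampShift a x) ∂uniformCube d) ^ 2 ∂uniformCube d ≤
      (∑ u ∈ (Finset.univ : Finset (Fin d)).powerset with u.Nonempty, N u) *
        shiftAveragedErrorSq n γ Finset.univ z := by
  have := (isMixedFamily_setPartial a hF).integral_sq_error_le hn z hγ hN hMN
    fun u x _ => hM u _ (clampShift_mem a x)
  simpa only [setPartial_empty] using this

/-! ### Gevrey bounds -/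

section Gevrey

variable {d : ℕ} {S : Set (Fin d → ℝ)} {β : ℝ} {b : Fin d → ℝ}

/-- Bounds of Gevrey type for the mixed first derivatives. -/
def GevreyBound (S : Set (Fin d → ℝ)) (β : ℝ) (b : Fin d → ℝ) (A κ : ℝ)
    (F : (Fin d → ℝ) → ℝ) : Prop :=
  ∀ u : Finset (Fin d), ∀ x ∈ S, |setPartial S u F x| ≤
    A * κ ^ u.card * ((u.card)! : ℝ) ^ β * ∏ j ∈ u, b j

/-- Each of the 2^|u| Leibniz terms obeys the same bound, as |w|! |u \ w|! ≤ |u|!. The number of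
terms is absorbed by doubling κ. -/
theorem GevreyBound.mul (hS : UniqueDiffOn ℝ S) (hβ : 1 ≤ β) (hb : ∀ j, 0 ≤ b j)
    {F G : (Fin d → ℝ) → ℝ} (hF : ContDiffOn ℝ ∞ F S) (hG : ContDiffOn ℝ ∞ G S) {A B κ : ℝ}
    (hA : 0 ≤ A) (hB : 0 ≤ B) (hκ : 0 ≤ κ) (hbF : GevreyBound S β b A κ F)
    (hbG : GevreyBound S β b B κ G) :
    GevreyBound S β b (A * B) (2 * κ) (fun y => F y * G y) := by
  intro u x hx
  rw [setPartial_mul hS hF hG u hx]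
  have hprod : ∀ w : Finset (Fin d), 0 ≤ ∏ j ∈ w, b j := fun w => Finset.prod_nonneg fun j _ => hb j
  have hterm : ∀ w ∈ u.powerset, |setPartial S w F x * setPartial S (u \ w) G x| ≤
      A * B * κ ^ u.card * ((u.card)! : ℝ) ^ β * ∏ j ∈ u, b j := by
    intro w hw
    rw [Finset.mem_powerset] at hw
    have hcard : w.card + (u \ w).card = u.card := by
      rw [add_comm, Finset.card_sdiff_add_card_eq_card hw]
    have hpr : (∏ j ∈ w, b j) * ∏ j ∈ u \ w, b j = ∏ j ∈ u, b j := by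
      rw [mul_comm, Finset.prod_sdiff hw]
    have hfac : ((w.card)! : ℝ) ^ β * (((u \ w).card)! : ℝ) ^ β ≤ ((u.card)! : ℝ) ^ β := by
      rw [← Real.mul_rpow (by positivity) (by positivity)]
      refine Real.rpow_le_rpow (by positivity) ?_ (by linarith)
      rw [← hcard]
      exact_mod_cast Nat.le_of_dvd (Nat.factorial_pos _)
        (Nat.factorial_mul_factorial_dvd_factorial_add _ _)
    rw [abs_mul]
    calc _ ≤ (A * κ ^ w.card * ((w.card)! : ℝ) ^ β * ∏ j ∈ w, b j) *
          (B * κ ^ (u \ w).card * (((u \ w).card)! : ℝ) ^ β * ∏ j ∈ u \ w, b j) :=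
          mul_le_mul (hbF w x hx) (hbG _ x hx) (abs_nonneg _)
            ((abs_nonneg _).trans (hbF w x hx))
      _ = A * B * κ ^ u.card * (((w.card)! : ℝ) ^ β * (((u \ w).card)! : ℝ) ^ β) *
          ∏ j ∈ u, b j := by
          rw [← hpr, ← hcard, pow_add]
          ring
      _ ≤ _ := by
          refine mul_le_mul_of_nonneg_right ?_ (hprod u)
          exact mul_le_mul_of_nonneg_left hfac (by positivity)
  refine (Finset.abs_sum_le_sum_abs _ _).trans ((Finset.sum_le_sum hterm).trans_eq ?_)
  rw [Finset.sum_const, Finset.card_powerset, nsmul_eq_mul, mul_pow]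
  push_cast
  ring

theorem GevreyBound.const (hb : ∀ j, 0 ≤ b j) {A κ : ℝ} (hκ : 0 ≤ κ) {c : ℝ} (hc : |c| ≤ A) :
    GevreyBound S β b A κ (fun _ => c) := by
  intro u x _
  rcases u.eq_empty_or_nonempty with rfl | hu
  · simpa [setPartial_empty] using hc
  · rw [setPartial_const hu]
    have hprod : 0 ≤ ∏ j ∈ u, b j := Finset.prod_nonneg fun j _ => hb j
    have hA : 0 ≤ A := (abs_nonneg c).trans hc
    simp only [abs_zero]
    positivity

theorem GevreyBound.sum (hS : UniqueDiffOn ℝ S) {ι : Type*} (t : Finset ι)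
    {F : ι → (Fin d → ℝ) → ℝ} (hF : ∀ i ∈ t, ContDiffOn ℝ ∞ (F i) S) {A : ι → ℝ} {κ : ℝ}
    (h : ∀ i ∈ t, GevreyBound S β b (A i) κ (F i)) :
    GevreyBound S β b (∑ i ∈ t, A i) κ (fun y => ∑ i ∈ t, F i y) := by
  intro u x hx
  rw [setPartial_sum hS t hF u hx, Finset.sum_mul, Finset.sum_mul, Finset.sum_mul]
  exact (Finset.abs_sum_le_sum_abs _ _).trans (Finset.sum_le_sum fun i hi => h i hi u x hx)

/-- Strong induction on |u| through the recursion for exp q. The condition q ≤ 0 supplies the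
constant 1 at u = ∅, and the factor 1 + Q in κ is what makes the recursion close. -/
theorem GevreyBound.exp (hS : UniqueDiffOn ℝ S) (hβ : 1 ≤ β) (hb : ∀ j, 0 ≤ b j)
    {q : (Fin d → ℝ) → ℝ} (hq : ContDiffOn ℝ ∞ q S) {Q κ : ℝ} (hQ : 0 ≤ Q) (hκ : 0 ≤ κ)
    (h : GevreyBound S β b Q κ q) (hq0 : ∀ x ∈ S, q x ≤ 0) :
    GevreyBound S β b 1 ((1 + Q) * κ) (fun y => Real.exp (q y)) := by
  suffices H : ∀ m : ℕ, ∀ u : Finset (Fin d), u.card = m → ∀ x ∈ S,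
      |setPartial S u (fun y => Real.exp (q y)) x| ≤
        1 * ((1 + Q) * κ) ^ u.card * ((u.card)! : ℝ) ^ β * ∏ j ∈ u, b j from
    fun u x hx => H _ u rfl x hx
  intro m
  induction m using Nat.strong_induction_on with
  | _ m ih =>
  intro u hu x hx
  have hprod : ∀ w : Finset (Fin d), 0 ≤ ∏ j ∈ w, b j := fun w => Finset.prod_nonneg fun j _ => hb j
  rcases u.eq_empty_or_nonempty with rfl | hne
  · simpa [setPartial_empty] using hq0 x hx
  obtain ⟨j, v, hj, rfl⟩ : ∃ j v, (∀ i ∈ v, i < j) ∧ u = insert j v :=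
    ⟨u.max' hne, u.erase (u.max' hne), fun i hi => Finset.lt_max'_of_mem_erase_max' u hne hi,
      (Finset.insert_erase (Finset.max'_mem u hne)).symm⟩
  have hjv : j ∉ v := fun h => (hj j h).false
  rw [Finset.card_insert_of_notMem hjv] at hu
  rw [setPartial_exp_insert_max hS hq hj hx, Finset.card_insert_of_notMem hjv]
  set l := v.card with hl
  have hterm : ∀ w ∈ v.powerset, |setPartial S (insert j w) q x *
      setPartial S (v \ w) (fun y => Real.exp (q y)) x| ≤
        (fun c : ℕ => Q * (1 + Q) ^ (l - c) * κ ^ (l + 1) *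
          ((((c + 1)! : ℕ) : ℝ) ^ β * (((l - c)! : ℕ) : ℝ) ^ β) * ∏ i ∈ insert j v, b i) w.card := by
    intro w hw
    rw [Finset.mem_powerset] at hw
    have hjw : j ∉ w := fun h => hjv (hw h)
    have hle : w.card ≤ l := Finset.card_le_card hw
    have hcard : (v \ w).card = l - w.card := Finset.card_sdiff_of_subset hw
    have hpr : (∏ i ∈ insert j w, b i) * ∏ i ∈ v \ w, b i = ∏ i ∈ insert j v, b i := by
      rw [Finset.prod_insert hjw, Finset.prod_insert hjv, ← Finset.prod_sdiff hw]
      ring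
    have hpow : κ ^ (w.card + 1) * κ ^ (l - w.card) = κ ^ (l + 1) := by
      rw [← pow_add]
      congr 1
      omega
    have h1 := h (insert j w) x hx
    have h2 := ih (l - w.card) (by omega) (v \ w) hcard x hx
    rw [Finset.card_insert_of_notMem hjw] at h1
    rw [hcard] at h2
    rw [abs_mul]
    refine (mul_le_mul h1 h2 (abs_nonneg _) ((abs_nonneg _).trans h1)).trans_eq ?_
    simp only
    rw [← hpr, ← hpow, mul_pow]
    ring
  refine (Finset.abs_sum_le_sum_abs _ _).trans ((Finset.sum_le_sum hterm).trans ?_)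
  rw [Finset.sum_powerset_apply_card (fun c : ℕ => Q * (1 + Q) ^ (l - c) * κ ^ (l + 1) *
          ((((c + 1)! : ℕ) : ℝ) ^ β * (((l - c)! : ℕ) : ℝ) ^ β) * ∏ i ∈ insert j v, b i)]
  -- The binomial coefficient counts the sets w of size c. One power of the factorials absorbs it,
  -- since binom(l,c) (c+1)! (l-c)! = (c+1) l! ≤ (l+1)!; the other β - 1 powers only need (c+1)!
  -- (l-c)! ≤ (l+1)!.
  have hfac : ∀ c ∈ Finset.range (l + 1), (l.choose c : ℝ) *
      ((((c + 1)! : ℕ) : ℝ) ^ β * (((l - c)! : ℕ) : ℝ) ^ β) ≤ (((l + 1)! : ℕ) : ℝ) ^ β := by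
    intro c hc
    have hcl : c ≤ l := Nat.lt_succ_iff.1 (Finset.mem_range.1 hc)
    rw [← Real.mul_rpow (by positivity) (by positivity)]
    set X : ℝ := (((c + 1)! : ℕ) : ℝ) * (((l - c)! : ℕ) : ℝ) with hX
    set Y : ℝ := (((l + 1)! : ℕ) : ℝ) with hY
    have hX0 : 0 < X := by positivity
    have hY0 : 0 < Y := by positivity
    have hXY : X ≤ Y := by
      rw [hX, hY]
      have := Nat.factorial_mul_factorial_dvd_factorial_add (c + 1) (l - c)
      rw [show c + 1 + (l - c) = l + 1 by omega] at this
      exact_mod_cast Nat.le_of_dvd (Nat.factorial_pos _) this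
    have hcX : (l.choose c : ℝ) * X ≤ Y := by
      have h1 := Nat.choose_mul_factorial_mul_factorial hcl
      have h2 : l.choose c * ((c + 1)! * (l - c)!) = (c + 1) * l ! := by
        rw [Nat.factorial_succ, ← h1]
        ring
      have h3 : (c + 1) * l ! ≤ (l + 1)! := by
        rw [Nat.factorial_succ]
        exact Nat.mul_le_mul_right _ (by omega)
      rw [hX, hY]
      exact_mod_cast h2.trans_le h3
    have hsplit : ∀ t : ℝ, 0 < t → t ^ β = t * t ^ (β - 1) := by
      intro t ht
      rw [Real.rpow_sub_one ht.ne']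
      field_simp
    rw [hsplit X hX0, hsplit Y hY0, ← mul_assoc]
    exact mul_le_mul hcX (Real.rpow_le_rpow hX0.le hXY (by linarith)) (by positivity) hY0.le
  calc _ ≤ ∑ c ∈ Finset.range (l + 1), Q * (1 + Q) ^ (l - c) * κ ^ (l + 1) *
          (((l + 1)! : ℕ) : ℝ) ^ β * ∏ i ∈ insert j v, b i := by
        refine Finset.sum_le_sum fun c hc => ?_
        rw [nsmul_eq_mul]
        have hp := hprod (insert j v)
        calc _ = (Q * (1 + Q) ^ (l - c) * κ ^ (l + 1)) * ((l.choose c : ℝ) *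
              ((((c + 1)! : ℕ) : ℝ) ^ β * (((l - c)! : ℕ) : ℝ) ^ β)) * ∏ i ∈ insert j v, b i := by
              ring
          _ ≤ _ := by
              refine mul_le_mul_of_nonneg_right ?_ hp
              exact mul_le_mul_of_nonneg_left (hfac c hc) (by positivity)
    _ = (Q * ∑ c ∈ Finset.range (l + 1), (1 + Q) ^ (l - c)) *
          (κ ^ (l + 1) * (((l + 1)! : ℕ) : ℝ) ^ β * ∏ i ∈ insert j v, b i) := by
        rw [Finset.mul_sum, Finset.sum_mul]
        exact Finset.sum_congr rfl fun c _ => by ring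
    -- Geometric sum with ratio 1 + Q: Q ∑ (1+Q)^i over i ≤ l equals (1+Q)^(l+1) - 1.
    _ ≤ (1 + Q) ^ (l + 1) *
          (κ ^ (l + 1) * (((l + 1)! : ℕ) : ℝ) ^ β * ∏ i ∈ insert j v, b i) := by
        have hp := hprod (insert j v)
        refine mul_le_mul_of_nonneg_right ?_ (by positivity)
        have hgeom := mul_geom_sum (1 + Q) (l + 1)
        have hrefl := Finset.sum_range_reflect (fun i => (1 + Q) ^ i) (l + 1)
        simp only [Nat.add_sub_cancel, add_sub_cancel_left] at hgeom hrefl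
        rw [hrefl, hgeom]
        linarith
    _ = _ := by rw [mul_pow]; ring

end Gevrey

/-! ### Sums of product-and-order dependent weights -/

/-- The first two terms of the binomial expansion. -/
theorem pow_succ_add_le {S x : ℝ} (hS : 0 ≤ S) (hx : 0 ≤ x) (m : ℕ) :
    S ^ (m + 1) + (m + 1) * (x * S ^ m) ≤ (x + S) ^ (m + 1) := by
  induction m with
  | zero => simp; linarith
  | succ m ih =>
    have h := mul_le_mul_of_nonneg_left ih (add_nonneg hx hS)
    rw [pow_succ' (x + S)]
    refine le_trans ?_ h
    have h1 : 0 ≤ (m + 1) * (x * x * S ^ m) := by positivity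
    have e : (x + S) * (S ^ (m + 1) + (m + 1) * (x * S ^ m)) =
      S ^ (m + 1 + 1) + (((m + 1 : ℕ) : ℝ) + 1) * (x * S ^ (m + 1)) +
        (m + 1) * (x * x * S ^ m) := by
      push_cast
      ring
    rw [e]
    linarith

/-- In the expansion of the m-th power of the sum, every squarefree monomial of degree m occurs m!
times. -/
theorem factorial_mul_esymm_le {ι : Type*} [DecidableEq ι] (A : Finset ι) (a : ι → ℝ)
    (ha : ∀ i, 0 ≤ a i) (m : ℕ) :
    (m ! : ℝ) * ∑ u ∈ A.powersetCard m, ∏ i ∈ u, a i ≤ (∑ i ∈ A, a i) ^ m := by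
  induction A using Finset.induction_on generalizing m with
  | empty =>
    cases m with
    | zero => simp
    | succ m => simp [Finset.powersetCard_eq_empty.2 (show (∅ : Finset ι).card < m + 1 by simp)]
  | insert x A hx ih =>
    cases m with
    | zero => simp
    | succ m =>
      have hdisj : Disjoint (A.powersetCard (m + 1)) ((A.powersetCard m).image (insert x)) := by
        rw [Finset.disjoint_left]
        intro u hu hu'
        rw [Finset.mem_image] at hu'
        obtain ⟨v, -, rfl⟩ := hu'
        exact hx ((Finset.mem_powersetCard.1 hu).1 (Finset.mem_insert_self x v))
      have hnot : ∀ v ∈ A.powersetCard m, x ∉ v := fun v hv h =>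
        hx ((Finset.mem_powersetCard.1 hv).1 h)
      rw [Finset.powersetCard_succ_insert hx, Finset.sum_union hdisj, Finset.sum_image,
        Finset.sum_insert hx]
      · have h1 : ∑ v ∈ A.powersetCard m, ∏ i ∈ insert x v, a i =
            a x * ∑ v ∈ A.powersetCard m, ∏ i ∈ v, a i := by
          rw [Finset.mul_sum]
          exact Finset.sum_congr rfl fun v hv => Finset.prod_insert (hnot v hv)
        have h2 := ih (m + 1)
        have h3 := mul_le_mul_of_nonneg_left (ih m) (mul_nonneg m.cast_add_one_pos.le (ha x))
        refine le_trans ?_ (pow_succ_add_le (Finset.sum_nonneg fun i _ => ha i) (ha x) m)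
        rw [h1, mul_add]
        refine add_le_add h2 ?_
        rw [Nat.factorial_succ]
        push_cast
        linarith
      · intro u hu v hv h
        rw [← Finset.erase_insert (hnot u hu), h, Finset.erase_insert (hnot v hv)]

theorem summable_pow_mul_factorial_rpow {S η : ℝ} (hS : 0 ≤ S) (hη : 0 < η) :
    Summable fun m : ℕ => (m ! : ℝ) ^ (-η) * S ^ m := by
  -- Chosen so that (y^m / m!)^η = (2S)^m / (m!)^η; the bound y^m / m! ≤ exp y then leaves a
  -- geometric series of ratio 1/2.
  set y : ℝ := (2 * S) ^ (1 / η) with hy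
  have hy0 : 0 ≤ y := by positivity
  have hyη : y ^ η = 2 * S := by
    rw [hy, ← Real.rpow_mul (by positivity), one_div_mul_cancel hη.ne', Real.rpow_one]
  refine Summable.of_nonneg_of_le (f := fun m : ℕ => Real.exp y ^ η * (1 / 2) ^ m)
    (fun m => by positivity) (fun m => ?_)
    ((summable_geometric_of_lt_one (by norm_num) (by norm_num)).mul_left _)
  have h1 := Real.rpow_le_rpow (by positivity) (Real.pow_div_factorial_le_exp y hy0 m) hη.le
  rw [Real.div_rpow (by positivity) (by positivity), ← Real.rpow_natCast, ← Real.rpow_mul hy0,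
    mul_comm (m : ℝ), Real.rpow_mul hy0, hyη, Real.rpow_natCast] at h1
  calc _ = (2 * S) ^ m / (m ! : ℝ) ^ η * (1 / 2) ^ m := by
        rw [Real.rpow_neg (by positivity), mul_pow, one_div, inv_pow]
        field_simp
    _ ≤ _ := mul_le_mul_of_nonneg_right h1 (by positivity)

/-- Sums of powers of product-and-order dependent weights are bounded uniformly in the
dimension. -/
theorem exists_bound_sum_pod {β p : ℝ} (hp : 0 < p) (hβp : β * p < 1)
    {b : ℕ → ℝ} (hb : ∀ j, 0 ≤ b j) (hsum : Summable fun j => b j ^ p) {κ τ : ℝ} (hκ : 0 ≤ κ)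
    (hτ : p ≤ τ) :
    ∃ B : ℝ, 0 ≤ B ∧ ∀ s : ℕ, ∑ u ∈ (Finset.univ : Finset (Fin s)).powerset,
      ((u.card ! : ℝ) ^ β * ∏ j ∈ u, (κ * b j)) ^ τ ≤ B := by
  have ha : Summable fun j => (κ * b j) ^ p := by
    simp only [Real.mul_rpow hκ (hb _)]
    exact hsum.mul_left _
  have ha0 : ∀ j, 0 ≤ (κ * b j) ^ p := fun j => Real.rpow_nonneg (mul_nonneg hκ (hb j)) _
  set S := ∑' j, (κ * b j) ^ p with hS
  have hS0 : 0 ≤ S := tsum_nonneg ha0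
  have hη : 0 < 1 - β * p := by linarith
  have hsm := summable_pow_mul_factorial_rpow hS0 hη
  set X₀ := ∑' m : ℕ, (m ! : ℝ) ^ (-(1 - β * p)) * S ^ m with hX₀
  have hX₀0 : 0 ≤ X₀ := tsum_nonneg fun m => by positivity
  refine ⟨X₀ ^ (τ / p), by positivity, fun s => ?_⟩
  set x : Finset (Fin s) → ℝ := fun u => ((u.card ! : ℝ) ^ β * ∏ j ∈ u, (κ * b j)) ^ p with hx
  have hprod : ∀ u : Finset (Fin s), 0 ≤ ∏ j ∈ u, (κ * b j) := fun u =>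
    Finset.prod_nonneg fun j _ => mul_nonneg hκ (hb j)
  have hbase : ∀ u : Finset (Fin s), 0 ≤ (u.card ! : ℝ) ^ β * ∏ j ∈ u, (κ * b j) := fun u =>
    mul_nonneg (by positivity) (hprod u)
  have hx0 : ∀ u, 0 ≤ x u := fun u => Real.rpow_nonneg (hbase u) _
  -- The case τ = p. The sets of size m contribute (m!)^(βp) times an elementary symmetric sum,
  -- hence at most (m!)^(βp - 1) S^m, and βp < 1 makes this summable over m.
  have hxX : ∑ u ∈ (Finset.univ : Finset (Fin s)).powerset, x u ≤ X₀ := by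
    rw [Finset.sum_powerset]
    refine le_trans (Finset.sum_le_sum fun m _ => ?_)
      (hsm.sum_le_tsum (Finset.range ((Finset.univ : Finset (Fin s)).card + 1))
        fun m _ => by positivity)
    have hm0 : (0 : ℝ) < (m ! : ℝ) := by positivity
    have he := factorial_mul_esymm_le (Finset.univ : Finset (Fin s)) (fun j => (κ * b j) ^ p)
      (fun j => ha0 j) m
    have hle : (∑ j : Fin s, (κ * b j) ^ p) ≤ S := by
      rw [Fin.sum_univ_eq_sum_range (fun j => (κ * b j) ^ p) s]
      exact ha.sum_le_tsum _ fun j _ => ha0 j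
    have hsum0 : (0 : ℝ) ≤ ∑ j : Fin s, (κ * b j) ^ p := Finset.sum_nonneg fun j _ => ha0 j
    have hxe : ∑ u ∈ (Finset.univ : Finset (Fin s)).powersetCard m, x u =
        (m ! : ℝ) ^ (β * p) *
          ∑ u ∈ (Finset.univ : Finset (Fin s)).powersetCard m, ∏ j ∈ u, (κ * b j) ^ p := by
      rw [Finset.mul_sum]
      refine Finset.sum_congr rfl fun u hu => ?_
      simp only [hx]
      rw [(Finset.mem_powersetCard.1 hu).2, Real.mul_rpow (by positivity) (hprod u),
        ← Real.rpow_mul (by positivity),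
        Real.finsetProd_rpow u (fun j : Fin s => κ * b j) fun j _ => mul_nonneg hκ (hb j)]
    have hfac : (m ! : ℝ) ^ (β * p) = (m ! : ℝ) ^ (-(1 - β * p)) * (m ! : ℝ) := by
      rw [← Real.rpow_add_one hm0.ne']
      congr 1
      ring
    rw [hxe, hfac, mul_assoc]
    refine mul_le_mul_of_nonneg_left (he.trans ?_) (by positivity)
    exact pow_le_pow_left₀ hsum0 hle m
  have hxτ : ∀ u : Finset (Fin s), ((u.card ! : ℝ) ^ β * ∏ j ∈ u, (κ * b j)) ^ τ = x u ^ (τ / p) := by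
    intro u
    rw [hx, ← Real.rpow_mul (hbase u), mul_div_cancel₀ _ hp.ne']
  have h1 : 1 ≤ τ / p := by rwa [one_le_div hp]
  have hsplit : ∀ t : ℝ, 0 ≤ t → t ^ (τ / p) = t * t ^ (τ / p - 1) := by
    intro t ht
    rcases ht.eq_or_lt with rfl | ht
    · rw [zero_mul, Real.zero_rpow (by positivity)]
    · rw [Real.rpow_sub_one ht.ne']
      field_simp
  -- Larger exponents: each x u is at most the whole sum, so x^(τ/p) = x · x^(τ/p - 1) ≤ x · X₀^(τ/p
  -- - 1).
  calc _ ≤ ∑ u ∈ (Finset.univ : Finset (Fin s)).powerset, x u * X₀ ^ (τ / p - 1) := by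
        refine Finset.sum_le_sum fun u hu => ?_
        rw [hxτ, hsplit _ (hx0 u)]
        refine mul_le_mul_of_nonneg_left (Real.rpow_le_rpow (hx0 u) ?_ (by linarith)) (hx0 u)
        exact (Finset.single_le_sum (fun v _ => hx0 v) hu).trans hxX
    _ ≤ X₀ * X₀ ^ (τ / p - 1) := by
        rw [← Finset.sum_mul]
        exact mul_le_mul_of_nonneg_right hxX (by positivity)
    _ = _ := (hsplit _ hX₀0).symm

/-! ### Bounds for the likelihood -/

section ConstSub

variable {d : ℕ} {S : Set (Fin d → ℝ)}

theorem setPartial_const_sub (hS : UniqueDiffOn ℝ S) (c : ℝ) {F : (Fin d → ℝ) → ℝ}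
    {u : Finset (Fin d)} (hu : u.Nonempty) {x : Fin d → ℝ} (hx : x ∈ S) :
    setPartial S u (fun y => c - F y) x = -setPartial S u F x := by
  induction u using Finset.induction_on_min generalizing x with
  | empty => simp at hu
  | insert j u hj ih =>
    rw [setPartial_insert_min hj, setPartial_insert_min hj]
    rcases u.eq_empty_or_nonempty with rfl | hne
    · rw [setPartial_empty, setPartial_empty, partialWithin, partialWithin,
        fderivWithin_const_sub (hS x hx)]
      rfl
    · rw [partialWithin_congr (fun y hy => ih hne hy) j hx, partialWithin, partialWithin,
        fderivWithin_fun_neg (hS x hx)]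
      rfl

end ConstSub

theorem paramBox_eq_shiftedCube (s : ℕ) : paramBox s = shiftedCube s (-(1 / 2)) := by
  rw [paramBox, shiftedCube]
  norm_num

theorem sum_indicator_eq_card {s : ℕ} (u : Finset (Fin s)) :
    ∑ j, (if j ∈ u then 1 else 0) = u.card := by
  simp

theorem prod_pow_indicator {s : ℕ} (u : Finset (Fin s)) (b : Fin s → ℝ) :
    ∏ j, b j ^ (if j ∈ u then 1 else 0) = ∏ j ∈ u, b j := by
  simp [pow_ite, Finset.prod_ite_mem]

section Likelihood

variable {k s : ℕ} {Γ : Matrix (Fin k) (Fin k) ℝ} {C β : ℝ} {b : Fin s → ℝ}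
  {G : (Fin s → ℝ) → EuclideanSpace ℝ (Fin k)}

theorem norm_setPartial_le_of_mixedPartial (hG : ContDiffOn ℝ ∞ G (paramBox s))
    (hbd : ∀ θ ∈ paramBox s, ∀ ν : Fin s → ℕ, ‖mixedPartial ν G (paramBox s) θ‖ ≤
      C * (((∑ j, ν j)! : ℕ) : ℝ) ^ β * ∏ j : Fin s, b j ^ ν j)
    (u : Finset (Fin s)) {θ : Fin s → ℝ} (hθ : θ ∈ paramBox s) :
    ‖setPartial (paramBox s) u G θ‖ ≤ C * ((u.card)! : ℝ) ^ β * ∏ j ∈ u, b j := by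
  rw [setPartial_eq_mixedPartial (paramBox_eq_shiftedCube s ▸ uniqueDiffOn_shiftedCube s _) hG u hθ]
  have := hbd θ hθ fun j => if j ∈ u then 1 else 0
  rwa [sum_indicator_eq_card, prod_pow_indicator] at this

theorem contDiffOn_apply_of_euclidean (hG : ContDiffOn ℝ ∞ G (paramBox s)) (i : Fin k) :
    ContDiffOn ℝ ∞ (fun θ => G θ i) (paramBox s) :=
  (EuclideanSpace.proj i : EuclideanSpace ℝ (Fin k) →L[ℝ] ℝ).contDiff.comp_contDiffOn hG

/-- The datum y is constant in θ and matters only for u = ∅, where it adds `K` to the bound; for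
other u the larger constant is harmless. -/
theorem gevreyBound_residual (hb : ∀ j, 0 ≤ b j) (hG : ContDiffOn ℝ ∞ G (paramBox s))
    (hbd : ∀ θ ∈ paramBox s, ∀ ν : Fin s → ℕ, ‖mixedPartial ν G (paramBox s) θ‖ ≤
      C * (((∑ j, ν j)! : ℕ) : ℝ) ^ β * ∏ j : Fin s, b j ^ ν j)
    {K : ℝ} (hK : 0 ≤ K) {y : Fin k → ℝ} (hy : ∀ i, |y i| ≤ K) (i : Fin k) :
    GevreyBound (paramBox s) β b (K + C) 1 (fun θ => y i - G θ i) := by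
  have hS : UniqueDiffOn ℝ (paramBox s) :=
    paramBox_eq_shiftedCube s ▸ uniqueDiffOn_shiftedCube s _
  intro u θ hθ
  have hGi : |setPartial (paramBox s) u (fun θ => G θ i) θ| ≤
      C * ((u.card)! : ℝ) ^ β * ∏ j ∈ u, b j := by
    have h1 := setPartial_clm hS (EuclideanSpace.proj i : EuclideanSpace ℝ (Fin k) →L[ℝ] ℝ) hG u hθ
    have h2 := norm_setPartial_le_of_mixedPartial hG hbd u hθ
    refine le_trans ?_ h2
    rw [show setPartial (paramBox s) u (fun θ => G θ i) θ = setPartial (paramBox s) u G θ i from h1]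
    exact PiLp.norm_apply_le (setPartial (paramBox s) u G θ) i
  rcases u.eq_empty_or_nonempty with rfl | hne
  · rw [setPartial_empty] at hGi ⊢
    simp only [Finset.card_empty, Nat.factorial_zero, Nat.cast_one, Real.one_rpow, mul_one,
      Finset.prod_empty, pow_zero] at hGi ⊢
    exact (abs_sub _ _).trans (add_le_add (hy i) hGi)
  · rw [setPartial_const_sub hS _ hne hθ, abs_neg]
    refine hGi.trans ?_
    have hprod : 0 ≤ ∏ j ∈ u, b j := Finset.prod_nonneg fun j _ => hb j
    rw [one_pow, mul_one]
    gcongr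
    linarith

/-- The exponent of the likelihood. -/
noncomputable def potential (Γ : Matrix (Fin k) (Fin k) ℝ) (v : Fin k → ℝ) : ℝ :=
  -(1 / 2) * (v ⬝ᵥ Γ⁻¹.mulVec v)

theorem potential_eq_sum (Γ : Matrix (Fin k) (Fin k) ℝ) (v : Fin k → ℝ) :
    potential Γ v = ∑ i, ∑ j, -(1 / 2) * Γ⁻¹ i j * (v i * v j) := by
  simp only [potential, dotProduct, Matrix.mulVec, Finset.mul_sum]
  refine Finset.sum_congr rfl fun i _ => Finset.sum_congr rfl fun j _ => ?_
  ring

theorem potential_nonpos (hΓ : Γ.PosDef) (v : Fin k → ℝ) : potential Γ v ≤ 0 := by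
  have := hΓ.inv.posSemidef.dotProduct_mulVec_nonneg v
  simp only [star_trivial] at this
  rw [potential]
  linarith

/-- The normalising constant of the likelihood. -/
noncomputable def normConst (Γ : Matrix (Fin k) (Fin k) ℝ) : ℝ :=
  1 / Real.sqrt ((2 * Real.pi) • Γ).det

theorem normConst_pos (hΓ : Γ.PosDef) : 0 < normConst Γ := by
  have : 0 < ((2 * Real.pi) • Γ).det := (hΓ.smul (by positivity)).det_pos
  unfold normConst
  positivity

theorem contDiff_potential (Γ : Matrix (Fin k) (Fin k) ℝ) : ContDiff ℝ ∞ (potential Γ) := by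
  simp only [funext (potential_eq_sum Γ)]
  fun_prop

/-- The constant in the bound on the derivatives of the exponent of the likelihood. -/
noncomputable def potentialConst (Γ : Matrix (Fin k) (Fin k) ℝ) (R : ℝ) : ℝ :=
  ∑ i, ∑ j, |-(1 / 2) * Γ⁻¹ i j| * (R * R)

theorem potentialConst_nonneg (Γ : Matrix (Fin k) (Fin k) ℝ) (R : ℝ) : 0 ≤ potentialConst Γ R :=
  Finset.sum_nonneg fun _ _ => Finset.sum_nonneg fun _ _ =>
    mul_nonneg (abs_nonneg _) (mul_self_nonneg R)

/-- The geometric factor records the operations: 2 for the product of two residuals, 2 for the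
matrix entry, 1 + `potentialConst` for the exponential, and 2 for the normalising constant. None of
them involves s. -/
theorem gevreyBound_likelihood (hΓ : Γ.PosDef) (hC : 0 ≤ C) (hβ : 1 ≤ β) (hb : ∀ j, 0 ≤ b j)
    (hG : ContDiffOn ℝ ∞ G (paramBox s))
    (hbd : ∀ θ ∈ paramBox s, ∀ ν : Fin s → ℕ, ‖mixedPartial ν G (paramBox s) θ‖ ≤
      C * (((∑ j, ν j)! : ℕ) : ℝ) ^ β * ∏ j : Fin s, b j ^ ν j)
    {K : ℝ} (hK : 0 ≤ K) {y : Fin k → ℝ} (hy : ∀ i, |y i| ≤ K) :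
    ContDiffOn ℝ ∞ (fun θ => likelihood Γ G θ y) (paramBox s) ∧
    GevreyBound (paramBox s) β b (normConst Γ) (2 * ((1 + potentialConst Γ (K + C)) * 4))
      (fun θ => likelihood Γ G θ y) := by
  have hS : UniqueDiffOn ℝ (paramBox s) :=
    paramBox_eq_shiftedCube s ▸ uniqueDiffOn_shiftedCube s _
  have hv : ∀ i, ContDiffOn ℝ ∞ (fun θ => y i - G θ i) (paramBox s) := fun i =>
    contDiffOn_const.sub (contDiffOn_apply_of_euclidean hG i)
  have hvb := gevreyBound_residual hb hG hbd hK hy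
  set q : (Fin s → ℝ) → ℝ := fun θ => ∑ i, ∑ j, -(1 / 2) * Γ⁻¹ i j *
    ((y i - G θ i) * (y j - G θ j)) with hq
  have hqp : ∀ θ, q θ = potential Γ fun i => y i - G θ i := fun θ => (potential_eq_sum Γ _).symm
  have hl : (fun θ => likelihood Γ G θ y) = fun θ => normConst Γ * Real.exp (q θ) := by
    ext θ
    rw [hqp]
    rfl
  have hterm : ∀ i j, ContDiffOn ℝ ∞ (fun θ => -(1 / 2) * Γ⁻¹ i j *
      ((y i - G θ i) * (y j - G θ j))) (paramBox s) := fun i j =>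
    contDiffOn_const.mul ((hv i).mul (hv j))
  have hqc : ContDiffOn ℝ ∞ q (paramBox s) :=
    ContDiffOn.sum fun i _ => ContDiffOn.sum fun j _ => hterm i j
  have hqb : GevreyBound (paramBox s) β b (potentialConst Γ (K + C)) 4 q := by
    refine GevreyBound.sum hS _ (fun i _ => ContDiffOn.sum fun j _ => hterm i j) fun i _ => ?_
    refine GevreyBound.sum hS _ (fun j _ => hterm i j) fun j _ => ?_
    have h1 : GevreyBound (paramBox s) β b ((K + C) * (K + C)) 2
        (fun θ => (y i - G θ i) * (y j - G θ j)) := by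
      have := GevreyBound.mul hS hβ hb (hv i) (hv j) (by positivity) (by positivity) zero_le_one
        (hvb i) (hvb j)
      rwa [mul_one] at this
    have := GevreyBound.mul hS hβ hb contDiffOn_const ((hv i).mul (hv j)) (abs_nonneg _)
      (by positivity) zero_le_two
      (GevreyBound.const hb zero_le_two (le_refl |-(1 / 2) * Γ⁻¹ i j|)) h1
    rwa [show (2 : ℝ) * 2 = 4 by norm_num] at this
  have hQ := potentialConst_nonneg Γ (K + C)
  have hexp := GevreyBound.exp hS hβ hb hqc hQ (by norm_num) hqb
    fun θ _ => (hqp θ).trans_le (potential_nonpos hΓ _)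
  rw [hl]
  refine ⟨contDiffOn_const.mul hqc.exp, ?_⟩
  have := GevreyBound.mul hS hβ hb contDiffOn_const hqc.exp (normConst_pos hΓ).le zero_le_one
    (by positivity) (GevreyBound.const hb (by positivity) (abs_of_pos (normConst_pos hΓ)).le) hexp
  rwa [mul_one] at this

end Likelihood

/-! ### Change of variables -/

open scoped Pointwise in
theorem setIntegral_Icc_eq_uniformCube {d : ℕ} (a : ℝ) {r : ℝ} (hr : 0 < r)
    (f : (Fin d → ℝ) → ℝ) :
    ∫ y in Set.Icc (fun _ : Fin d => a) (fun _ => a + r), f y =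
      r ^ d * ∫ x, f (fun j => r * x j + a) ∂uniformCube d := by
  have h1 := Measure.setIntegral_comp_smul (volume : Measure (Fin d → ℝ))
    (fun y => f (y + fun _ => a)) (Set.Icc (fun _ => 0) (fun _ => 1)) hr.ne'
  have hset : r • Set.Icc (fun _ : Fin d => (0 : ℝ)) (fun _ => 1) =
      (fun y => y + fun _ => a) ⁻¹' Set.Icc (fun _ : Fin d => a) (fun _ => a + r) := by
    ext y
    rw [Set.mem_smul_set_iff_inv_smul_mem₀ hr.ne']
    simp only [Set.mem_Icc, Pi.le_def, Set.mem_preimage, Pi.smul_apply, Pi.add_apply, smul_eq_mul,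
      ← forall_and]
    refine forall_congr' fun j => ?_
    rw [inv_mul_le_iff₀ hr, inv_mul_eq_div, le_div_iff₀ hr]
    constructor <;> rintro ⟨h, h'⟩ <;> constructor <;> linarith
  rw [hset, (measurePreserving_add_right (volume : Measure (Fin d → ℝ))
    (fun _ => a)).setIntegral_preimage_emb (MeasurableEquiv.addRight _).measurableEmbedding] at h1
  have h2 : ∫ x, f (fun j => r * x j + a) ∂uniformCube d =
      ∫ x in Set.Icc (fun _ => 0) (fun _ => 1), f (r • x + fun _ => a) := rfl
  rw [h2, h1, Module.finrank_fin_fun, abs_of_pos (by positivity), smul_eq_mul, ← mul_assoc,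
    mul_inv_cancel₀ (by positivity), one_mul]

/-! ### Combination of the errors of the outer and of the inner rule -/

/-- Splits e into e - A and A, where A depends on the second variable alone, and uses (a + b)² ≤ 2a²
+ 2b². In the application A is the inner contribution and e - A the outer error for a frozen inner
shift. -/
theorem integral_prod_sq_le {α β : Type*} [MeasurableSpace α] [MeasurableSpace β]
    (μ : Measure α) (ν : Measure β) [IsProbabilityMeasure μ] [IsProbabilityMeasure ν]
    {e : α × β → ℝ} (he : Measurable e) {A : β → ℝ} (hA : Measurable A) {B V W : ℝ}
    (heB : ∀ᵐ p ∂μ.prod ν, |e p| ≤ B) (hAB : ∀ᵐ y ∂ν, |A y| ≤ B)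
    (hV : ∀ᵐ y ∂ν, ∫ x, (e (x, y) - A y) ^ 2 ∂μ ≤ V) (hW : ∫ y, A y ^ 2 ∂ν ≤ W) :
    ∫ p, e p ^ 2 ∂μ.prod ν ≤ 2 * V + 2 * W := by
  have hsq : ∀ {t : ℝ}, |t| ≤ B → ‖t ^ 2‖ ≤ B ^ 2 := fun {t} h => by
    rw [norm_pow]
    exact pow_le_pow_left₀ (norm_nonneg _) h 2
  have hAe : ∀ᵐ p ∂μ.prod ν, |A p.2| ≤ B := Measure.quasiMeasurePreserving_snd.ae hAB
  have hi : Integrable (fun p => e p ^ 2) (μ.prod ν) :=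
    Integrable.of_bound (he.pow_const 2).aestronglyMeasurable (B ^ 2)
      (heB.mono fun _ h => hsq h)
  have hd : Measurable fun p : α × β => (e p - A p.2) ^ 2 :=
    (he.sub (hA.comp measurable_snd)).pow_const 2
  have hid : Integrable (fun p => (e p - A p.2) ^ 2) (μ.prod ν) := by
    refine Integrable.of_bound hd.aestronglyMeasurable ((2 * B) ^ 2) ?_
    filter_upwards [heB, hAe] with p h h'
    rw [norm_pow]
    refine pow_le_pow_left₀ (norm_nonneg _) ?_ 2
    rw [Real.norm_eq_abs]
    exact (abs_sub _ _).trans (by linarith)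
  have hiA : Integrable (fun y => A y ^ 2) ν :=
    Integrable.of_bound (hA.pow_const 2).aestronglyMeasurable (B ^ 2) (hAB.mono fun _ h => hsq h)
  have hiA' : Integrable (fun p : α × β => A p.2 ^ 2) (μ.prod ν) :=
    hiA.comp_snd μ
  have hA' : ∫ p, A p.2 ^ 2 ∂μ.prod ν = ∫ y, A y ^ 2 ∂ν := by
    rw [integral_prod_symm _ hiA']
    simp
  have hd' : ∫ p, (e p - A p.2) ^ 2 ∂μ.prod ν ≤ V := by
    rw [integral_prod_symm _ hid]
    calc _ ≤ ∫ _, V ∂ν := integral_mono_ae hid.integral_prod_right (integrable_const V) hV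
      _ = V := by simp
  calc _ ≤ ∫ p, (2 * (e p - A p.2) ^ 2 + 2 * A p.2 ^ 2) ∂μ.prod ν := by
        refine integral_mono hi ((hid.const_mul 2).add (hiA'.const_mul 2)) fun p => ?_
        have := sq_nonneg (e p - 2 * A p.2)
        simp only
        nlinarith
    _ = 2 * ∫ p, (e p - A p.2) ^ 2 ∂μ.prod ν + 2 * ∫ p, A p.2 ^ 2 ∂μ.prod ν := by
        rw [integral_add (hid.const_mul 2) (hiA'.const_mul 2), integral_const_mul,
          integral_const_mul]
    _ ≤ _ := by rw [hA']; linarith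

theorem eLpNorm_two_le {α : Type*} [MeasurableSpace α] (μ : Measure α) [IsProbabilityMeasure μ]
    {e : α → ℝ} (he : Measurable e) {B V : ℝ} (heB : ∀ᵐ p ∂μ, |e p| ≤ B)
    (hV : ∫ p, e p ^ 2 ∂μ ≤ V) : eLpNorm e 2 μ ≤ ENNReal.ofReal (Real.sqrt V) := by
  have hm : MemLp e 2 μ := MemLp.of_bound he.aestronglyMeasurable B heB
  rw [hm.eLpNorm_eq_integral_rpow_norm (by norm_num) (by norm_num)]
  refine ENNReal.ofReal_le_ofReal ?_
  rw [Real.sqrt_eq_rpow]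
  have : ∀ p, ‖e p‖ ^ (2 : ℝ) = e p ^ 2 := fun p => by simp
  simp only [ENNReal.toReal_ofNat, this, one_div]
  exact Real.rpow_le_rpow (integral_nonneg fun _ => sq_nonneg _) hV (by norm_num)

/-! ### The function `x log x` -/

theorem contDiffOn_xlogx : ContDiffOn ℝ ∞ xlogx (Set.Ioi 0) :=
  contDiffOn_id.mul (contDiffOn_id.log fun _ hx => (Set.mem_Ioi.1 hx).ne')

theorem continuous_xlogx : Continuous xlogx := Real.continuous_mul_log

/-- The derivative log t + 1 is bounded once t stays away from zero; this is why a positive lower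
bound on the density is needed. -/
theorem exists_lipschitz_xlogx {c M : ℝ} (hc : 0 < c) :
    ∃ L : ℝ, 0 ≤ L ∧ ∀ x ∈ Set.Icc c M, ∀ y ∈ Set.Icc c M, |xlogx x - xlogx y| ≤ L * |x - y| := by
  refine ⟨|Real.log c| + |Real.log M| + 1, by positivity, fun x hx y hy => ?_⟩
  refine (convex_Icc c M).norm_image_sub_le_of_norm_hasDerivWithin_le (𝕜 := ℝ)
    (f := xlogx) (f' := fun t => Real.log t + 1) (fun t ht =>
      (Real.hasDerivAt_mul_log (hc.trans_le ht.1).ne').hasDerivWithinAt) (fun t ht => ?_) hy hx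
  have h1 := Real.log_le_log hc ht.1
  have h2 := Real.log_le_log (hc.trans_le ht.1) ht.2
  rw [Real.norm_eq_abs, abs_le]
  have h3 := neg_abs_le (Real.log c)
  have h4 := le_abs_self (Real.log M)
  have h5 := abs_nonneg (Real.log c)
  have h6 := abs_nonneg (Real.log M)
  constructor <;> linarith

theorem exists_bound_iteratedFDerivWithin_xlogx {c M : ℝ} (hc : 0 < c) (m : ℕ) :
    ∃ B : ℝ, 0 ≤ B ∧ ∀ i ≤ m, ∀ x ∈ Set.Icc c M,
      ‖iteratedFDerivWithin ℝ i xlogx (Set.Ioi 0) x‖ ≤ B := by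
  have h : ∀ i : ℕ, ∃ B : ℝ, ∀ x ∈ Set.Icc c M,
      ‖iteratedFDerivWithin ℝ i xlogx (Set.Ioi 0) x‖ ≤ B := fun i =>
    isCompact_Icc.exists_bound_of_continuousOn
      ((contDiffOn_xlogx.continuousOn_iteratedFDerivWithin (m := i)
        (by exact_mod_cast le_top) isOpen_Ioi.uniqueDiffOn).mono
          fun x hx => hc.trans_le hx.1)
  choose B hB using h
  refine ⟨∑ i ∈ Finset.range (m + 1), |B i|, Finset.sum_nonneg fun _ _ => abs_nonneg _,
    fun i hi x hx => ?_⟩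
  exact ((hB i x hx).trans (le_abs_self _)).trans
    (Finset.single_le_sum (f := fun i => |B i|) (fun _ _ => abs_nonneg _)
      (Finset.mem_range.2 (Nat.lt_succ_of_le hi)))

/-! ### Bounds for the outer integrand -/

section Outer

variable {k : ℕ} {Γ : Matrix (Fin k) (Fin k) ℝ}

/-- The density of the noise, `v ↦ det(2πΓ)^{-1/2} exp(-‖v‖²_{Γ⁻¹} / 2)`. -/
noncomputable def noiseDensity (Γ : Matrix (Fin k) (Fin k) ℝ) (v : Fin k → ℝ) : ℝ :=
  normConst Γ * Real.exp (potential Γ v)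

theorem contDiff_noiseDensity (Γ : Matrix (Fin k) (Fin k) ℝ) :
    ContDiff ℝ ∞ (noiseDensity Γ) :=
  contDiff_const.mul (contDiff_potential Γ).exp

theorem noiseDensity_le (hΓ : Γ.PosDef) (v : Fin k → ℝ) : noiseDensity Γ v ≤ normConst Γ :=
  mul_le_of_le_one_right (normConst_pos hΓ).le (Real.exp_le_one_iff.2 (potential_nonpos hΓ v))

/-- The exponent is continuous, hence bounded on a cube, so the Gaussian density stays above a
positive constant there. -/
theorem exists_noiseDensity_mem_Icc (hΓ : Γ.PosDef) (R : ℝ) :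
    ∃ c : ℝ, 0 < c ∧ ∀ v : Fin k → ℝ, (∀ l, |v l| ≤ R) →
      noiseDensity Γ v ∈ Set.Icc c (normConst Γ) := by
  obtain ⟨P, hP⟩ := (isCompact_Icc (a := fun _ : Fin k => -R) (b := fun _ => R)
    ).exists_bound_of_continuousOn (contDiff_potential Γ).continuous.continuousOn
  refine ⟨normConst Γ * Real.exp (-P), mul_pos (normConst_pos hΓ) (Real.exp_pos _),
    fun v hv => ⟨?_, noiseDensity_le hΓ v⟩⟩
  refine mul_le_mul_of_nonneg_left (Real.exp_le_exp.2 ?_) (normConst_pos hΓ).le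
  have := hP v ⟨fun l => (abs_le.1 (hv l)).1, fun l => (abs_le.1 (hv l)).2⟩
  exact (abs_le.1 this).1

/-- The average of translates of a function. -/
noncomputable def translateAverage (F : (Fin k → ℝ) → ℝ) (n : ℕ) (c : ℕ → Fin k → ℝ)
    (x : Fin k → ℝ) : ℝ :=
  (1 / (n : ℝ)) * ∑ i ∈ Finset.Icc 1 n, F (x - c i)

theorem contDiff_translateAverage {F : (Fin k → ℝ) → ℝ} (hF : ContDiff ℝ ∞ F) (n : ℕ)
    (c : ℕ → Fin k → ℝ) : ContDiff ℝ ∞ (translateAverage F n c) :=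
  contDiff_const.mul (ContDiff.sum fun _ _ => hF.comp (contDiff_id.sub contDiff_const))

theorem norm_iteratedFDeriv_translateAverage_le {F : (Fin k → ℝ) → ℝ} (hF : ContDiff ℝ ∞ F)
    {n : ℕ} (hn : 0 < n) (c : ℕ → Fin k → ℝ) (x : Fin k → ℝ) (m : ℕ) {B : ℝ}
    (hB : ∀ i, ‖iteratedFDeriv ℝ m F (x - c i)‖ ≤ B) :
    ‖iteratedFDeriv ℝ m (translateAverage F n c) x‖ ≤ B := by
  have hn' : (0 : ℝ) < n := by exact_mod_cast hn
  have hFm : ContDiff ℝ m F := hF.of_le (by exact_mod_cast le_top)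
  have hs : ∀ i ∈ Finset.Icc 1 n, ContDiffAt ℝ m (fun y => F (y - c i)) x := fun i _ =>
    (hFm.comp (contDiff_id.sub contDiff_const)).contDiffAt
  rw [show translateAverage F n c = fun y => (1 / (n : ℝ)) • ∑ i ∈ Finset.Icc 1 n, F (y - c i) from
    rfl, iteratedFDeriv_const_smul_apply' (ContDiffAt.sum hs), iteratedFDeriv_fun_sum_apply hs,
    norm_smul, Real.norm_eq_abs, abs_of_pos (by positivity)]
  calc _ ≤ 1 / (n : ℝ) * ∑ i ∈ Finset.Icc 1 n, B := by
        refine mul_le_mul_of_nonneg_left ((norm_sum_le _ _).trans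
          (Finset.sum_le_sum fun i _ => ?_)) (by positivity)
        rw [iteratedFDeriv_comp_sub]
        exact hB i
    _ = B := by
        rw [Finset.sum_const, Nat.card_Icc, nsmul_eq_mul]
        simp only [Nat.add_sub_cancel]
        field_simp

theorem translateAverage_mem_Icc {F : (Fin k → ℝ) → ℝ} {n : ℕ} (hn : 0 < n)
    (c : ℕ → Fin k → ℝ) (x : Fin k → ℝ) {p q : ℝ} (h : ∀ i, F (x - c i) ∈ Set.Icc p q) :
    translateAverage F n c x ∈ Set.Icc p q := by
  have hn' : (0 : ℝ) < n := by exact_mod_cast hn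
  have hc : ∀ t : ℝ, 1 / (n : ℝ) * ∑ i ∈ Finset.Icc 1 n, t = t := by
    intro t
    rw [Finset.sum_const, Nat.card_Icc, nsmul_eq_mul]
    simp only [Nat.add_sub_cancel]
    field_simp
  constructor
  · rw [← hc p]
    exact mul_le_mul_of_nonneg_left (Finset.sum_le_sum fun i _ => (h i).1) (by positivity)
  · rw [← hc q]
    exact mul_le_mul_of_nonneg_left (Finset.sum_le_sum fun i _ => (h i).2) (by positivity)

/-- The mixed first derivatives of `x ↦ g(n⁻¹ ∑ F(x - cᵢ))` are bounded uniformly in `n` and in the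
bounded translations `cᵢ`. -/
theorem exists_bound_setPartial_xlogx_translateAverage {F : (Fin k → ℝ) → ℝ}
    (hF : ContDiff ℝ ∞ F) {R p q : ℝ} (hp : 0 < p)
    (hFpq : ∀ v : Fin k → ℝ, (∀ l, |v l| ≤ 1 + R) → F v ∈ Set.Icc p q) :
    ∃ M : ℝ, 0 ≤ M ∧ ∀ n : ℕ, 0 < n → ∀ c : ℕ → Fin k → ℝ, (∀ i l, |c i l| ≤ R) →
      ContDiffOn ℝ ∞ (fun x => xlogx (translateAverage F n c x)) (shiftedCube k 0) ∧
      ∀ u, ∀ x ∈ shiftedCube k 0, |setPartial (shiftedCube k 0) u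
        (fun x => xlogx (translateAverage F n c x)) x| ≤ M := by
  obtain ⟨B, hB0, hB⟩ := exists_bound_iteratedFDerivWithin_xlogx (M := q) hp k
  have h : ∀ i : ℕ, ∃ A : ℝ, ∀ v ∈ Set.Icc (fun _ : Fin k => -(1 + R)) (fun _ => 1 + R),
      ‖iteratedFDeriv ℝ i F v‖ ≤ A := fun i =>
    isCompact_Icc.exists_bound_of_continuousOn
      (hF.continuous_iteratedFDeriv (m := i) (by exact_mod_cast le_top)).continuousOn
  choose A hA using h
  -- The composition estimate wants the i-th derivative of the inner function bounded by D^i; since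
  -- D ≥ 1, a uniform bound by D is enough for every i ≥ 1.
  set D : ℝ := 1 + ∑ i ∈ Finset.range (k + 1), |A i| with hD
  have hD1 : 1 ≤ D := le_add_of_nonneg_right (Finset.sum_nonneg fun _ _ => abs_nonneg _)
  refine ⟨k ! * B * D ^ k, by positivity, fun n hn c hc => ?_⟩
  have hS := uniqueDiffOn_shiftedCube k 0
  have hmem : ∀ x ∈ shiftedCube k 0, ∀ i l, |(x - c i) l| ≤ 1 + R := by
    intro x hx i l
    have h0 := hx.1 l
    have h1 := hx.2 l
    simp only [zero_add] at h0 h1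
    have := abs_le.1 (hc i l)
    rw [Pi.sub_apply, abs_le]
    constructor <;> linarith
  have hval : ∀ x ∈ shiftedCube k 0, translateAverage F n c x ∈ Set.Icc p q := fun x hx =>
    translateAverage_mem_Icc hn c x fun i => hFpq _ (hmem x hx i)
  have hT := contDiff_translateAverage hF n c
  have hmaps : Set.MapsTo (translateAverage F n c) (shiftedCube k 0) (Set.Ioi 0) :=
    fun x hx => hp.trans_le (hval x hx).1
  have hcomp : ContDiffOn ℝ ∞ (xlogx ∘ translateAverage F n c) (shiftedCube k 0) :=
    contDiffOn_xlogx.comp hT.contDiffOn hmaps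
  refine ⟨hcomp, fun u x hx => ?_⟩
  have hu : u.card ≤ k := (Finset.card_le_univ u).trans_eq (Fintype.card_fin k)
  refine (norm_setPartial_le_norm_iteratedFDerivWithin hS hcomp u hx).trans ?_
  have hle : ∀ i : ℕ, 1 ≤ i → i ≤ u.card →
      ‖iteratedFDerivWithin ℝ i (translateAverage F n c) (shiftedCube k 0) x‖ ≤ D ^ i := by
    intro i h1 hi
    rw [iteratedFDerivWithin_eq_iteratedFDeriv hS
      (hT.of_le (by exact_mod_cast le_top)).contDiffAt hx]
    refine le_trans ?_ (le_self_pow₀ hD1 (by omega))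
    refine norm_iteratedFDeriv_translateAverage_le hF hn c x i fun m => ?_
    refine (hA i _ ⟨fun l => (abs_le.1 (hmem x hx m l)).1,
      fun l => (abs_le.1 (hmem x hx m l)).2⟩).trans ((le_abs_self _).trans ?_)
    refine (Finset.single_le_sum (f := fun i => |A i|) (fun _ _ => abs_nonneg _)
      (Finset.mem_range.2 (by omega : i < k + 1))).trans ?_
    linarith
  refine (norm_iteratedFDerivWithin_comp_le contDiffOn_xlogx hT.contDiffOn
    (by exact_mod_cast le_top) isOpen_Ioi.uniqueDiffOn hS hmaps hx
    (fun i hi => hB i (hi.trans hu) _ (hval x hx)) hle).trans ?_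
  have hfac : (u.card ! : ℝ) ≤ k ! := by exact_mod_cast Nat.factorial_le hu
  have hpow : D ^ u.card ≤ D ^ k := pow_le_pow_right₀ hD1 hu
  have hD0 : 0 ≤ D := zero_le_one.trans hD1
  gcongr

end Outer

/-! ### The error of the full tensor product cubature -/

section FullTensor

variable {k s : ℕ} {Γ : Matrix (Fin k) (Fin k) ℝ} {G : (Fin s → ℝ) → EuclideanSpace ℝ (Fin k)}

/-- The likelihood, transported to the unit cubes. -/
noncomputable def unitLikelihood (Γ : Matrix (Fin k) (Fin k) ℝ)
    (G : (Fin s → ℝ) → EuclideanSpace ℝ (Fin k)) (K : ℝ) (θ : Fin s → ℝ) (x : Fin k → ℝ) : ℝ :=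
  likelihood Γ G (clampShift (-(1 / 2)) θ) fun i => 2 * K * x i - K

theorem unitLikelihood_eq_noiseDensity (K : ℝ) (θ : Fin s → ℝ) (x : Fin k → ℝ) :
    unitLikelihood Γ G K θ x =
      noiseDensity Γ fun i => 2 * K * x i - K - G (clampShift (-(1 / 2)) θ) i := rfl

theorem clampShift_mem_paramBox (θ : Fin s → ℝ) : clampShift (-(1 / 2)) θ ∈ paramBox s := by
  rw [paramBox_eq_shiftedCube]
  exact clampShift_mem _ θ

theorem continuous_unitLikelihood (hG : ContDiffOn ℝ ∞ G (paramBox s)) (K : ℝ) :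
    Continuous fun p : (Fin s → ℝ) × (Fin k → ℝ) => unitLikelihood Γ G K p.1 p.2 := by
  simp only [unitLikelihood_eq_noiseDensity]
  have h : ∀ i, Continuous fun θ => G (clampShift (-(1 / 2)) θ) i := fun i =>
    (contDiffOn_apply_of_euclidean hG i).continuousOn.comp_continuous
      (continuous_clampShift _) clampShift_mem_paramBox
  refine (contDiff_noiseDensity Γ).continuous.comp (continuous_pi fun i => ?_)
  exact ((continuous_const.mul ((continuous_apply i).comp continuous_snd)).sub
    continuous_const).sub ((h i).comp continuous_fst)

theorem abs_scale_le {K : ℝ} (hK : 0 < K) {x : Fin k → ℝ} (hx : x ∈ unitCube k) (i : Fin k) :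
    |2 * K * x i - K| ≤ K := by
  obtain ⟨h0, h1⟩ := mem_unitCube.1 hx i
  rw [abs_le]
  constructor <;> nlinarith

theorem abs_apply_le_of_norm_le {C : ℝ} {v : EuclideanSpace ℝ (Fin k)} (hv : ‖v‖ ≤ C) (i : Fin k) :
    |v i| ≤ C :=
  (PiLp.norm_apply_le v i).trans hv

theorem unitLikelihood_mem_Icc {C K c₀ : ℝ} (hK : 0 < K) (hGC : ∀ θ ∈ paramBox s, ‖G θ‖ ≤ C)
    (hval : ∀ v : Fin k → ℝ, (∀ l, |v l| ≤ K + C) → noiseDensity Γ v ∈ Set.Icc c₀ (normConst Γ))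
    (θ : Fin s → ℝ) {x : Fin k → ℝ} (hx : x ∈ unitCube k) :
    unitLikelihood Γ G K θ x ∈ Set.Icc c₀ (normConst Γ) :=
  hval _ fun i => (abs_sub _ _).trans (add_le_add (abs_scale_le hK hx i)
    (abs_apply_le_of_norm_le (hGC _ (clampShift_mem_paramBox θ)) i))

theorem doubleIntegral_eq {K : ℝ} (hK : 0 < K) :
    doubleIntegral Γ G K = (2 * K) ^ k *
      ∫ x, xlogx (∫ θ, unitLikelihood Γ G K θ x ∂uniformCube s) ∂uniformCube k := by
  have h1 := setIntegral_Icc_eq_uniformCube (d := k) (-K) (r := 2 * K) (by positivity)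
    fun y => xlogx (∫ θ in paramBox s, likelihood Γ G θ y)
  rw [show -K + 2 * K = K by ring] at h1
  rw [doubleIntegral, h1]
  congr 2
  ext x
  congr 1
  have h2 := setIntegral_Icc_eq_uniformCube (d := s) (-(1 / 2)) one_pos
    fun θ => likelihood Γ G θ (fun j => 2 * K * x j + -K)
  rw [one_pow, one_mul] at h2
  rw [paramBox_eq_shiftedCube, shiftedCube, h2]
  refine integral_congr_ae ((ae_mem_unitCube s).mono fun θ hθ => ?_)
  simp only [unitLikelihood, clampShift_eq _ hθ, one_mul, sub_eq_add_neg]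

theorem latticeRule_congr {d n : ℕ} (z : Fin d → ℕ) (Δ : Fin d → ℝ) {f g : (Fin d → ℝ) → ℝ}
    (h : ∀ x ∈ unitCube d, f x = g x) : latticeRule n z Δ f = latticeRule n z Δ g := by
  unfold latticeRule
  congr 1
  exact Finset.sum_congr rfl fun i _ => h _ (shiftedLatticePoint_mem_unitCube n z Δ i)

theorem fullTensorCubature_eq (K : ℝ) (n : ℕ) (z₁ : Fin k → ℕ) (z₂ : Fin s → ℕ)
    (Δ₁ : Fin k → ℝ) (Δ₂ : Fin s → ℝ) :
    fullTensorCubature Γ G K n z₁ z₂ Δ₁ Δ₂ = (2 * K) ^ k * latticeRule n z₁ Δ₁ fun x =>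
      xlogx (latticeRule n z₂ Δ₂ fun θ => unitLikelihood Γ G K θ x) := by
  unfold fullTensorCubature
  congr 2
  ext x
  congr 1
  refine latticeRule_congr z₂ Δ₂ fun θ hθ => ?_
  simp only [unitLikelihood, clampShift_eq _ hθ, sub_eq_add_neg]

theorem measurable_shiftedLatticePoint {d : ℕ} (n : ℕ) (z : Fin d → ℕ) (i : ℕ) :
    Measurable fun Δ : Fin d → ℝ => shiftedLatticePoint n z Δ i :=
  measurable_pi_lambda _ fun j =>
    measurable_fract.comp (measurable_const.add (measurable_pi_apply j))

theorem measurable_latticeRule {d : ℕ} {α : Type*} [MeasurableSpace α] (n : ℕ) (z : Fin d → ℕ)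
    {f : α → (Fin d → ℝ) → ℝ} (hf : Measurable fun p : α × (Fin d → ℝ) => f p.1 p.2)
    {Δ : α → Fin d → ℝ} (hΔ : Measurable Δ) :
    Measurable fun a => latticeRule n z (Δ a) (f a) :=
  measurable_const.mul (Finset.measurable_sum _ fun i _ =>
    hf.comp (measurable_id.prodMk ((measurable_shiftedLatticePoint n z i).comp hΔ)))

theorem measurable_latticeRule_right {d : ℕ} {α : Type*} [MeasurableSpace α] (n : ℕ)
    (z : Fin d → ℕ) {f : (Fin d → ℝ) → α → ℝ}
    (hf : Measurable fun p : (Fin d → ℝ) × α => f p.1 p.2) :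
    Measurable fun p : (Fin d → ℝ) × α => latticeRule n z p.1 fun θ => f θ p.2 := by
  have h : Measurable fun p : ((Fin d → ℝ) × α) × (Fin d → ℝ) => f p.2 p.1.2 :=
    hf.comp (measurable_snd.prodMk (measurable_snd.comp measurable_fst))
  exact measurable_latticeRule n z (f := fun p θ => f θ p.2) h measurable_fst

/-- A lattice rule is an average of point values, that is, `translateAverage` at the origin with the
negated lattice points as translations. -/
theorem latticeRule_mem_Icc {d n : ℕ} (hn : 0 < n) (z : Fin d → ℕ) (Δ : Fin d → ℝ)
    {f : (Fin d → ℝ) → ℝ} {p q : ℝ} (h : ∀ x, f x ∈ Set.Icc p q) :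
    latticeRule n z Δ f ∈ Set.Icc p q := by
  have := translateAverage_mem_Icc (F := f) hn (fun i => -shiftedLatticePoint n z Δ i) 0
    (p := p) (q := q) fun i => h _
  simpa only [translateAverage, zero_sub, neg_neg, latticeRule] using this

theorem integral_mem_Icc {d : ℕ} {f : (Fin d → ℝ) → ℝ} (hf : Measurable f) {p q : ℝ}
    (h : ∀ x, f x ∈ Set.Icc p q) : ∫ x, f x ∂uniformCube d ∈ Set.Icc p q := by
  have hi : Integrable f (uniformCube d) := integrable_of_bound_on_unitCube (M := |p| + |q|) hf
    fun x _ => by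
      have h1 := neg_abs_le p
      have h2 := le_abs_self q
      have h3 := abs_nonneg p
      have h4 := abs_nonneg q
      rw [abs_le]
      constructor <;> linarith [(h x).1, (h x).2]
  have hc : ∀ t : ℝ, ∫ _, t ∂uniformCube d = t := fun t => by simp
  exact ⟨(hc p).symm.trans_le (integral_mono (integrable_const p) hi fun x => (h x).1),
    (integral_mono hi (integrable_const q) fun x => (h x).2).trans_eq (hc q)⟩

theorem abs_integral_le_of_bound {d : ℕ} {f : (Fin d → ℝ) → ℝ} {M : ℝ}
    (h : ∀ x ∈ unitCube d, |f x| ≤ M) : |∫ x, f x ∂uniformCube d| ≤ M := by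
  have := norm_integral_le_of_norm_le_const (μ := uniformCube d) (f := f) (C := M)
    ((ae_mem_unitCube d).mono fun x hx => h x hx)
  simpa using this

/-- The exact inner integral. -/
noncomputable def innerIntegral (Γ : Matrix (Fin k) (Fin k) ℝ)
    (G : (Fin s → ℝ) → EuclideanSpace ℝ (Fin k)) (K : ℝ) (x : Fin k → ℝ) : ℝ :=
  ∫ θ, unitLikelihood Γ G K θ x ∂uniformCube s

/-- The approximation of the inner integral by the shifted lattice rule. -/
noncomputable def innerRule (Γ : Matrix (Fin k) (Fin k) ℝ)
    (G : (Fin s → ℝ) → EuclideanSpace ℝ (Fin k)) (K : ℝ) (n : ℕ) (z : Fin s → ℕ)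
    (Δ : Fin s → ℝ) (x : Fin k → ℝ) : ℝ :=
  latticeRule n z Δ fun θ => unitLikelihood Γ G K θ x

theorem measurable_unitLikelihood (hG : ContDiffOn ℝ ∞ G (paramBox s)) (K : ℝ) :
    Measurable fun p : (Fin s → ℝ) × (Fin k → ℝ) => unitLikelihood Γ G K p.1 p.2 :=
  (continuous_unitLikelihood hG K).measurable

theorem measurable_innerIntegral (hG : ContDiffOn ℝ ∞ G (paramBox s)) (K : ℝ) :
    Measurable (innerIntegral Γ G K) :=
  ((measurable_unitLikelihood hG K).stronglyMeasurable.integral_prod_left'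
    (μ := uniformCube s)).measurable

theorem measurable_innerRule (hG : ContDiffOn ℝ ∞ G (paramBox s)) (K : ℝ) (n : ℕ)
    (z : Fin s → ℕ) :
    Measurable fun p : (Fin s → ℝ) × (Fin k → ℝ) => innerRule Γ G K n z p.1 p.2 :=
  measurable_latticeRule_right n z (measurable_unitLikelihood hG K)

/-- The combination of the errors of the outer and of the inner rule, for an abstract inner
integral `H` and its approximations `Q`. -/
theorem integral_sq_outer_error_le {c₀ M L V W : ℝ} {H : (Fin k → ℝ) → ℝ}
    {Q : (Fin s → ℝ) → (Fin k → ℝ) → ℝ} (hHm : Measurable H)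
    (hQm : Measurable fun p : (Fin s → ℝ) × (Fin k → ℝ) => Q p.1 p.2)
    (hHmem : ∀ x ∈ unitCube k, H x ∈ Set.Icc c₀ M)
    (hQmem : ∀ Δ, ∀ x ∈ unitCube k, Q Δ x ∈ Set.Icc c₀ M)
    (hL : ∀ x ∈ Set.Icc c₀ M, ∀ y ∈ Set.Icc c₀ M, |xlogx x - xlogx y| ≤ L * |x - y|)
    {n : ℕ} (hn : 0 < n) (z : Fin k → ℕ)
    (hV : ∀ Δ, ∫ Δ₁, (latticeRule n z Δ₁ (fun x => xlogx (Q Δ x)) -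
      ∫ x, xlogx (Q Δ x) ∂uniformCube k) ^ 2 ∂uniformCube k ≤ V)
    (hW : ∀ x ∈ unitCube k, ∫ Δ, (Q Δ x - H x) ^ 2 ∂uniformCube s ≤ W)
    {e : (Fin k → ℝ) × (Fin s → ℝ) → ℝ} (he : e = fun Δ =>
      ∫ x, xlogx (H x) ∂uniformCube k - latticeRule n z Δ.1 fun x => xlogx (Q Δ.2 x)) :
    Measurable e ∧ (∃ B, ∀ p, |e p| ≤ B) ∧
      ∫ p, e p ^ 2 ∂(uniformCube k).prod (uniformCube s) ≤ 2 * V + 2 * (L ^ 2 * W) := by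
  -- The part of the error independent of the outer shift: both outer integrals are exact, only the
  -- inner integral is approximated.
  obtain ⟨A, hA⟩ : ∃ A : (Fin s → ℝ) → ℝ, A = fun Δ =>
    ∫ x, xlogx (H x) ∂uniformCube k - ∫ x, xlogx (Q Δ x) ∂uniformCube k := ⟨_, rfl⟩
  have hg : Measurable xlogx := continuous_xlogx.measurable
  have hgQm : Measurable fun p : (Fin s → ℝ) × (Fin k → ℝ) => xlogx (Q p.1 p.2) := hg.comp hQm
  have hem : Measurable e := by
    rw [he]
    exact measurable_const.sub
      (measurable_latticeRule (α := (Fin k → ℝ) × (Fin s → ℝ)) n z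
        (f := fun p x => xlogx (Q p.2 x)) (Δ := Prod.fst)
        (hgQm.comp ((measurable_snd.comp measurable_fst).prodMk measurable_snd)) measurable_fst)
  have hAm : Measurable A := by
    rw [hA]
    exact measurable_const.sub
      (hgQm.stronglyMeasurable.integral_prod_right' (ν := uniformCube k)).measurable
  obtain ⟨B, hB⟩ := (isCompact_Icc (a := c₀) (b := M)).exists_bound_of_continuousOn
    continuous_xlogx.continuousOn
  have hgH : ∀ x ∈ unitCube k, |xlogx (H x)| ≤ B := fun x hx => hB _ (hHmem x hx)
  have hgQ : ∀ Δ, ∀ x ∈ unitCube k, |xlogx (Q Δ x)| ≤ B := fun Δ x hx => hB _ (hQmem Δ x hx)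
  have heB : ∀ p, |e p| ≤ B + B := fun p => by
    rw [he]
    exact (abs_sub _ _).trans
      (add_le_add (abs_integral_le_of_bound hgH) (abs_latticeRule_le hn z _ (hgQ p.2)))
  have hAB : ∀ Δ, |A Δ| ≤ B + B := fun Δ => by
    rw [hA]
    exact (abs_sub _ _).trans
      (add_le_add (abs_integral_le_of_bound hgH) (abs_integral_le_of_bound (hgQ Δ)))
  have heV : ∀ Δ, ∫ x, (e (x, Δ) - A Δ) ^ 2 ∂uniformCube k ≤ V := by
    intro Δ
    refine le_trans (le_of_eq ?_) (hV Δ)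
    refine integral_congr_ae (Filter.Eventually.of_forall fun x => ?_)
    simp only [he, hA]
    ring
  obtain ⟨E, hE⟩ : ∃ E : (Fin s → ℝ) × (Fin k → ℝ) → ℝ,
    E = fun p => (Q p.1 p.2 - H p.2) ^ 2 := ⟨_, rfl⟩
  have hEm : Measurable E := by
    rw [hE]
    exact (hQm.sub (hHm.comp measurable_snd)).pow_const 2
  have hEb : ∀ Δ, ∀ x ∈ unitCube k, |E (Δ, x)| ≤ (M - c₀) ^ 2 := by
    intro Δ x hx
    simp only [hE]
    rw [abs_pow]
    refine pow_le_pow_left₀ (abs_nonneg _) ?_ 2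
    rw [abs_le]
    constructor <;> linarith [(hHmem x hx).1, (hHmem x hx).2, (hQmem Δ x hx).1, (hQmem Δ x hx).2]
  have hEi : Integrable E ((uniformCube s).prod (uniformCube k)) := by
    refine Integrable.of_bound hEm.aestronglyMeasurable ((M - c₀) ^ 2) ?_
    filter_upwards [Measure.quasiMeasurePreserving_snd.ae (ae_mem_unitCube k)] with p hp
    exact hEb p.1 p.2 hp
  -- The square of an integral is at most the integral of the square, and the Lipschitz bound for g
  -- removes x log x. Exchanging the order of integration afterwards allows the inner error bound to
  -- be used at each fixed x.
  have hA2 : ∀ Δ, A Δ ^ 2 ≤ L ^ 2 * ∫ x, E (Δ, x) ∂uniformCube k := by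
    intro Δ
    have hm1 : Measurable fun x => xlogx (H x) := hg.comp hHm
    have hm2 : Measurable fun x => xlogx (Q Δ x) :=
      hgQm.comp (measurable_const.prodMk measurable_id)
    have hm : Measurable fun x => xlogx (H x) - xlogx (Q Δ x) := hm1.sub hm2
    have hb : ∀ x ∈ unitCube k, |xlogx (H x) - xlogx (Q Δ x)| ≤ B + B := fun x hx =>
      (abs_sub _ _).trans (add_le_add (hgH x hx) (hgQ Δ x hx))
    have hi2 : Integrable (fun x => (xlogx (H x) - xlogx (Q Δ x)) ^ 2) (uniformCube k) :=
      integrable_of_bound_on_unitCube (M := (B + B) ^ 2) (hm.pow_const 2) fun x hx => by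
        rw [abs_pow]
        exact pow_le_pow_left₀ (abs_nonneg _) (hb x hx) 2
    have hiE : Integrable (fun x => E (Δ, x)) (uniformCube k) :=
      integrable_of_bound_on_unitCube (hEm.comp (measurable_const.prodMk measurable_id)) (hEb Δ)
    simp only [hA]
    rw [← integral_sub (integrable_of_bound_on_unitCube hm1 hgH)
      (integrable_of_bound_on_unitCube hm2 (hgQ Δ))]
    refine (sq_integral_le_integral_sq _ (integrable_of_bound_on_unitCube hm hb) hi2).trans ?_
    rw [← integral_const_mul]
    refine integral_mono_ae hi2 (hiE.const_mul _) ((ae_mem_unitCube k).mono fun x hx => ?_)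
    have h1 := hL _ (hHmem x hx) _ (hQmem Δ x hx)
    have h2 := pow_le_pow_left₀ (abs_nonneg _) h1 2
    rw [mul_pow, sq_abs, sq_abs] at h2
    refine h2.trans_eq ?_
    simp only [hE]
    ring
  have hAW : ∫ Δ, A Δ ^ 2 ∂uniformCube s ≤ L ^ 2 * W := by
    calc _ ≤ ∫ Δ, L ^ 2 * ∫ x, E (Δ, x) ∂uniformCube k ∂uniformCube s :=
          integral_mono_of_nonneg (Filter.Eventually.of_forall fun _ => sq_nonneg _)
            (hEi.integral_prod_left.const_mul _) (Filter.Eventually.of_forall hA2)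
      _ = L ^ 2 * ∫ x, ∫ Δ, E (Δ, x) ∂uniformCube s ∂uniformCube k := by
          rw [integral_const_mul]
          congr 1
          exact integral_integral_swap (f := fun Δ x => E (Δ, x)) hEi
      _ ≤ L ^ 2 * W := by
          refine mul_le_mul_of_nonneg_left ?_ (sq_nonneg _)
          refine (integral_mono_ae hEi.integral_prod_right (integrable_const W)
            ((ae_mem_unitCube k).mono fun x hx => ?_)).trans_eq ?_
          · simp only [hE]
            exact hW x hx
          simp
  exact ⟨hem, ⟨_, heB⟩, integral_prod_sq_le (uniformCube k) (uniformCube s) hem hAm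
    (Filter.Eventually.of_forall heB) (Filter.Eventually.of_forall hAB)
    (Filter.Eventually.of_forall heV) hAW⟩

/-- Rescaling both domains to unit cubes pulls out the volume factor (2K)^k, and the bounds on the
density confine inner integral and inner rule to the interval where g is Lipschitz. -/
theorem fullTensorRMSError_le {C K c₀ L V W : ℝ} (hK : 0 < K)
    (hG : ContDiffOn ℝ ∞ G (paramBox s)) (hGC : ∀ θ ∈ paramBox s, ‖G θ‖ ≤ C)
    (hval : ∀ v : Fin k → ℝ, (∀ l, |v l| ≤ K + C) → noiseDensity Γ v ∈ Set.Icc c₀ (normConst Γ))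
    (hL : ∀ x ∈ Set.Icc c₀ (normConst Γ), ∀ y ∈ Set.Icc c₀ (normConst Γ),
      |xlogx x - xlogx y| ≤ L * |x - y|)
    {n : ℕ} (hn : 0 < n) (z₁ : Fin k → ℕ) (z₂ : Fin s → ℕ)
    (hV : ∀ Δ₂ : Fin s → ℝ, ∫ Δ₁, (latticeRule n z₁ Δ₁
        (fun x => xlogx (innerRule Γ G K n z₂ Δ₂ x)) -
      ∫ x, xlogx (innerRule Γ G K n z₂ Δ₂ x) ∂uniformCube k) ^ 2 ∂uniformCube k ≤ V)
    (hW : ∀ x ∈ unitCube k, ∫ Δ₂, (innerRule Γ G K n z₂ Δ₂ x - innerIntegral Γ G K x) ^ 2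
      ∂uniformCube s ≤ W) :
    fullTensorRMSError Γ G K n z₁ z₂ ≤
      ENNReal.ofReal ((2 * K) ^ k * Real.sqrt (2 * V + 2 * (L ^ 2 * W))) := by
  have hHmem : ∀ x ∈ unitCube k, innerIntegral Γ G K x ∈ Set.Icc c₀ (normConst Γ) := fun x hx =>
    integral_mem_Icc ((measurable_unitLikelihood hG K).comp
      (measurable_id.prodMk measurable_const))
      fun θ => unitLikelihood_mem_Icc hK hGC hval θ hx
  have hQmem : ∀ Δ, ∀ x ∈ unitCube k, innerRule Γ G K n z₂ Δ x ∈ Set.Icc c₀ (normConst Γ) :=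
    fun Δ x hx => latticeRule_mem_Icc hn z₂ Δ fun θ => unitLikelihood_mem_Icc hK hGC hval θ hx
  obtain ⟨e, he⟩ : ∃ e : (Fin k → ℝ) × (Fin s → ℝ) → ℝ, e = fun Δ =>
    ∫ x, xlogx (innerIntegral Γ G K x) ∂uniformCube k -
      latticeRule n z₁ Δ.1 fun x => xlogx (innerRule Γ G K n z₂ Δ.2 x) := ⟨_, rfl⟩
  obtain ⟨hem, ⟨B, heB⟩, hsq⟩ := integral_sq_outer_error_le (measurable_innerIntegral hG K)
    (measurable_innerRule hG K n z₂) hHmem hQmem hL hn z₁ hV hW he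
  have hfun : (fun Δ : (Fin k → ℝ) × (Fin s → ℝ) =>
      doubleIntegral Γ G K - fullTensorCubature Γ G K n z₁ z₂ Δ.1 Δ.2) =
        (2 * K) ^ k • e := by
    ext Δ
    rw [doubleIntegral_eq hK, fullTensorCubature_eq, ← mul_sub, he]
    rfl
  rw [fullTensorRMSError, hfun, eLpNorm_const_smul, ENNReal.ofReal_mul (by positivity)]
  have hnorm : ‖(2 * K) ^ k‖ₑ = ENNReal.ofReal ((2 * K) ^ k) :=
    Real.enorm_of_nonneg (by positivity)
  rw [hnorm]
  exact mul_le_mul_right (eLpNorm_two_le _ hem (Filter.Eventually.of_forall heB) hsq) _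

end FullTensor

/-! ### Constants independent of the dimension -/

theorem varrho_pos {lam : ℝ} (h : 1 / 2 < lam) : 0 < varrho lam := by
  have hs : Summable fun m : ℕ => ((m : ℝ) + 1) ^ (-(2 * lam)) := by
    have := (summable_nat_add_iff 1).2 (Real.summable_nat_rpow.2 (by linarith : -(2 * lam) < -1))
    simpa using this
  have : 0 < ∑' m : ℕ, ((m : ℝ) + 1) ^ (-(2 * lam)) :=
    hs.tsum_pos (fun m => by positivity) 0 (by positivity)
  unfold varrho
  positivity

/-- The factor of `b_j` in the product-and-order dependent weights. -/
noncomputable def podFactor (C β μ δ : ℝ) : ℝ :=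
  (2 : ℝ) ^ β * C / Real.sqrt μ / Real.sqrt (varrho (1 / (2 - 2 * δ)))

theorem podWeight_eq (s : ℕ) (C β μ δ : ℝ) (b : ℕ → ℝ) (u : Finset (Fin s)) :
    podWeight s C β μ δ b u =
      ((u.card ! : ℝ) ^ β * ∏ j ∈ u, (podFactor C β μ δ * b j)) ^
        (2 / (1 + 1 / (2 - 2 * δ))) := by
  unfold podWeight podFactor
  congr 2
  exact Finset.prod_congr rfl fun j _ => by ring

/-- Splits a squared Gevrey bound into two weights with exponents adding up to 2. The geometric
factors may be distributed freely as long as their product is right. -/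
theorem rpow_mul_rpow_eq_sq {κ κ₁ κ₃ X τ₁ τ₂ : ℝ} (hκ₁ : 0 ≤ κ₁) (hκ₃ : 0 ≤ κ₃) (hX : 0 ≤ X)
    (hτ₁ : 0 ≤ τ₁) (hτ₂ : 0 ≤ τ₂) (hτ : τ₁ + τ₂ = 2) (h : κ₁ ^ τ₁ * κ₃ ^ τ₂ = κ ^ 2) (m : ℕ) :
    (κ₁ ^ m * X) ^ τ₁ * (κ₃ ^ m * X) ^ τ₂ = (κ ^ m * X) ^ 2 := by
  rw [Real.mul_rpow (by positivity) hX, Real.mul_rpow (by positivity) hX,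
    ← Real.rpow_pow_comm hκ₁, ← Real.rpow_pow_comm hκ₃]
  have hXX : X ^ τ₁ * X ^ τ₂ = X ^ 2 := by
    rw [← Real.rpow_add_of_nonneg hX hτ₁ hτ₂, hτ, Real.rpow_two]
  calc _ = (κ₁ ^ τ₁ * κ₃ ^ τ₂) ^ m * (X ^ τ₁ * X ^ τ₂) := by rw [mul_pow]; ring
    _ = _ := by rw [h, hXX]; ring

/-- The mean square error of the inner rule is `O(1 / n)`, uniformly in the dimension. -/
theorem exists_bound_inner_error {k : ℕ} {Γ : Matrix (Fin k) (Fin k) ℝ} (hΓ : Γ.PosDef)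
    {μ C β p : ℝ} (hμ : 0 < μ) (hC : 1 ≤ C) (hβ : 1 ≤ β) (hp : 0 < p) (hp' : p ≤ 2 / 3)
    (hβp : β * p < 1) {b : ℕ → ℝ} (hb : ∀ j, 0 ≤ b j) (hsum : Summable fun j => b j ^ p)
    {K : ℝ} (hK : 0 < K) {δ : ℝ} (hδ : 0 < δ) (hδ' : δ < 1 / 2) :
    ∃ W : ℝ, 0 ≤ W ∧ ∀ (s : ℕ) (G : (Fin s → ℝ) → EuclideanSpace ℝ (Fin k)),
      ContDiffOn ℝ ∞ G (paramBox s) →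
      (∀ θ ∈ paramBox s, ∀ ν : Fin s → ℕ, ‖mixedPartial ν G (paramBox s) θ‖ ≤
        C * (((∑ j, ν j)! : ℕ) : ℝ) ^ β * ∏ j : Fin s, b j ^ ν j) →
      ∀ (ℓ : ℕ) (z : Fin s → ℕ), IsCBCVector (2 ^ ℓ) (podWeight s C β μ δ b) z →
      ∀ x ∈ unitCube k, ∫ Δ, (innerRule Γ G K (2 ^ ℓ) z Δ x - innerIntegral Γ G K x) ^ 2
        ∂uniformCube s ≤ W / 2 ^ ℓ := by
  set lam := 1 / (2 - 2 * δ) with hlam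
  have hlam1 : 1 / 2 < lam := by
    rw [hlam, div_lt_div_iff₀ (by norm_num) (by linarith)]
    linarith
  have hlam2 : lam < 1 := by
    rw [hlam, div_lt_one (by linarith)]
    linarith
  set τ₁ := 2 / (1 + lam) with hτ₁
  have hτ₁1 : 1 ≤ τ₁ := by
    rw [hτ₁, le_div_iff₀ (by linarith)]
    linarith
  have hτ₁2 : τ₁ ≤ 4 / 3 := by
    rw [hτ₁, div_le_div_iff₀ (by linarith) (by norm_num)]
    linarith
  -- The complementary exponent. From τ₁ ≤ 4/3 it is at least 2/3, hence at least p, which is what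
  -- summability of the second family needs.
  obtain ⟨τ₂, hτ₂⟩ : ∃ τ₂, τ₂ = 2 - τ₁ := ⟨_, rfl⟩
  have hτ₂' : 2 / 3 ≤ τ₂ := by linarith
  have hρ := varrho_pos hlam1
  obtain ⟨κ₁, hκ₁⟩ : ∃ κ₁, κ₁ = podFactor C β μ δ := ⟨_, rfl⟩
  have hκ₁0 : 0 < κ₁ := by
    rw [hκ₁, podFactor, ← hlam]
    positivity
  obtain ⟨κ, hκ⟩ : ∃ κ, κ = 2 * ((1 + potentialConst Γ (K + C)) * 4) := ⟨_, rfl⟩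
  have hκ0 : 0 ≤ κ := by
    have := potentialConst_nonneg Γ (K + C)
    rw [hκ]
    positivity
  -- Solves κ₁^τ₁ κ₃^τ₂ = κ². The factor κ₁ built into the weights need not match the Gevrey factor
  -- κ of the likelihood: any mismatch goes into κ₃, because sums of such weights converge for every
  -- geometric factor.
  obtain ⟨κ₃, hκ₃⟩ : ∃ κ₃, κ₃ = (κ ^ 2 / κ₁ ^ τ₁) ^ (1 / τ₂) := ⟨_, rfl⟩
  have hκ₃0 : 0 ≤ κ₃ := by
    rw [hκ₃]
    positivity
  have hκκ : κ₁ ^ τ₁ * κ₃ ^ τ₂ = κ ^ 2 := by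
    have : 0 < κ₁ ^ τ₁ := by positivity
    rw [hκ₃, ← Real.rpow_mul (by positivity), one_div_mul_cancel (by linarith), Real.rpow_one]
    field_simp
  obtain ⟨B₁, hB₁0, hB₁⟩ := exists_bound_sum_pod hp hβp hb hsum hκ₁0.le
    (by linarith : p ≤ τ₁)
  obtain ⟨B₃, hB₃0, hB₃⟩ := exists_bound_sum_pod hp hβp hb hsum hκ₃0 (by linarith : p ≤ τ₂)
  have hA := normConst_pos hΓ
  refine ⟨(normConst Γ ^ 2 * B₃) * (2 * B₁), by positivity, fun s G hG hbd ℓ z hz x hx => ?_⟩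
  have hprod : ∀ u : Finset (Fin s), 0 ≤ ∏ j ∈ u, b j := fun u =>
    Finset.prod_nonneg fun j _ => hb j
  have hpow : ∀ (t : ℝ) (u : Finset (Fin s)), (u.card ! : ℝ) ^ β * ∏ j ∈ u, (t * b j) =
      t ^ u.card * ((u.card ! : ℝ) ^ β * ∏ j ∈ u, b j) := fun t u => by
    rw [Finset.prod_mul_distrib, Finset.prod_const]
    ring
  have hγ : ∀ u, podWeight s C β μ δ b u =
      ((u.card ! : ℝ) ^ β * ∏ j ∈ u, (κ₁ * b j)) ^ τ₁ := fun u => by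
    rw [podWeight_eq, hκ₁]
  have hbase : ∀ (t : ℝ) (u : Finset (Fin s)), 0 ≤ t →
      0 ≤ (u.card ! : ℝ) ^ β * ∏ j ∈ u, (t * b j) := fun t u ht => by
    have := hprod u
    rw [hpow]
    positivity
  have hγ0 : ∀ u, 0 ≤ podWeight s C β μ δ b u := fun u => by
    rw [hγ]
    exact Real.rpow_nonneg (hbase _ u hκ₁0.le) _
  obtain ⟨hsmooth, hgev⟩ := gevreyBound_likelihood (b := fun j : Fin s => b j) hΓ
    (by linarith : 0 ≤ C) hβ (fun j => hb j) hG hbd hK.le (y := fun i => 2 * K * x i - K)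
    (abs_scale_le hK hx)
  rw [← hκ] at hgev
  rw [paramBox_eq_shiftedCube] at hsmooth hgev
  have hn : 0 < 2 ^ ℓ := by positivity
  have hmain := integral_sq_error_le_of_contDiffOn (-(1 / 2)) hsmooth hn z
    (γ := podWeight s C β μ δ b)
    (M := fun u => normConst Γ * κ ^ u.card * (u.card ! : ℝ) ^ β * ∏ j ∈ u, b j)
    (N := fun u => normConst Γ ^ 2 * ((u.card ! : ℝ) ^ β * ∏ j ∈ u, (κ₃ * b j)) ^ τ₂)
    hγ0 (fun u => mul_nonneg (sq_nonneg _) (Real.rpow_nonneg (hbase _ u hκ₃0) _))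
    (fun u => by
      have h := rpow_mul_rpow_eq_sq (X := (u.card ! : ℝ) ^ β * ∏ j ∈ u, b j) hκ₁0.le hκ₃0
        (mul_nonneg (by positivity) (hprod u))
        (by linarith : 0 ≤ τ₁) (by linarith : 0 ≤ τ₂) (by linarith) hκκ u.card
      rw [hγ, hpow, hpow]
      refine le_of_eq ?_
      calc _ = normConst Γ ^ 2 * (κ ^ u.card * ((u.card ! : ℝ) ^ β * ∏ j ∈ u, b j)) ^ 2 := by ring
        _ = _ := by rw [← h]; ring)
    hgev
  refine hmain.trans ?_
  have hcbc := shiftAveragedErrorSq_le_of_isCBCVector ℓ _ hγ0 z hz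
  have hfil : ∀ f : Finset (Fin s) → ℝ, (∀ u, 0 ≤ f u) →
      ∑ u ∈ (Finset.univ : Finset (Fin s)).powerset with u.Nonempty, f u ≤
        ∑ u ∈ (Finset.univ : Finset (Fin s)).powerset, f u := fun f hf =>
    Finset.sum_le_sum_of_subset_of_nonneg (Finset.filter_subset _ _) fun u _ _ => hf u
  have hN : ∑ u ∈ (Finset.univ : Finset (Fin s)).powerset with u.Nonempty,
      normConst Γ ^ 2 * ((u.card ! : ℝ) ^ β * ∏ j ∈ u, (κ₃ * b j)) ^ τ₂ ≤
        normConst Γ ^ 2 * B₃ := by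
    rw [← Finset.mul_sum]
    refine mul_le_mul_of_nonneg_left ((hfil _ fun u => ?_).trans (hB₃ s)) (sq_nonneg _)
    exact Real.rpow_nonneg (hbase _ u hκ₃0) _
  have hE : shiftAveragedErrorSq (2 ^ ℓ) (podWeight s C β μ δ b) Finset.univ z ≤
      2 / 2 ^ ℓ * B₁ := by
    refine hcbc.trans (mul_le_mul_of_nonneg_left ?_ (by positivity))
    refine (hfil _ fun u => mul_nonneg (hγ0 u) (by positivity)).trans
      (le_trans (Finset.sum_le_sum fun u _ => ?_) (hB₁ s))
    rw [hγ]
    exact mul_le_of_le_one_right (Real.rpow_nonneg (hbase _ u hκ₁0.le) _)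
      (pow_le_one₀ (by norm_num) (by norm_num))
  have hNB : 0 ≤ normConst Γ ^ 2 * B₃ := by positivity
  have hN0 : 0 ≤ ∑ u ∈ (Finset.univ : Finset (Fin s)).powerset with u.Nonempty,
      normConst Γ ^ 2 * ((u.card ! : ℝ) ^ β * ∏ j ∈ u, (κ₃ * b j)) ^ τ₂ :=
    Finset.sum_nonneg fun u _ => mul_nonneg (sq_nonneg _) (Real.rpow_nonneg (hbase _ u hκ₃0) _)
  calc _ ≤ (∑ u ∈ (Finset.univ : Finset (Fin s)).powerset with u.Nonempty,
          normConst Γ ^ 2 * ((u.card ! : ℝ) ^ β * ∏ j ∈ u, (κ₃ * b j)) ^ τ₂) *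
          (2 / 2 ^ ℓ * B₁) := mul_le_mul_of_nonneg_left hE hN0
    _ ≤ normConst Γ ^ 2 * B₃ * (2 / 2 ^ ℓ * B₁) :=
        mul_le_mul_of_nonneg_right hN (by positivity)
    _ = _ := by ring

/-- The parameter enters the likelihood only through the shift y - G(θ). Each inner quadrature point
therefore contributes a translate of one fixed Gaussian, which removes s from the smoothness of the
outer integrand. -/
theorem innerRule_eq_translateAverage {k s : ℕ} {Γ : Matrix (Fin k) (Fin k) ℝ}
    {G : (Fin s → ℝ) → EuclideanSpace ℝ (Fin k)} {K : ℝ} (hK : 0 < K) (n : ℕ)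
    (z : Fin s → ℕ) (Δ : Fin s → ℝ) (x : Fin k → ℝ) :
    innerRule Γ G K n z Δ x = translateAverage (fun v => noiseDensity Γ ((2 * K) • v)) n
      (fun i l => (K + G (clampShift (-(1 / 2)) (shiftedLatticePoint n z Δ i)) l) / (2 * K)) x := by
  unfold innerRule latticeRule translateAverage
  congr 1
  refine Finset.sum_congr rfl fun i _ => ?_
  simp only [unitLikelihood_eq_noiseDensity]
  congr 1
  ext l
  simp only [Pi.smul_apply, Pi.sub_apply, smul_eq_mul]
  field_simp
  ring

/-- The mean square error of the outer rule is `O(1 / n)`, uniformly in the inner rule. -/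
theorem exists_bound_outer_error {k : ℕ} {Γ : Matrix (Fin k) (Fin k) ℝ}
    {C K c₀ : ℝ} (hK : 0 < K) (hc₀ : 0 < c₀)
    (hval : ∀ v : Fin k → ℝ, (∀ l, |v l| ≤ 3 * K + C) →
      noiseDensity Γ v ∈ Set.Icc c₀ (normConst Γ))
    {γ : Finset (Fin k) → ℝ} (hγ : ∀ u, 0 < γ u) :
    ∃ V : ℝ, 0 ≤ V ∧ ∀ (s : ℕ) (G : (Fin s → ℝ) → EuclideanSpace ℝ (Fin k)),
      (∀ θ ∈ paramBox s, ‖G θ‖ ≤ C) →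
      ∀ (ℓ : ℕ) (z₁ : Fin k → ℕ) (z₂ : Fin s → ℕ), IsCBCVector (2 ^ ℓ) γ z₁ →
      ∀ Δ₂ : Fin s → ℝ, ∫ Δ₁, (latticeRule (2 ^ ℓ) z₁ Δ₁
        (fun x => xlogx (innerRule Γ G K (2 ^ ℓ) z₂ Δ₂ x)) -
        ∫ x, xlogx (innerRule Γ G K (2 ^ ℓ) z₂ Δ₂ x) ∂uniformCube k) ^ 2 ∂uniformCube k ≤
          V / 2 ^ ℓ := by
  have hF : ContDiff ℝ ∞ fun v : Fin k → ℝ => noiseDensity Γ ((2 * K) • v) :=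
    (contDiff_noiseDensity Γ).comp (contDiff_const_smul (2 * K))
  -- In unit-cube coordinates the translations are at most R = (K + C)/(2K), so the arguments are at
  -- most 1 + R; scaling back by 2K gives the radius 3K + C.
  obtain ⟨M, hM0, hM⟩ := exists_bound_setPartial_xlogx_translateAverage hF
    (R := (K + C) / (2 * K)) hc₀ fun v hv => hval _ fun l => by
      rw [Pi.smul_apply, smul_eq_mul, abs_mul, abs_of_pos (by positivity : 0 < 2 * K)]
      calc _ ≤ 2 * K * (1 + (K + C) / (2 * K)) :=
            mul_le_mul_of_nonneg_left (hv l) (by positivity)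
        _ = 3 * K + C := by field_simp; ring
  have hγ0 : ∀ u, 0 ≤ γ u := fun u => (hγ u).le
  refine ⟨(∑ u ∈ (Finset.univ : Finset (Fin k)).powerset with u.Nonempty, M ^ 2 / γ u) *
    (2 * ∑ u ∈ (Finset.univ : Finset (Fin k)).powerset with u.Nonempty,
      γ u * (1 / 6) ^ u.card), ?_, fun s G hGC ℓ z₁ z₂ hz Δ₂ => ?_⟩
  · exact mul_nonneg (Finset.sum_nonneg fun u _ => div_nonneg (sq_nonneg _) (hγ0 u))
      (mul_nonneg zero_le_two (Finset.sum_nonneg fun u _ => mul_nonneg (hγ0 u) (by positivity)))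
  have hn : 0 < 2 ^ ℓ := by positivity
  obtain ⟨hsmooth, hbd⟩ := hM (2 ^ ℓ) hn
    (fun i l => (K + G (clampShift (-(1 / 2)) (shiftedLatticePoint (2 ^ ℓ) z₂ Δ₂ i)) l) /
      (2 * K)) fun i l => by
        rw [abs_div, abs_of_pos (by positivity : 0 < 2 * K)]
        refine div_le_div_of_nonneg_right ((abs_add_le _ _).trans (add_le_add (abs_of_pos hK).le
          (abs_apply_le_of_norm_le (hGC _ (clampShift_mem_paramBox _)) l))) (by positivity)
  simp only [← innerRule_eq_translateAverage hK] at hsmooth hbd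
  have hmain := integral_sq_error_le_of_contDiffOn 0 hsmooth hn z₁ (γ := γ) (M := fun _ => M)
    (N := fun u => M ^ 2 / γ u) hγ0 (fun u => div_nonneg (sq_nonneg _) (hγ0 u))
    (fun u => by
      have := (hγ u).ne'
      refine le_of_eq ?_
      field_simp) hbd
  have hclamp : ∀ x ∈ unitCube k, clampShift 0 x = x := fun x hx => by
    rw [clampShift_eq 0 hx]
    simp only [add_zero]
  have h1 : ∀ Δ₁, latticeRule (2 ^ ℓ) z₁ Δ₁
      (fun x => xlogx (innerRule Γ G K (2 ^ ℓ) z₂ Δ₂ (clampShift 0 x))) =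
        latticeRule (2 ^ ℓ) z₁ Δ₁ (fun x => xlogx (innerRule Γ G K (2 ^ ℓ) z₂ Δ₂ x)) := fun Δ₁ =>
    latticeRule_congr z₁ Δ₁ fun x hx => by rw [hclamp x hx]
  have h2 : ∫ x, xlogx (innerRule Γ G K (2 ^ ℓ) z₂ Δ₂ (clampShift 0 x)) ∂uniformCube k =
      ∫ x, xlogx (innerRule Γ G K (2 ^ ℓ) z₂ Δ₂ x) ∂uniformCube k :=
    integral_congr_ae ((ae_mem_unitCube k).mono fun x hx => by simp only [hclamp x hx])
  simp only [h1, h2] at hmain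
  refine hmain.trans ?_
  have hcbc := shiftAveragedErrorSq_le_of_isCBCVector ℓ γ hγ0 z₁ hz
  refine (mul_le_mul_of_nonneg_left hcbc
    (Finset.sum_nonneg fun u _ => div_nonneg (sq_nonneg _) (hγ0 u))).trans_eq ?_
  ring

theorem norm_le_of_mixedPartial_le {k s : ℕ} {C β : ℝ} {b : Fin s → ℝ}
    {G : (Fin s → ℝ) → EuclideanSpace ℝ (Fin k)} (hG : ContDiffOn ℝ ∞ G (paramBox s))
    (hbd : ∀ θ ∈ paramBox s, ∀ ν : Fin s → ℕ, ‖mixedPartial ν G (paramBox s) θ‖ ≤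
      C * (((∑ j, ν j)! : ℕ) : ℝ) ^ β * ∏ j : Fin s, b j ^ ν j) :
    ∀ θ ∈ paramBox s, ‖G θ‖ ≤ C := fun θ hθ => by
  have := norm_setPartial_le_of_mixedPartial hG hbd ∅ hθ
  simpa [setPartial_empty] using this

end BayesQMC

/-! ### The main theorem: combining the inner and outer errors. -/

theorem mainTheorem6
    {k : ℕ} (hk : 0 < k)
    (Γ : Matrix (Fin k) (Fin k) ℝ) (hΓ : Γ.PosDef)
    (μmin : ℝ) (hμ_pos : 0 < μmin) (hμ_le : μmin ≤ 1)
    (hμ_eig : ∀ μ : ℝ, Module.End.HasEigenvalue (Matrix.toLin' Γ) μ → μmin ≤ μ)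
    (C β p : ℝ) (hC : 1 ≤ C) (hβ : 1 ≤ β)
    (hp_pos : 0 < p) (hp_le : p ≤ min (2 / 3) (1 / β)) (hp_ne : p ≠ 1 / β)
    (b : ℕ → ℝ) (hb_nonneg : ∀ j, 0 ≤ b j) (hb_sum : Summable fun j => b j ^ p)
    {Ξ : Type*} (G : (s : ℕ) → (Fin s → ℝ) → Ξ → EuclideanSpace ℝ (Fin k))
    (hG_smooth : ∀ s : ℕ, 0 < s → ∀ ξ : Ξ,
      ContDiffOn ℝ ∞ (fun θ => G s θ ξ) (BayesQMC.paramBox s))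
    (hG_bound : ∀ s : ℕ, 0 < s → ∀ ξ : Ξ, ∀ θ ∈ BayesQMC.paramBox s, ∀ ν : Fin s → ℕ,
      ‖BayesQMC.mixedPartial ν (fun θ' => G s θ' ξ) (BayesQMC.paramBox s) θ‖ ≤
        C * (((∑ j, ν j)! : ℕ) : ℝ) ^ β * ∏ j : Fin s, b j ^ ν j)
    (K : ℝ) (hK : 0 < K)
    (γ₁ : Finset (Fin k) → ℝ) (hγ₁ : ∀ u, 0 < γ₁ u)
    (δ' : ℝ) (hδ'_pos : 0 < δ') (hδ'_lt : δ' < 1 / 2)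
    (δ : ℝ) (hδ_pos : 0 < δ) :
    ∃ Cerr : ℝ, 0 < Cerr ∧
      ∀ s : ℕ, 0 < s → ∀ (ξ : Ξ) (ℓ : ℕ) (z₁ : Fin k → ℕ) (z₂ : Fin s → ℕ),
        BayesQMC.IsCBCVector (2 ^ ℓ) γ₁ z₁ →
        BayesQMC.IsCBCVector (2 ^ ℓ) (BayesQMC.podWeight s C β μmin δ' b) z₂ →
        BayesQMC.fullTensorRMSError Γ (fun θ => G s θ ξ) K (2 ^ ℓ) z₁ z₂ ≤
          ENNReal.ofReal (Cerr * ((2 : ℝ) ^ ℓ) ^ (-(1 / 2) + δ)) := by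
  have hβ0 : 0 < β := by linarith
  have hβp : β * p < 1 := by
    have h1 : p < 1 / β := lt_of_le_of_ne (hp_le.trans (min_le_right _ _)) hp_ne
    rwa [lt_div_iff₀ hβ0, mul_comm] at h1
  -- The actual residuals are at most K + C. The larger radius is the one required for the outer
  -- derivative bounds, so one c₀ serves both purposes.
  obtain ⟨c₀, hc₀, hval⟩ := BayesQMC.exists_noiseDensity_mem_Icc hΓ (3 * K + C)
  obtain ⟨L, hL0, hL⟩ := BayesQMC.exists_lipschitz_xlogx (M := BayesQMC.normConst Γ) hc₀
  obtain ⟨W, hW0, hW⟩ := BayesQMC.exists_bound_inner_error hΓ hμ_pos hC hβ hp_pos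
    (hp_le.trans (min_le_left _ _)) hβp hb_nonneg hb_sum hK hδ'_pos hδ'_lt
  obtain ⟨V, hV0, hV⟩ := BayesQMC.exists_bound_outer_error hK hc₀ hval hγ₁
  -- The added 1 only ensures that the constant is strictly positive.
  refine ⟨(2 * K) ^ k * Real.sqrt (2 * V + 2 * (L ^ 2 * W)) + 1, by positivity,
    fun s hs ξ ℓ z₁ z₂ hz₁ hz₂ => ?_⟩
  have hG := hG_smooth s hs ξ
  have hbd := hG_bound s hs ξ
  have hGC := BayesQMC.norm_le_of_mixedPartial_le hG hbd
  have hpos : (0 : ℝ) < 2 ^ ℓ := by positivity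
  refine (BayesQMC.fullTensorRMSError_le hK hG hGC
    (fun v hv => hval v fun l => (hv l).trans (by linarith)) hL (by positivity) z₁ z₂
    (hV s _ hGC ℓ z₁ z₂ hz₁) (hW s _ hG hbd ℓ z₂ hz₂)).trans (ENNReal.ofReal_le_ofReal ?_)
  have hsq : 2 * (V / 2 ^ ℓ) + 2 * (L ^ 2 * (W / 2 ^ ℓ)) =
      (2 * V + 2 * (L ^ 2 * W)) / 2 ^ ℓ := by ring
  -- The proven rate is n^(-1/2); since n ≥ 1, raising the exponent by δ weakens it.
  have hrate : 1 / Real.sqrt (2 ^ ℓ) ≤ ((2 : ℝ) ^ ℓ) ^ (-(1 / 2) + δ) := by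
    rw [one_div, Real.sqrt_eq_rpow, ← Real.rpow_neg hpos.le]
    exact Real.rpow_le_rpow_of_exponent_le (one_le_pow₀ one_le_two) (by linarith)
  rw [hsq, Real.sqrt_div' _ hpos.le]
  calc _ = (2 * K) ^ k * Real.sqrt (2 * V + 2 * (L ^ 2 * W)) * (1 / Real.sqrt (2 ^ ℓ)) := by ring
    _ ≤ ((2 * K) ^ k * Real.sqrt (2 * V + 2 * (L ^ 2 * W)) + 1) *
          ((2 : ℝ) ^ ℓ) ^ (-(1 / 2) + δ) := by
        refine mul_le_mul (by linarith) hrate (by positivity) (by positivity)
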